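/- **Setting.** A spin chain $\mathcal A$ assigns to every $j\in\mathbb Z$ a matrix algebra $\mathcal A_j=\mathrm{End}(\mathbb C^{d_j})$ with $1\le d_j\le d_{\max}$; $\mathcal A$ is the C*-algebraic inductive limit of the algebras $\bigotimes_{j\in S}\mathcal A_j$, $S\subset\mathbb Z$ finite, with subalgebras $\mathcal A_X$, $X\subset\mathbb Z$. The stack $\mathcal A\otimes\mathcal B$ has on-site algebras $\mathcal A_j\otimes\mathcal B_j$. A $*$-automorphism $\alpha$ of $\mathcal A$ has range at most $r$ if $\alpha(\mathcal A_X)\subset\mathcal A_{\{j:\,\mathrm{dist}(j,X)\le r\}}$ for all $X$; it is a QCA if this holds for some $r$. Given a partition of $\mathbb Z$ into intervals $I_a$ of bounded size and unitaries $U_a\in\mathcal A_{I_a}$, $\bigotimes_a\mathrm{Ad}(U_a)$ is called block partitioned; a finite depth quantum circuit (FDQC) is a finite composition of block partitioned QCAs. Let $G$ be a finite group, $\bar g=g^{-1}$. A symmetry is a homomorphism $\alpha$ from $G$ to the QCAs of some spin chain; it is decoupled if all $\alpha^{(g)}$ are block partitioned with blocks independent of $g$. Symmetries $\alpha,\beta$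 are stably equivalent, $\alpha\sim\beta$, if there are symmetries $\alpha',\beta'$ of range $0$ and an FDQC $\gamma$ with $(\beta\otimes\beta')^{(g)}=\gamma^{-1}\circ(\alpha\otimes\alpha')^{(g)}\circ\gamma$ for all $g$ (the two chains being identified through an isomorphism that maps on-site algebras to on-site algebras). A right restriction of $\alpha$ at the site $j$ with defect size $L$ is a family of $*$-automorphisms $\alpha_\ge^{(g)}$, $g\in G$, equal to $\alpha^{(g)}$ on $\mathcal A_{[j+L,\infty)}$ and to the identity on $\mathcal A_{(-\infty,j-L-1]}$. It is covariant if $\alpha^{(k)}\circ\alpha_\ge^{(\bar kgk)}\circ\alpha^{(\bar k)}=\alpha_\ge^{(g)}$ for all $g,k$. Its fusion operators are local unitaries $\Phi(g,h)$ with $\alpha_\ge^{(g)}\circ\alpha_\ge^{(h)}=\mathrm{Ad}[\Phi(g,h)]\circ\alpha_\ge^{(gh)}$; its crossing operators are local unitaries $X_g(k)$ with $\alpha^{(k)}\circ\alpha_\ge^{(\bar kgk)}\circ\alpha^{(\bar k)}\circ(\alpha_\ge^{(g)})^{-1}=\mathrm{Ad}[X_g(k)]$, and phases $\lambda_g(k,l)$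 are given by $\alpha^{(k)}(X_{\bar kgk}(l))\,X_g(k)=\lambda_g(k,l)\,X_g(kl)$. Let $U(1)[G]$ and $U(1)[G^2]$ be the $G$-modules of maps $G\to U(1)$, $G^2\to U(1)$ with $(k\cdot\lambda)_g=\lambda_{\bar kgk}$ and $(k\cdot\mu)_{g,h}=\mu_{\bar kgk,\bar khk}$. The phases $\lambda$ form a 2-cocycle; write $\Lambda(\alpha)=[1]$ if $[\lambda]=[1]\in H^2(G,U(1)[G])$ for some right restriction of $\alpha$ and some choice of crossing operators. Let $\iota:H^1(G,U(1)[G])\to H^1(G,U(1)[G^2])$ be induced by $\theta\mapsto\big((g,h)\mapsto\theta_g\theta_h/\theta_{gh}\big)$ and $\mathfrak K=H^1(G,U(1)[G^2])/\iota(H^1(G,U(1)[G]))$. Let $\rho_{\mathrm{reg}}$ be the symmetry on the chain with on-site Hilbert spaces $\mathbb C[G]$ that acts at each site by conjugation with the left regular representation. **Proposition.** (a) Every right restriction at $j$ with defect size $L$ of a symmetry of range at most $R$ has fusion operators, which can be chosen in $\mathcal A_{[j-L,j+L+R]}$. For a covariant right restriction of a symmetry $\alpha$ with fusion operators $\Phi$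 there are unique phases $\mu_{g,h}(k)\in U(1)$ with $$\alpha^{(k)}\big(\Phi(\bar kgk,\bar khk)\big)=\mu_{g,h}(k)\,\Phi(g,h),$$ and $\mu_{g,h}(kl)=\mu_{g,h}(k)\,\mu_{\bar kgk,\bar khk}(l)$, so $\mu$ is a twisted 1-cocycle and defines a class $[\mu]\in\mathfrak K$. The abelian group $\mathfrak K$ is finite. (b) There is a map $\Upsilon$ from the symmetries with $\Lambda=[1]$ to $\mathfrak K$ such that, for every such $\alpha$: the symmetry $\alpha\otimes\rho_{\mathrm{reg}}$ has a covariant right restriction, and for every covariant right restriction of $\alpha\otimes\rho_{\mathrm{reg}}$, at any site, with any defect size and any choice of fusion operators, $[\mu]=\Upsilon(\alpha)$. If $\alpha$ itself has a covariant right restriction, then any such (with any choice of fusion operators) likewise gives $[\mu]=\Upsilon(\alpha)$. (c) If $\alpha$ is decoupled, then $\Lambda(\alpha)=[1]$ and $\Upsilon(\alpha)=[1]$. (d) If $\alpha,\beta$ with $\Lambda(\alpha)=\Lambda(\beta)=[1]$ act on the same chain, both have range at most $R$, and $\alpha^{(g)}|_{\mathcal A_I}=\beta^{(g)}|_{\mathcal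 A_I}$ for all $g$ on some interval $I$ of $12R+1$ sites, then $\Upsilon(\alpha)=\Upsilon(\beta)$. (e) If $\Lambda(\alpha)=\Lambda(\beta)=[1]$, then $\Lambda(\alpha\otimes\beta)=[1]$ and $\Upsilon(\alpha\otimes\beta)=\Upsilon(\alpha)\Upsilon(\beta)$. (f) If $\Lambda(\alpha)=\Lambda(\beta)=[1]$ and $\alpha\sim\beta$, then $\Upsilon(\alpha)=\Upsilon(\beta)$. (g) Consequently the quotient by $\sim$ of the set of symmetries with $\Lambda=[1]$ is a commutative monoid under stacking, with unit the class of the trivial symmetry on the chain with all $d_j=1$, and $\Upsilon$ induces a homomorphism of monoids from it to $\mathfrak K$. -/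

import Mathlib

open scoped ENNReal InnerProductSpace Kronecker

namespace SpinChains

/-- A spin chain: to every site `j` of `ℤ` is associated a finite dimensional Hilbert space
`ℂ^(site j)`, given through the finite nonempty set `site j` labelling its standard basis; the
dimensions are uniformly bounded. -/
structure SpinChain where
  site : ℤ → Type
  [fintypeSite : ∀ j, Fintype (site j)]
  [decEqSite : ∀ j, DecidableEq (site j)]
  [nonemptySite : ∀ j, Nonempty (site j)]
  bounded : ∃ d : ℕ, ∀ j, Fintype.card (site j) ≤ d

attribute [instance] SpinChain.fintypeSite SpinChain.decEqSite SpinChain.nonemptySite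

namespace SpinChain

variable (A : SpinChain)

/-- Classical configurations, labelling the product basis. -/
abbrev Config : Type := ∀ j, A.site j

/-- The Hilbert space `ℓ²` with the product configurations as orthonormal basis. All local operators
act on it, which gives a faithful representation of every `A_S`, `S` finite. -/
abbrev Hilb : Type := lp (fun _ : A.Config => ℂ) 2

/-- The on-site algebra `End(ℂ^(site j))`. -/
abbrev OnSite (j : ℤ) : Type := Matrix (A.site j) (A.site j) ℂ

/-- The involution `(σ, s) ↦ (σ with σ j replaced by s, σ j)`. -/
def flip (j : ℤ) : A.Config × A.site j ≃ A.Config × A.site j where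
  toFun p := (Function.update p.1 j p.2, p.1 j)
  invFun p := (Function.update p.1 j p.2, p.1 j)
  left_inv p := by simp
  right_inv p := by simp

theorem summable_flip (j : ℤ) {f : A.Config → ℝ} (hf : Summable f) :
    Summable fun p : A.Config × A.site j => f (Function.update p.1 j p.2) := by
  have h : Summable fun p : A.Config × A.site j => f p.1 := by
    have h1 : Summable fun p : A.site j × A.Config => f p.2 := by
      rw [← (Equiv.sigmaEquivProd _ _).summable_iff]
      have : ∀ s : A.site j, Summable fun c : A.Config => f c := fun _ => hf
      rw [← summable_abs_iff]
      refine (summable_sigma_of_nonneg (fun _ => abs_nonneg _)).2 ⟨fun s => ?_, ?_⟩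
      · simpa using hf.abs
      · exact Summable.of_finite
    exact (Equiv.prodComm _ _).summable_iff.1 h1
  exact (A.flip j).summable_iff.2 h

theorem summable_sq (ψ : A.Hilb) : Summable fun σ => ‖ψ σ‖ ^ 2 := by
  have := lp.memℓp ψ
  rw [memℓp_gen_iff (by norm_num)] at this
  simpa using this

theorem norm_sq_eq (ψ : A.Hilb) : ‖ψ‖ ^ 2 = ∑' σ, ‖ψ σ‖ ^ 2 := by
  have := lp.norm_rpow_eq_tsum (p := 2) (by norm_num) ψ
  simpa using this

/-- The function `σ ↦ ∑ₛ a (σ j) s ψ(σ with σ j replaced by s)`. -/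
noncomputable def onsiteFun (j : ℤ) (a : A.OnSite j) (ψ : A.Config → ℂ) (σ : A.Config) : ℂ :=
  ∑ s, a (σ j) s * ψ (Function.update σ j s)

/-- A bound for the entries of a matrix. -/
noncomputable def entryBound (j : ℤ) (a : A.OnSite j) : ℝ := ∑ s, ∑ t, ‖a s t‖

theorem le_entryBound (j : ℤ) (a : A.OnSite j) (s t : A.site j) : ‖a s t‖ ≤ A.entryBound j a :=
  (Finset.single_le_sum (f := fun t => ‖a s t‖) (fun _ _ => norm_nonneg _)
    (Finset.mem_univ t)).trans
  (Finset.single_le_sum (f := fun s => ∑ t, ‖a s t‖)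
    (fun _ _ => Finset.sum_nonneg fun _ _ => norm_nonneg _) (Finset.mem_univ s))

theorem onsiteFun_sq_le (j : ℤ) (a : A.OnSite j) (ψ : A.Config → ℂ) (σ : A.Config) :
    ‖A.onsiteFun j a ψ σ‖ ^ 2 ≤ (A.entryBound j a) ^ 2 * (Fintype.card (A.site j)) *
      ∑ s, ‖ψ (Function.update σ j s)‖ ^ 2 := by
  have h0 : 0 ≤ A.entryBound j a :=
    Finset.sum_nonneg fun _ _ => Finset.sum_nonneg fun _ _ => norm_nonneg _
  have h1 : ‖A.onsiteFun j a ψ σ‖ ≤ A.entryBound j a * ∑ s, ‖ψ (Function.update σ j s)‖ := by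
    refine (norm_sum_le _ _).trans ?_
    rw [Finset.mul_sum]
    refine Finset.sum_le_sum fun s _ => ?_
    rw [norm_mul]
    exact mul_le_mul_of_nonneg_right (A.le_entryBound j a _ _) (norm_nonneg _)
  have h2 := sq_sum_le_card_mul_sum_sq (s := Finset.univ)
    (f := fun s => ‖ψ (Function.update σ j s)‖)
  calc _ ≤ (A.entryBound j a * ∑ s, ‖ψ (Function.update σ j s)‖) ^ 2 := by gcongr
    _ = (A.entryBound j a) ^ 2 * (∑ s, ‖ψ (Function.update σ j s)‖) ^ 2 := by ring
    _ ≤ (A.entryBound j a) ^ 2 * (Fintype.card (A.site j) *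
        ∑ s, ‖ψ (Function.update σ j s)‖ ^ 2) := by
      gcongr
      simpa using h2
    _ = _ := by ring

theorem summable_flip_sum (j : ℤ) (ψ : A.Hilb) :
    Summable fun σ => ∑ s, ‖ψ (Function.update σ j s)‖ ^ 2 := by
  have := (A.summable_flip j (A.summable_sq ψ)).prod
  simpa [tsum_fintype] using this

theorem tsum_flip_sum (j : ℤ) (ψ : A.Hilb) :
    ∑' σ, ∑ s, ‖ψ (Function.update σ j s)‖ ^ 2 = Fintype.card (A.site j) * ‖ψ‖ ^ 2 := by
  have hs := A.summable_flip j (A.summable_sq ψ)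
  have hs' : Summable fun p : A.Config × A.site j => ‖ψ p.1‖ ^ 2 :=
    (A.flip j).summable_iff.1 hs
  have h1 := hs.tsum_prod
  have h2 := hs'.tsum_prod
  have h3 := (A.flip j).tsum_eq (fun p : A.Config × A.site j => ‖ψ p.1‖ ^ 2)
  simp only [tsum_fintype, Finset.sum_const, Finset.card_univ, nsmul_eq_mul, tsum_mul_left] at h1 h2
  rw [← h1, A.norm_sq_eq, ← h2, ← h3]
  rfl

/-- The on-site operator as a linear map. -/
noncomputable def onsiteLin (j : ℤ) (a : A.OnSite j) : A.Hilb →ₗ[ℂ] A.Hilb where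
  toFun := fun ψ => ⟨A.onsiteFun j a ψ, by
        refine memℓp_gen ?_
        simp only [ENNReal.toReal_ofNat, Real.rpow_ofNat]
        exact Summable.of_nonneg_of_le (fun _ => by positivity) (A.onsiteFun_sq_le j a ψ)
          ((A.summable_flip_sum j ψ).mul_left _)⟩
  map_add' := fun ψ φ => by
        ext σ
        simp only [onsiteFun, lp.coeFn_add, Pi.add_apply, mul_add, Finset.sum_add_distrib]
  map_smul' := fun c ψ => by
        ext σ
        simp only [onsiteFun, lp.coeFn_smul, Pi.smul_apply, smul_eq_mul, Finset.mul_sum,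
          mul_left_comm, RingHom.id_apply]

theorem onsiteLin_apply (j : ℤ) (a : A.OnSite j) (ψ : A.Hilb) (σ : A.Config) :
    A.onsiteLin j a ψ σ = ∑ s, a (σ j) s * ψ (Function.update σ j s) := rfl

theorem norm_onsiteLin_le (j : ℤ) (a : A.OnSite j) (ψ : A.Hilb) :
    ‖A.onsiteLin j a ψ‖ ≤ A.entryBound j a * Fintype.card (A.site j) * ‖ψ‖ := by
  have h0 : 0 ≤ A.entryBound j a :=
    Finset.sum_nonneg fun _ _ => Finset.sum_nonneg fun _ _ => norm_nonneg _
  refine (pow_le_pow_iff_left₀ (norm_nonneg _) (by positivity) two_ne_zero).1 ?_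
  rw [A.norm_sq_eq]
  refine (Summable.tsum_le_tsum (A.onsiteFun_sq_le j a ψ)
    (A.summable_sq (A.onsiteLin j a ψ)) ((A.summable_flip_sum j ψ).mul_left _)).trans ?_
  rw [tsum_mul_left, A.tsum_flip_sum]
  apply le_of_eq
  ring

/-- The on-site operator `a ⊗ 1` on `ℓ²`. -/
noncomputable def onsiteOp (j : ℤ) (a : A.OnSite j) : A.Hilb →L[ℂ] A.Hilb :=
  (A.onsiteLin j a).mkContinuous _ (A.norm_onsiteLin_le j a)

theorem onsiteOp_apply (j : ℤ) (a : A.OnSite j) (ψ : A.Hilb) (σ : A.Config) :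
    A.onsiteOp j a ψ σ = ∑ s, a (σ j) s * ψ (Function.update σ j s) := rfl

theorem summable_flip_inner (j : ℤ) (a : A.OnSite j) (ψ φ : A.Hilb) :
    Summable fun p : A.Config × A.site j =>
      star (a (p.1 j) p.2 * ψ (Function.update p.1 j p.2)) * φ p.1 := by
  have h1 := A.summable_flip j (A.summable_sq ψ)
  have h2 : Summable fun p : A.Config × A.site j => ‖φ p.1‖ ^ 2 :=
    (A.flip j).summable_iff.1 (A.summable_flip j (A.summable_sq φ))
  refine Summable.of_norm_bounded ((h1.add h2).mul_left (A.entryBound j a)) fun p => ?_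
  have h0 : 0 ≤ A.entryBound j a :=
    Finset.sum_nonneg fun _ _ => Finset.sum_nonneg fun _ _ => norm_nonneg _
  rw [norm_mul, norm_star, norm_mul, mul_assoc]
  refine mul_le_mul (A.le_entryBound j a _ _) ?_ (by positivity) h0
  nlinarith [sq_nonneg (‖ψ (Function.update p.1 j p.2)‖ - ‖φ p.1‖),
    sq_nonneg (‖ψ (Function.update p.1 j p.2)‖), sq_nonneg ‖φ p.1‖]

theorem inner_onsiteOp_left (j : ℤ) (a : A.OnSite j) (ψ φ : A.Hilb) :
    ⟪A.onsiteOp j a ψ, φ⟫_ℂ = ∑' p : A.Config × A.site j,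
      star (a (p.1 j) p.2 * ψ (Function.update p.1 j p.2)) * φ p.1 := by
  rw [lp.inner_eq_tsum, (A.summable_flip_inner j a ψ φ).tsum_prod]
  refine tsum_congr fun σ => ?_
  simp only [tsum_fintype, RCLike.inner_apply, onsiteOp_apply, ← Finset.sum_mul]
  rw [mul_comm, map_sum]
  rfl

theorem inner_onsiteOp (j : ℤ) (a : A.OnSite j) (ψ φ : A.Hilb) :
    ⟪A.onsiteOp j a ψ, φ⟫_ℂ = ⟪ψ, A.onsiteOp j (star a) φ⟫_ℂ := by
  rw [← inner_conj_symm ψ, inner_onsiteOp_left, inner_onsiteOp_left, starRingEnd_apply, tsum_star,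
    ← (A.flip j).tsum_eq]
  refine tsum_congr fun p => ?_
  simp [flip, Matrix.star_apply]
  ring

theorem adjoint_onsiteOp (j : ℤ) (a : A.OnSite j) :
    star (A.onsiteOp j a) = A.onsiteOp j (star a) := by
  rw [ContinuousLinearMap.star_eq_adjoint, eq_comm, ContinuousLinearMap.eq_adjoint_iff]
  intro x y
  rw [inner_onsiteOp, star_star]

/-- The on-site operators `a ⊗ 1` as a star homomorphism to bounded operators on `ℓ²`. -/
noncomputable def onsiteHom (j : ℤ) : A.OnSite j →⋆ₐ[ℂ] (A.Hilb →L[ℂ] A.Hilb) where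
  toFun := A.onsiteOp j
  map_one' := by
    ext ψ σ
    simp [onsiteOp_apply, Matrix.one_apply]
  map_mul' a b := by
    ext ψ σ
    simp only [onsiteOp_apply, mul_apply_eq_comp, Matrix.mul_apply, Finset.sum_mul,
      Finset.mul_sum, Function.update_self, Function.update_idem, mul_assoc]
    exact Finset.sum_comm
  map_zero' := by
    ext ψ σ
    simp [onsiteOp_apply]
  map_add' a b := by
    ext ψ σ
    simp [onsiteOp_apply, add_mul, Finset.sum_add_distrib]
  commutes' c := by
    ext ψ σ
    simp [onsiteOp_apply, Matrix.algebraMap_matrix_apply, ContinuousLinearMap.algebraMap_apply]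
  map_star' a := (A.adjoint_onsiteOp j a).symm

theorem onsiteHom_commute {i j : ℤ} (h : i ≠ j) (a : A.OnSite i) (b : A.OnSite j) :
    Commute (A.onsiteHom i a) (A.onsiteHom j b) := by
  ext ψ σ
  change A.onsiteOp i a (A.onsiteOp j b ψ) σ = A.onsiteOp j b (A.onsiteOp i a ψ) σ
  simp only [onsiteOp_apply, Finset.mul_sum, Function.update_of_ne h, Function.update_of_ne h.symm]
  rw [Finset.sum_comm]
  refine Finset.sum_congr rfl fun t _ => Finset.sum_congr rfl fun s _ => ?_
  rw [Function.update_comm h]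
  ring

/-- The quasi-local algebra: the norm closure of the `*`-algebra of local operators, i.e. of the
`*`-algebra generated by the on-site operators. As the finite matrix algebras `A_S` are represented
faithfully, hence isometrically, this is their C*-algebraic inductive limit. -/
noncomputable def quasiLocal : StarSubalgebra ℂ (A.Hilb →L[ℂ] A.Hilb) :=
  (StarAlgebra.adjoin ℂ (⋃ j, Set.range (A.onsiteHom j))).topologicalClosure

/-- The spin chain C*-algebra. -/
abbrev Alg : Type := A.quasiLocal

instance isClosed_quasiLocal : IsClosed (A.quasiLocal : Set (A.Hilb →L[ℂ] A.Hilb)) :=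
  StarSubalgebra.isClosed_topologicalClosure _

noncomputable example : CStarAlgebra A.Alg := inferInstance

/-- The inclusion of the on-site algebra `A_j` in the chain algebra. -/
noncomputable def ofSite (j : ℤ) : A.OnSite j →⋆ₐ[ℂ] A.Alg :=
  (A.onsiteHom j).codRestrict A.quasiLocal fun a =>
    StarSubalgebra.le_topologicalClosure _
      (StarAlgebra.subset_adjoin ℂ _ (Set.mem_iUnion.2 ⟨j, a, rfl⟩))

/-- The subalgebra `A_X` of the chain: the closure of the local algebra generated by the on-site
algebras `A_j`, `j ∈ X`. -/
noncomputable def sub (X : Set ℤ) : StarSubalgebra ℂ A.Alg :=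
  (StarAlgebra.adjoin ℂ (⋃ j ∈ X, Set.range (A.ofSite j))).topologicalClosure

theorem ofSite_commute {i j : ℤ} (h : i ≠ j) (a : A.OnSite i) (b : A.OnSite j) :
    Commute (A.ofSite i a) (A.ofSite j b) :=
  Subtype.ext (A.onsiteHom_commute h a b)

section MatrixHom

open scoped TensorProduct

variable {m n : Type} [Fintype m] [DecidableEq m] [Fintype n] [DecidableEq n]
variable {C : Type*} [CStarAlgebra C]

theorem kron_induction {P : Matrix (m × n) (m × n) ℂ → Prop} (h : ∀ a b, P (a ⊗ₖ b))
    (hadd : ∀ x y, P x → P y → P (x + y)) (x : Matrix (m × n) (m × n) ℂ) : P x := by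
  obtain ⟨y, rfl⟩ := (Matrix.kroneckerStarAlgEquiv m n ℂ).surjective x
  induction y using TensorProduct.induction_on with
  | zero => simpa using h 0 0
  | tmul a b => exact h a b
  | add x y hx hy => rw [map_add]; exact hadd _ _ hx hy

/-- Commuting representations of two matrix algebras combine to a representation of the matrix
algebra on the product index set. -/
theorem exists_kronHom (f : Matrix m m ℂ →⋆ₐ[ℂ] C) (g : Matrix n n ℂ →⋆ₐ[ℂ] C)
    (h : ∀ a b, Commute (f a) (g b)) :
    ∃ k : Matrix (m × n) (m × n) ℂ →⋆ₐ[ℂ] C, ∀ a b, k (a ⊗ₖ b) = f a * g b := by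
  let e := Matrix.kroneckerAlgEquiv m n ℂ
  let k : Matrix (m × n) (m × n) ℂ →ₐ[ℂ] C :=
    (Algebra.TensorProduct.lift f.toAlgHom g.toAlgHom h).comp e.symm.toAlgHom
  have hk : ∀ a b, k (a ⊗ₖ b) = f a * g b := fun a b => by
    have : e.symm (a ⊗ₖ b) = a ⊗ₜ b := e.symm_apply_apply (a ⊗ₜ b)
    change Algebra.TensorProduct.lift f.toAlgHom g.toAlgHom h (e.symm (a ⊗ₖ b)) = _
    rw [this]
    rfl
  refine ⟨{ k with map_star' := fun x => ?_ }, hk⟩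
  change k (star x) = star (k x)
  induction x using kron_induction with
  | h a b =>
    have : star (a ⊗ₖ b) = star a ⊗ₖ star b := by
      simp [Matrix.star_eq_conjTranspose, Matrix.conjTranspose_kronecker]
    rw [this, hk, hk, star_mul, map_star, map_star]
    have := h (star a) (star b)
    rw [map_star, map_star] at this
    exact this
  | hadd x y hx hy => rw [star_add, map_add, map_add, star_add, hx, hy]

/-- Two star homomorphisms on a product matrix algebra that agree on the factors are equal. -/
theorem kron_hom_ext {k k' : Matrix (m × n) (m × n) ℂ →⋆ₐ[ℂ] C}
    (h1 : ∀ a, k (a ⊗ₖ 1) = k' (a ⊗ₖ 1)) (h2 : ∀ b, k (1 ⊗ₖ b) = k' (1 ⊗ₖ b)) : k = k' := by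
  ext x
  induction x using kron_induction with
  | h a b =>
    have : a ⊗ₖ b = (a ⊗ₖ (1 : Matrix n n ℂ)) * ((1 : Matrix m m ℂ) ⊗ₖ b) := by
      rw [← Matrix.mul_kronecker_mul, mul_one, one_mul]
    rw [this, map_mul, map_mul, h1, h2]
  | hadd x y hx hy => rw [map_add, map_add, hx, hy]

/-- The embedding `a ↦ a ⊗ 1` of matrix algebras. -/
noncomputable def kronLeft : Matrix m m ℂ →⋆ₐ[ℂ] Matrix (m × n) (m × n) ℂ where
  toFun a := a ⊗ₖ (1 : Matrix n n ℂ)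
  map_one' := Matrix.one_kronecker_one
  map_mul' a b := by rw [← Matrix.mul_kronecker_mul, mul_one]
  map_zero' := Matrix.zero_kronecker _
  map_add' a b := Matrix.add_kronecker _ _ _
  commutes' c := by
    simp [Algebra.algebraMap_eq_smul_one, Matrix.smul_kronecker]
  map_star' a := by
    simp [Matrix.star_eq_conjTranspose, Matrix.conjTranspose_kronecker]

/-- The embedding `b ↦ 1 ⊗ b` of matrix algebras. -/
noncomputable def kronRight : Matrix n n ℂ →⋆ₐ[ℂ] Matrix (m × n) (m × n) ℂ where
  toFun b := (1 : Matrix m m ℂ) ⊗ₖ b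
  map_one' := Matrix.one_kronecker_one
  map_mul' a b := by rw [← Matrix.mul_kronecker_mul, mul_one]
  map_zero' := Matrix.kronecker_zero _
  map_add' a b := Matrix.kronecker_add _ _ _
  commutes' c := by
    simp [Algebra.algebraMap_eq_smul_one, Matrix.kronecker_smul]
  map_star' a := by
    simp [Matrix.star_eq_conjTranspose, Matrix.conjTranspose_kronecker]

end MatrixHom

section Lift

variable (A : SpinChain) {C : Type*} [CStarAlgebra C]

theorem exists_matrixHom {E : Type*} [CStarAlgebra E] (p : ∀ j, A.OnSite j →⋆ₐ[ℂ] E)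
    (hp : ∀ i j, i ≠ j → ∀ a b, Commute (p i a) (p j b)) (S : Finset ℤ) :
    ∃ (n : Type) (_ : Fintype n) (_ : DecidableEq n) (_ : Nonempty n)
      (π : Matrix n n ℂ →⋆ₐ[ℂ] E), (∀ j ∈ S, ∀ a, ∃ x, π x = p j a) ∧
        ∀ j ∉ S, ∀ a x, Commute (π x) (p j a) := by
  induction S using Finset.induction_on with
  | empty =>
    let e : Matrix Unit Unit ℂ ≃⋆ₐ[ℂ] ℂ :=
      StarAlgEquiv.ofAlgEquiv (Matrix.uniqueAlgEquiv) (fun x => by simp [Matrix.star_apply])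
    refine ⟨Unit, inferInstance, inferInstance, inferInstance,
      (StarAlgHom.ofId ℂ E).comp e.toStarAlgHom, by simp, fun j _ a x => ?_⟩
    exact Algebra.commutes (e x) (p j a)
  | insert i S hi ih =>
    obtain ⟨n, _, _, _, π, h1, h2⟩ := ih
    obtain ⟨k, hk⟩ := exists_kronHom π (p i) (fun x a => h2 i hi a x)
    refine ⟨n × A.site i, inferInstance, inferInstance, inferInstance, k, fun j hj a => ?_,
      fun j hj a x => ?_⟩
    · rcases Finset.mem_insert.1 hj with rfl | hj
      · exact ⟨1 ⊗ₖ a, by rw [hk, map_one, one_mul]⟩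
      · obtain ⟨x, hx⟩ := h1 j hj a
        exact ⟨x ⊗ₖ 1, by rw [hk, map_one, mul_one, hx]⟩
    · rw [Finset.mem_insert, not_or] at hj
      induction x using kron_induction with
      | h b c =>
        rw [hk]
        exact (h2 j hj.2 a b).mul_left (hp i j (Ne.symm hj.1) c a)
      | hadd x y hx hy => rw [map_add]; exact hx.add_left hy

instance : Nontrivial (A.Hilb →L[ℂ] A.Hilb) := by
  classical
  refine ⟨1, 0, fun h => ?_⟩
  let σ : A.Config := fun j => Classical.arbitrary _
  have h1 := congrArg (fun T : A.Hilb →L[ℂ] A.Hilb => T (lp.single 2 σ 1) σ) h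
  simp at h1

theorem exists_finset_of_mem_adjoin {E : Type*} [CStarAlgebra E] (p : ∀ j, A.OnSite j →⋆ₐ[ℂ] E)
    {z : E} (hz : z ∈ StarAlgebra.adjoin ℂ (⋃ j, Set.range (p j))) :
    ∃ S : Finset ℤ, ∀ T : StarSubalgebra ℂ E, (∀ j ∈ S, ∀ a, p j a ∈ T) → z ∈ T := by
  induction hz using StarAlgebra.adjoin_induction with
  | mem x hx =>
    obtain ⟨j, a, rfl⟩ := Set.mem_iUnion.1 hx
    exact ⟨{j}, fun T hT => hT j (by simp) a⟩
  | algebraMap r => exact ⟨∅, fun T _ => T.algebraMap_mem r⟩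
  | add x y _ _ hx hy =>
    obtain ⟨S, hS⟩ := hx
    obtain ⟨S', hS'⟩ := hy
    exact ⟨S ∪ S', fun T hT => add_mem (hS T fun j hj => hT j (Finset.mem_union_left _ hj))
      (hS' T fun j hj => hT j (Finset.mem_union_right _ hj))⟩
  | mul x y _ _ hx hy =>
    obtain ⟨S, hS⟩ := hx
    obtain ⟨S', hS'⟩ := hy
    exact ⟨S ∪ S', fun T hT => mul_mem (hS T fun j hj => hT j (Finset.mem_union_left _ hj))
      (hS' T fun j hj => hT j (Finset.mem_union_right _ hj))⟩
  | star x _ hx =>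
    obtain ⟨S, hS⟩ := hx
    exact ⟨S, fun T hT => star_mem (hS T hT)⟩

open scoped Matrix.Norms.L2Operator in
theorem norm_snd_le (φ : ∀ j, A.OnSite j →⋆ₐ[ℂ] C)
    (hφ : ∀ i j, i ≠ j → ∀ a b, Commute (φ i a) (φ j b)) {z : (A.Hilb →L[ℂ] A.Hilb) × C}
    (hz : z ∈ StarAlgebra.adjoin ℂ (⋃ j, Set.range ((A.onsiteHom j).prod (φ j)))) :
    ‖z.2‖ ≤ ‖z.1‖ := by
  obtain ⟨S, hS⟩ := A.exists_finset_of_mem_adjoin _ hz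
  obtain ⟨n, _, _, _, π, h1, -⟩ := A.exists_matrixHom (fun j => (A.onsiteHom j).prod (φ j))
    (fun i j hij a b => Prod.ext (A.onsiteHom_commute hij a b) (hφ i j hij a b)) S
  obtain ⟨x, rfl⟩ : z ∈ π.range := hS _ (fun j hj a => h1 j hj a)
  have hinj : Function.Injective ((StarAlgHom.fst ℂ (A.Hilb →L[ℂ] A.Hilb) C).comp π) :=
    RingHom.injective
      ((StarAlgHom.fst ℂ (A.Hilb →L[ℂ] A.Hilb) C).comp π).toAlgHom.toRingHom
  have e1 := NonUnitalStarAlgHom.norm_map ((StarAlgHom.fst ℂ (A.Hilb →L[ℂ] A.Hilb) C).comp π) hinj x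
  have e2 := NonUnitalStarAlgHom.norm_apply_le ((StarAlgHom.snd ℂ (A.Hilb →L[ℂ] A.Hilb) C).comp π) x
  exact e2.trans e1.ge

/-- The universal property of the quasi-local algebra: commuting representations of the on-site
algebras in a C*-algebra extend to it. -/
theorem exists_lift (φ : ∀ j, A.OnSite j →⋆ₐ[ℂ] C)
    (hφ : ∀ i j, i ≠ j → ∀ a b, Commute (φ i a) (φ j b)) :
    ∃ Φ : A.Alg →⋆ₐ[ℂ] C, ∀ j a, Φ (A.ofSite j a) = φ j a := by
  let D := StarAlgebra.adjoin ℂ (⋃ j, Set.range ((A.onsiteHom j).prod (φ j)))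
  let K := D.topologicalClosure
  have hK : ∀ z ∈ K, ‖z.2‖ ≤ ‖z.1‖ := by
    have hc : IsClosed {z : (A.Hilb →L[ℂ] A.Hilb) × C | ‖z.2‖ ≤ ‖z.1‖} :=
      isClosed_le (by fun_prop) (by fun_prop)
    have : (closure (D : Set ((A.Hilb →L[ℂ] A.Hilb) × C))) ⊆ _ :=
      closure_minimal (fun z hz => A.norm_snd_le φ hφ hz) hc
    exact this
  have hgen : ∀ j a, ((A.onsiteHom j a, φ j a) : (A.Hilb →L[ℂ] A.Hilb) × C) ∈ K := fun j a =>
    D.le_topologicalClosure (StarAlgebra.subset_adjoin ℂ _ (Set.mem_iUnion.2 ⟨j, a, rfl⟩))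
  let F : K →⋆ₐ[ℂ] (A.Hilb →L[ℂ] A.Hilb) :=
    (StarAlgHom.fst ℂ (A.Hilb →L[ℂ] A.Hilb) C).comp K.subtype
  have hKc : IsClosed (K : Set ((A.Hilb →L[ℂ] A.Hilb) × C)) :=
    StarSubalgebra.isClosed_topologicalClosure _
  have hFn : ∀ z, ‖F z‖ = ‖z‖ := fun z => by
    change ‖z.1.1‖ = ‖z.1‖
    rw [Prod.norm_def, max_eq_left (hK _ z.2)]
  have hFiso : Isometry F := AddMonoidHomClass.isometry_of_norm F hFn
  have : CompleteSpace K := hKc.completeSpace_coe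
  have hFr : IsClosed (F.range : Set (A.Hilb →L[ℂ] A.Hilb)) :=
    (hFiso.isClosedEmbedding).isClosed_range
  have hle : A.quasiLocal ≤ F.range := by
    refine StarSubalgebra.topologicalClosure_minimal (StarAlgebra.adjoin_le ?_) hFr
    refine Set.iUnion_subset fun j => ?_
    rintro _ ⟨a, rfl⟩
    exact ⟨⟨_, hgen j a⟩, rfl⟩
  have hmem : ∀ z, F z ∈ A.quasiLocal := by
    have : K ≤ A.quasiLocal.comap (StarAlgHom.fst ℂ (A.Hilb →L[ℂ] A.Hilb) C) := by
      refine StarSubalgebra.topologicalClosure_minimal (StarAlgebra.adjoin_le ?_) ?_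
      · refine Set.iUnion_subset fun j => ?_
        rintro _ ⟨a, rfl⟩
        exact (A.ofSite j a).2
      · exact A.isClosed_quasiLocal.preimage continuous_fst
    exact fun z => this z.2
  let e : K ≃⋆ₐ[ℂ] A.Alg := StarAlgEquiv.ofBijective (F.codRestrict A.quasiLocal hmem)
    ⟨fun x y h => hFiso.injective (congrArg Subtype.val h), fun x => by
      obtain ⟨z, hz⟩ := hle x.2
      exact ⟨z, Subtype.ext hz⟩⟩
  refine ⟨((StarAlgHom.snd ℂ (A.Hilb →L[ℂ] A.Hilb) C).comp K.subtype).comp e.symm.toStarAlgHom,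
    fun j a => ?_⟩
  have : e.symm (A.ofSite j a) = ⟨_, hgen j a⟩ := by
    rw [StarAlgEquiv.symm_apply_eq]
    rfl
  change (e.symm (A.ofSite j a)).1.2 = _
  rw [this]

end Lift

section Functoriality

variable (A B : SpinChain) {C : Type*} [CStarAlgebra C]

/-- The extension of commuting representations of the on-site algebras. -/
noncomputable def lift (φ : ∀ j, A.OnSite j →⋆ₐ[ℂ] C)
    (hφ : ∀ i j, i ≠ j → ∀ a b, Commute (φ i a) (φ j b)) : A.Alg →⋆ₐ[ℂ] C :=
  (A.exists_lift φ hφ).choose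

variable {A B}

theorem lift_ofSite {φ : ∀ j, A.OnSite j →⋆ₐ[ℂ] C}
    (hφ : ∀ i j, i ≠ j → ∀ a b, Commute (φ i a) (φ j b)) (j : ℤ) (a : A.OnSite j) :
    A.lift φ hφ (A.ofSite j a) = φ j a :=
  (A.exists_lift φ hφ).choose_spec j a

theorem continuous_starHom {C' : Type*} [CStarAlgebra C'] (f : C →⋆ₐ[ℂ] C') : Continuous f :=
  AddMonoidHomClass.continuous_of_bound f 1 fun x => by
    rw [one_mul]
    exact NonUnitalStarAlgHom.norm_apply_le f x

theorem closure_adjoin_ofSite :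
    (StarAlgebra.adjoin ℂ (⋃ j, Set.range (A.ofSite j))).topologicalClosure = ⊤ := by
  rw [eq_top_iff]
  rintro x -
  have h1 : (StarAlgebra.adjoin ℂ (⋃ j, Set.range (A.ofSite j))).map A.quasiLocal.subtype =
      StarAlgebra.adjoin ℂ (⋃ j, Set.range (A.onsiteHom j)) := by
    rw [StarAlgHom.map_adjoin, Set.image_iUnion]
    congr 1
    refine Set.iUnion_congr fun j => ?_
    rw [← Set.range_comp]
    rfl
  have hx : (x : A.Hilb →L[ℂ] A.Hilb) ∈
      closure (StarAlgebra.adjoin ℂ (⋃ j, Set.range (A.onsiteHom j)) : Set _) := x.2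
  rw [← h1] at hx
  change x ∈ closure _
  rw [closure_subtype]
  exact hx

/-- A star homomorphism out of the quasi-local algebra is determined by its values on the on-site
algebras. -/
theorem hom_ext {f g : A.Alg →⋆ₐ[ℂ] C} (h : ∀ j a, f (A.ofSite j a) = g (A.ofSite j a)) :
    f = g := by
  have h1 : StarAlgebra.adjoin ℂ (⋃ j, Set.range (A.ofSite j)) ≤ StarAlgHom.equalizer f g := by
    refine StarAlgebra.adjoin_le (Set.iUnion_subset fun j => ?_)
    rintro _ ⟨a, rfl⟩
    exact h j a
  have h2 : IsClosed (StarAlgHom.equalizer f g : Set A.Alg) :=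
    isClosed_eq (continuous_starHom f) (continuous_starHom g)
  have h3 := StarSubalgebra.topologicalClosure_minimal h1 h2
  rw [closure_adjoin_ofSite] at h3
  ext x
  exact h3 (show x ∈ (⊤ : StarSubalgebra ℂ A.Alg) from trivial)

theorem isClosed_sub (X : Set ℤ) : IsClosed (A.sub X : Set A.Alg) :=
  StarSubalgebra.isClosed_topologicalClosure _

theorem ofSite_mem_sub {X : Set ℤ} {j : ℤ} (hj : j ∈ X) (a : A.OnSite j) :
    A.ofSite j a ∈ A.sub X :=
  StarSubalgebra.le_topologicalClosure _
    (StarAlgebra.subset_adjoin ℂ _ (Set.mem_biUnion hj ⟨a, rfl⟩))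

/-- To map `A_X` into a closed subalgebra it suffices to map the on-site algebras there. -/
theorem map_mem_of_mem_sub {f : A.Alg →⋆ₐ[ℂ] C} {X : Set ℤ} {T : StarSubalgebra ℂ C}
    (hT : IsClosed (T : Set C)) (h : ∀ j ∈ X, ∀ a, f (A.ofSite j a) ∈ T) {x : A.Alg}
    (hx : x ∈ A.sub X) : f x ∈ T := by
  have h1 : A.sub X ≤ T.comap f := by
    refine StarSubalgebra.topologicalClosure_minimal (StarAlgebra.adjoin_le ?_)
      (hT.preimage (continuous_starHom f))
    refine Set.iUnion₂_subset fun j hj => ?_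
    rintro _ ⟨a, rfl⟩
    exact h j hj a
  exact h1 hx

theorem sub_mono {X Y : Set ℤ} (h : X ⊆ Y) : A.sub X ≤ A.sub Y := fun _ hx =>
  map_mem_of_mem_sub (f := StarAlgHom.id ℂ A.Alg) (isClosed_sub Y)
    (fun _ hj a => ofSite_mem_sub (h hj) a) hx

theorem commute_of_ofSite {f : A.Alg →⋆ₐ[ℂ] C} {y : C}
    (h : ∀ j a, Commute (f (A.ofSite j a)) y) (x : A.Alg) : Commute (f x) y := by
  have h1 : StarAlgebra.adjoin ℂ (⋃ j, Set.range (A.ofSite j)) ≤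
      (StarSubalgebra.centralizer ℂ {y}).comap f := by
    refine StarAlgebra.adjoin_le (Set.iUnion_subset fun j => ?_)
    rintro _ ⟨a, rfl⟩
    change f (A.ofSite j a) ∈ StarSubalgebra.centralizer ℂ {y}
    rw [StarSubalgebra.mem_centralizer_iff]
    rintro _ rfl
    refine ⟨(h j a).symm, ?_⟩
    have := (h j (star a)).star_star
    rw [map_star, map_star, star_star] at this
    exact this.symm
  have h2 : IsClosed ({x | f x * y = y * f x} : Set A.Alg) := by
    have := continuous_starHom f
    exact isClosed_eq (by fun_prop) (by fun_prop)
  have h3 : closure (StarAlgebra.adjoin ℂ (⋃ j, Set.range (A.ofSite j)) : Set A.Alg) ⊆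
      {x | f x * y = y * f x} := by
    refine closure_minimal (fun z hz => ?_) h2
    have := h1 hz
    change f z ∈ StarSubalgebra.centralizer ℂ {y} at this
    rw [StarSubalgebra.mem_centralizer_iff] at this
    exact ((this y rfl).1).symm
  have h4 : x ∈ (StarAlgebra.adjoin ℂ (⋃ j, Set.range (A.ofSite j))).topologicalClosure := by
    rw [closure_adjoin_ofSite]
    trivial
  exact h3 h4

/-- The automorphism determined by a star homomorphism and a candidate for its inverse. -/
noncomputable def autOf (f g : A.Alg →⋆ₐ[ℂ] A.Alg) (hgf : g.comp f = StarAlgHom.id ℂ _)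
    (hfg : f.comp g = StarAlgHom.id ℂ _) : A.Alg ≃⋆ₐ[ℂ] A.Alg :=
  StarAlgEquiv.ofStarAlgHom f g hgf hfg

end Functoriality

section Stack

variable (A B : SpinChain)

/-- The stack `A ⊗ B`, with on-site algebras `A_j ⊗ B_j`. -/
abbrev stack : SpinChain where
  site j := A.site j × B.site j
  bounded := by
    obtain ⟨d, hd⟩ := A.bounded
    obtain ⟨e, he⟩ := B.bounded
    exact ⟨d * e, fun j => by
      rw [Fintype.card_prod]
      exact Nat.mul_le_mul (hd j) (he j)⟩

/-- The embedding `a ↦ a ⊗ 1`. -/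
noncomputable def inl : A.Alg →⋆ₐ[ℂ] (A.stack B).Alg :=
  A.lift (fun j => ((A.stack B).ofSite j).comp (kronLeft (m := A.site j) (n := B.site j)))
    fun _ _ hij _ _ => (A.stack B).ofSite_commute hij _ _

/-- The embedding `b ↦ 1 ⊗ b`. -/
noncomputable def inr : B.Alg →⋆ₐ[ℂ] (A.stack B).Alg :=
  B.lift (fun j => ((A.stack B).ofSite j).comp (kronRight (m := A.site j) (n := B.site j)))
    fun _ _ hij _ _ => (A.stack B).ofSite_commute hij _ _

variable {A B}

theorem inl_ofSite (j : ℤ) (a : A.OnSite j) :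
    A.inl B (A.ofSite j a) = (A.stack B).ofSite j (a ⊗ₖ (1 : B.OnSite j)) :=
  lift_ofSite _ j a

theorem inr_ofSite (j : ℤ) (b : B.OnSite j) :
    A.inr B (B.ofSite j b) = (A.stack B).ofSite j ((1 : A.OnSite j) ⊗ₖ b) :=
  lift_ofSite _ j b

theorem commute_inl_inr (x : A.Alg) (y : B.Alg) : Commute (A.inl B x) (A.inr B y) := by
  refine commute_of_ofSite (fun j a => ?_) x
  refine Commute.symm (commute_of_ofSite (fun i b => ?_) y)
  rw [inl_ofSite, inr_ofSite]
  rcases eq_or_ne i j with rfl | hij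
  · change _ * _ = _ * _
    rw [← map_mul, ← map_mul]
    congr 1
    rw [← Matrix.mul_kronecker_mul, ← Matrix.mul_kronecker_mul]
    simp
  · exact (A.stack B).ofSite_commute hij _ _

theorem stack_hom_ext {C : Type*} [CStarAlgebra C] {f g : (A.stack B).Alg →⋆ₐ[ℂ] C}
    (hl : ∀ x, f (A.inl B x) = g (A.inl B x)) (hr : ∀ y, f (A.inr B y) = g (A.inr B y)) :
    f = g := by
  refine hom_ext fun j c => ?_
  have : f.comp ((A.stack B).ofSite j) = g.comp ((A.stack B).ofSite j) := by
    refine kron_hom_ext (m := A.site j) (n := B.site j) (fun a => ?_) (fun b => ?_)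
    · have := hl (A.ofSite j a)
      rwa [inl_ofSite] at this
    · have := hr (B.ofSite j b)
      rwa [inr_ofSite] at this
  exact DFunLike.congr_fun this c

theorem exists_stackHom {C : Type*} [CStarAlgebra C] (f : A.Alg →⋆ₐ[ℂ] C) (g : B.Alg →⋆ₐ[ℂ] C)
    (h : ∀ x y, Commute (f x) (g y)) :
    ∃ k : (A.stack B).Alg →⋆ₐ[ℂ] C, (∀ x, k (A.inl B x) = f x) ∧ ∀ y, k (A.inr B y) = g y := by
  have hk : ∀ j, ∃ k : (A.stack B).OnSite j →⋆ₐ[ℂ] C,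
      ∀ (a : A.OnSite j) (b : B.OnSite j), k (a ⊗ₖ b) = f (A.ofSite j a) * g (B.ofSite j b) :=
    fun j => exists_kronHom (f.comp (A.ofSite j)) (g.comp (B.ofSite j)) fun _ _ => h _ _
  choose k hk using hk
  have hc : ∀ i j, i ≠ j → ∀ a b, Commute (k i a) (k j b) := by
    intro i j hij a b
    induction a using kron_induction (m := A.site i) (n := B.site i) with
    | h a a' =>
      induction b using kron_induction (m := A.site j) (n := B.site j) with
      | h b b' =>
        rw [hk, hk]
        refine Commute.mul_left (Commute.mul_right ?_ (h _ _)) (Commute.mul_right (h _ _).symm ?_)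
        · exact (A.ofSite_commute hij a b).map f
        · exact (B.ofSite_commute hij a' b').map g
      | hadd x y hx hy => rw [map_add]; exact hx.add_right hy
    | hadd x y hx hy => rw [map_add]; exact hx.add_left hy
  refine ⟨(A.stack B).lift k hc, fun x => ?_, fun y => ?_⟩
  · have : ((A.stack B).lift k hc).comp (A.inl B) = f := hom_ext fun j a => by
      change (A.stack B).lift k hc (A.inl B (A.ofSite j a)) = _
      rw [inl_ofSite, lift_ofSite, hk, map_one, map_one, mul_one]
    exact DFunLike.congr_fun this x
  · have : ((A.stack B).lift k hc).comp (A.inr B) = g := hom_ext fun j b => by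
      change (A.stack B).lift k hc (A.inr B (B.ofSite j b)) = _
      rw [inr_ofSite, lift_ofSite, hk, map_one, map_one, one_mul]
    exact DFunLike.congr_fun this y

/-- The tensor product `f ⊗ g` of star homomorphisms. -/
noncomputable def stackHom (f : A.Alg →⋆ₐ[ℂ] A.Alg) (g : B.Alg →⋆ₐ[ℂ] B.Alg) :
    (A.stack B).Alg →⋆ₐ[ℂ] (A.stack B).Alg :=
  (exists_stackHom ((A.inl B).comp f) ((A.inr B).comp g)
    fun x y => commute_inl_inr (f x) (g y)).choose

theorem stackHom_inl (f : A.Alg →⋆ₐ[ℂ] A.Alg) (g : B.Alg →⋆ₐ[ℂ] B.Alg) (x : A.Alg) :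
    stackHom f g (A.inl B x) = A.inl B (f x) :=
  (exists_stackHom ((A.inl B).comp f) ((A.inr B).comp g)
    fun x y => commute_inl_inr (f x) (g y)).choose_spec.1 x

theorem stackHom_inr (f : A.Alg →⋆ₐ[ℂ] A.Alg) (g : B.Alg →⋆ₐ[ℂ] B.Alg) (y : B.Alg) :
    stackHom f g (A.inr B y) = A.inr B (g y) :=
  (exists_stackHom ((A.inl B).comp f) ((A.inr B).comp g)
    fun x y => commute_inl_inr (f x) (g y)).choose_spec.2 y

/-- The tensor product `α ⊗ β` of automorphisms. -/
noncomputable def stackAut (α : A.Alg ≃⋆ₐ[ℂ] A.Alg) (β : B.Alg ≃⋆ₐ[ℂ] B.Alg) :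
    (A.stack B).Alg ≃⋆ₐ[ℂ] (A.stack B).Alg :=
  autOf (stackHom α.toStarAlgHom β.toStarAlgHom)
    (stackHom α.symm.toStarAlgHom β.symm.toStarAlgHom)
    (stack_hom_ext (fun x => by simp [stackHom_inl]) (fun y => by simp [stackHom_inr]))
    (stack_hom_ext (fun x => by simp [stackHom_inl]) (fun y => by simp [stackHom_inr]))

theorem stackAut_inl (α : A.Alg ≃⋆ₐ[ℂ] A.Alg) (β : B.Alg ≃⋆ₐ[ℂ] B.Alg) (x : A.Alg) :
    stackAut α β (A.inl B x) = A.inl B (α x) :=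
  stackHom_inl _ _ x

theorem stackAut_inr (α : A.Alg ≃⋆ₐ[ℂ] A.Alg) (β : B.Alg ≃⋆ₐ[ℂ] B.Alg) (y : B.Alg) :
    stackAut α β (A.inr B y) = A.inr B (β y) :=
  stackHom_inr _ _ y

theorem aut_ext_stack {γ δ : (A.stack B).Alg ≃⋆ₐ[ℂ] (A.stack B).Alg}
    (hl : ∀ x, γ (A.inl B x) = δ (A.inl B x)) (hr : ∀ y, γ (A.inr B y) = δ (A.inr B y)) :
    γ = δ := by
  have : γ.toStarAlgHom = δ.toStarAlgHom := stack_hom_ext hl hr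
  ext1 x
  exact DFunLike.congr_fun this x

theorem inl_mem_sub {X : Set ℤ} {x : A.Alg} (hx : x ∈ A.sub X) :
    A.inl B x ∈ (A.stack B).sub X :=
  map_mem_of_mem_sub (isClosed_sub X)
    (fun j hj a => by rw [inl_ofSite]; exact ofSite_mem_sub hj _) hx

theorem inr_mem_sub {X : Set ℤ} {y : B.Alg} (hy : y ∈ B.sub X) :
    A.inr B y ∈ (A.stack B).sub X :=
  map_mem_of_mem_sub (isClosed_sub X)
    (fun j hj a => by rw [inr_ofSite]; exact ofSite_mem_sub hj _) hy

end Stack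

section QCA

variable {A : SpinChain}

/-- The fattening `X^(r) = {j : dist(j, X) ≤ r}`. -/
def fatten (X : Set ℤ) (r : ℕ) : Set ℤ := {j | ∃ i ∈ X, |j - i| ≤ r}

/-- `α` has range at most `r`: `α(A_X) ⊆ A_{X^(r)}` for every `X ⊆ ℤ`. -/
def RangeLE (α : A.Alg ≃⋆ₐ[ℂ] A.Alg) (r : ℕ) : Prop :=
  ∀ X : Set ℤ, ∀ x ∈ A.sub X, α x ∈ A.sub (fatten X r)

/-- Quantum cellular automata. -/
def IsQCA (α : A.Alg ≃⋆ₐ[ℂ] A.Alg) : Prop := ∃ r, RangeLE α r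

/-- A partition of `ℤ` into intervals `I a` of bounded size. -/
structure IsBlockPartition (I : ℤ → Set ℤ) : Prop where
  nonempty : ∀ a, (I a).Nonempty
  interval : ∀ a, (I a).OrdConnected
  disjoint : Pairwise fun a b => Disjoint (I a) (I b)
  cover : ⋃ a, I a = Set.univ
  bounded : ∃ N : ℕ, ∀ a, (I a).encard ≤ N

/-- `β = ⨂ₐ Ad(Uₐ)` with gates `Uₐ` in the blocks `A_{Iₐ}`: on each block algebra, `β` is
conjugation by the gate. -/
def IsBlockProduct (I : ℤ → Set ℤ) (β : A.Alg ≃⋆ₐ[ℂ] A.Alg) : Prop :=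
  ∃ U : ℤ → A.Alg, ∀ a, U a ∈ unitary A.Alg ∧ U a ∈ A.sub (I a) ∧
    ∀ x ∈ A.sub (I a), β x = U a * x * star (U a)

/-- Block partitioned QCAs. -/
def IsBlockPartitioned (β : A.Alg ≃⋆ₐ[ℂ] A.Alg) : Prop :=
  ∃ I, IsBlockPartition I ∧ IsBlockProduct I β

/-- Finite depth quantum circuits: finite compositions of block partitioned QCAs. -/
def IsFDQC (γ : A.Alg ≃⋆ₐ[ℂ] A.Alg) : Prop :=
  ∃ l : List (A.Alg ≃⋆ₐ[ℂ] A.Alg), (∀ β ∈ l, IsBlockPartitioned β) ∧ γ = l.prod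

theorem fatten_mono {X : Set ℤ} {r s : ℕ} (h : r ≤ s) : fatten X r ⊆ fatten X s :=
  fun _ ⟨i, hi, hj⟩ => ⟨i, hi, hj.trans (by exact_mod_cast h)⟩

theorem subset_fatten (X : Set ℤ) (r : ℕ) : X ⊆ fatten X r :=
  fun j hj => ⟨j, hj, by simp⟩

theorem fatten_singleton_subset {X : Set ℤ} {i : ℤ} (hi : i ∈ X) (r : ℕ) :
    fatten {i} r ⊆ fatten X r := by
  rintro j ⟨_, rfl, hj⟩
  exact ⟨_, hi, hj⟩

theorem RangeLE.mono {α : A.Alg ≃⋆ₐ[ℂ] A.Alg} {r s : ℕ} (h : RangeLE α r) (hrs : r ≤ s) :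
    RangeLE α s := fun X x hx => sub_mono (fatten_mono hrs) (h X x hx)

theorem RangeLE.stackAut {B : SpinChain} {α : A.Alg ≃⋆ₐ[ℂ] A.Alg} {β : B.Alg ≃⋆ₐ[ℂ] B.Alg}
    {r : ℕ} (hα : RangeLE α r) (hβ : RangeLE β r) : RangeLE (stackAut α β) r := by
  intro X x hx
  refine map_mem_of_mem_sub (f := (SpinChain.stackAut α β).toStarAlgHom) (isClosed_sub _)
    (fun j hj c => ?_) hx
  have h1 : ∀ a : A.OnSite j, α (A.ofSite j a) ∈ A.sub (fatten X r) := fun a =>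
    sub_mono (fatten_singleton_subset hj r) (hα {j} _ (ofSite_mem_sub (Set.mem_singleton j) a))
  have h2 : ∀ b : B.OnSite j, β (B.ofSite j b) ∈ B.sub (fatten X r) := fun b =>
    sub_mono (fatten_singleton_subset hj r) (hβ {j} _ (ofSite_mem_sub (Set.mem_singleton j) b))
  change SpinChain.stackAut α β ((A.stack B).ofSite j c) ∈ _
  induction c using kron_induction (m := A.site j) (n := B.site j) with
  | h a b =>
    have : (A.stack B).ofSite j (a ⊗ₖ b) = A.inl B (A.ofSite j a) * A.inr B (B.ofSite j b) := by
      rw [inl_ofSite, inr_ofSite, ← map_mul, ← Matrix.mul_kronecker_mul, mul_one, one_mul]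
    rw [this, map_mul, stackAut_inl, stackAut_inr]
    exact mul_mem (inl_mem_sub (h1 a)) (inr_mem_sub (h2 b))
  | hadd x y hx hy =>
    rw [map_add, map_add]
    exact add_mem hx hy

theorem IsQCA.stackAut {B : SpinChain} {α : A.Alg ≃⋆ₐ[ℂ] A.Alg} {β : B.Alg ≃⋆ₐ[ℂ] B.Alg}
    (hα : IsQCA α) (hβ : IsQCA β) : IsQCA (stackAut α β) := by
  obtain ⟨r, hr⟩ := hα
  obtain ⟨s, hs⟩ := hβ
  exact ⟨max r s, (hr.mono (le_max_left _ _)).stackAut (hs.mono (le_max_right _ _))⟩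

end QCA

/-- The trivial chain, all of whose on-site algebras are `ℂ`. -/
abbrev unitChain : SpinChain where
  site _ := Unit
  bounded := ⟨1, fun _ => by simp⟩

/-- The chain with on-site Hilbert space `ℂ[G]` everywhere. -/
abbrev regularChain (G : Type) [Group G] [Fintype G] [DecidableEq G] : SpinChain where
  site _ := G
  bounded := ⟨Fintype.card G, fun _ => le_rfl⟩

/-- Conjugation `|h⟩⟨h'| ↦ |kh⟩⟨kh'|` by the left regular representation of `k`. -/
def conjRegular {G : Type} [Group G] [Fintype G] [DecidableEq G] (k : G) :
    Matrix G G ℂ →⋆ₐ[ℂ] Matrix G G ℂ where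
  toFun a := Matrix.of fun h h' => a (k⁻¹ * h) (k⁻¹ * h')
  map_one' := by ext; simp [Matrix.one_apply]
  map_mul' a b := by
    ext h h'
    simp only [Matrix.of_apply, Matrix.mul_apply]
    exact (Equiv.sum_comp (Equiv.mulLeft k⁻¹) fun x => a (k⁻¹ * h) x * b x (k⁻¹ * h')).symm
  map_zero' := rfl
  map_add' _ _ := rfl
  commutes' c := by ext; simp [Matrix.algebraMap_matrix_apply]
  map_star' _ := rfl

theorem conjRegular_apply {G : Type} [Group G] [Fintype G] [DecidableEq G] (k : G)
    (a : Matrix G G ℂ) (h h' : G) : conjRegular k a h h' = a (k⁻¹ * h) (k⁻¹ * h') := rfl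

end SpinChain

open SpinChain

variable (G : Type) [Group G]

/-- A (locality preserving) `G`-symmetry on the spin chain `A`. -/
structure Symmetry (A : SpinChain) where
  toHom : G →* (A.Alg ≃⋆ₐ[ℂ] A.Alg)
  isQCA : ∀ g, IsQCA (toHom g)

namespace Symmetry

variable {G} {A B : SpinChain}

noncomputable instance : CoeFun (Symmetry G A) fun _ => G → (A.Alg ≃⋆ₐ[ℂ] A.Alg) := ⟨fun α => α.toHom⟩

/-- The stack `α ⊗ β`. -/
noncomputable def stack (α : Symmetry G A) (β : Symmetry G B) : Symmetry G (A.stack B) where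
  toHom :=
    { toFun g := stackAut (α g) (β g)
      map_one' := aut_ext_stack (fun x => by simp [stackAut_inl]) (fun y => by simp [stackAut_inr])
      map_mul' g h := aut_ext_stack (fun x => by simp [stackAut_inl])
        (fun y => by simp [stackAut_inr]) }
  isQCA g := (α.isQCA g).stackAut (β.isQCA g)

/-- The trivial symmetry. -/
noncomputable def triv (G : Type) [Group G] (A : SpinChain) : Symmetry G A where
  toHom := 1
  isQCA _ := ⟨0, fun X _ hx => sub_mono (subset_fatten X 0) hx⟩

/-- The automorphism of the chain acting on every site by `conjRegular k`. -/
noncomputable def regularHom [Fintype G] [DecidableEq G] (k : G) :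
    (regularChain G).Alg →⋆ₐ[ℂ] (regularChain G).Alg :=
  (regularChain G).lift (fun j => ((regularChain G).ofSite j).comp (conjRegular k))
    fun _ _ hij _ _ => (regularChain G).ofSite_commute hij _ _

theorem regularHom_ofSite [Fintype G] [DecidableEq G] (k : G) (j : ℤ) (a : Matrix G G ℂ) :
    regularHom k ((regularChain G).ofSite j a) = (regularChain G).ofSite j (conjRegular k a) :=
  lift_ofSite (φ := fun j => ((regularChain G).ofSite j).comp (conjRegular k)) _ j a

theorem regularHom_mul [Fintype G] [DecidableEq G] (k l : G) :
    (regularHom k).comp (regularHom l) = regularHom (k * l) :=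
  hom_ext fun j a => by
    rw [StarAlgHom.comp_apply, regularHom_ofSite, regularHom_ofSite, regularHom_ofSite]
    congr 1
    ext
    simp [conjRegular_apply, mul_assoc]

theorem regularHom_one [Fintype G] [DecidableEq G] :
    regularHom (1 : G) = StarAlgHom.id ℂ (regularChain G).Alg :=
  hom_ext fun j a => by
    have : conjRegular (1 : G) a = a := by
      ext
      simp [conjRegular_apply]
    rw [regularHom_ofSite, this]
    rfl

/-- The symmetry acting at every site by (conjugation with) the left regular representation. -/
noncomputable def regular (G : Type) [Group G] [Fintype G] [DecidableEq G] :
    Symmetry G (regularChain G) where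
  toHom :=
    { toFun k := autOf (regularHom k) (regularHom k⁻¹)
        (by rw [regularHom_mul, inv_mul_cancel, regularHom_one])
        (by rw [regularHom_mul, mul_inv_cancel, regularHom_one])
      map_one' := StarAlgEquiv.ext fun x => by
        exact DFunLike.congr_fun regularHom_one x
      map_mul' k l := StarAlgEquiv.ext fun x => by
        exact DFunLike.congr_fun (regularHom_mul k l).symm x }
  isQCA k := ⟨0, fun X _ hx => map_mem_of_mem_sub (f := regularHom k) (isClosed_sub _)
    (fun j hj a => by
      rw [regularHom_ofSite]
      exact ofSite_mem_sub (subset_fatten X 0 hj) _) hx⟩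

/-- The symmetry `α` has range at most `R`. -/
def RangeLE (α : Symmetry G A) (R : ℕ) : Prop := ∀ g, SpinChain.RangeLE (α g) R

/-- Decoupled symmetries: block partitioned with blocks independent of the group element. -/
def IsDecoupled (α : Symmetry G A) : Prop := ∃ I, IsBlockPartition I ∧ ∀ g, IsBlockProduct I (α g)

/-- Equivalence of symmetries, `β = γ⁻¹ ∘ α ∘ γ` with `γ` a finite depth quantum circuit. The two
spin chains are identified through an isomorphism `θ` that maps on-site algebras onto on-site
algebras. -/
def Equivalent (α : Symmetry G A) (β : Symmetry G B) : Prop :=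
  ∃ θ : A.Alg ≃⋆ₐ[ℂ] B.Alg, (∀ j x, θ x ∈ B.sub {j} ↔ x ∈ A.sub {j}) ∧
    ∃ γ : B.Alg ≃⋆ₐ[ℂ] B.Alg, IsFDQC γ ∧
      ∀ g x, β g x = γ.symm (θ (α g (θ.symm (γ x))))

/-- Stable equivalence. -/
def StablyEquivalent (α : Symmetry G A) (β : Symmetry G B) : Prop :=
  ∃ (A' B' : SpinChain) (α' : Symmetry G A') (β' : Symmetry G B'),
    α'.RangeLE 0 ∧ β'.RangeLE 0 ∧ Equivalent (α.stack α') (β.stack β')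

/-- `r` is a right restriction of `α` at the site `j` with defect size `L`: a family of automorphisms
that agree with `α` on `A_{≥ j+L}` and are the identity on `A_{< j-L}`. -/
structure IsRightRestriction (α : Symmetry G A) (j : ℤ) (L : ℕ)
    (r : G → (A.Alg ≃⋆ₐ[ℂ] A.Alg)) : Prop where
  right : ∀ g, ∀ x ∈ A.sub (Set.Ici (j + L)), r g x = α g x
  left : ∀ g, ∀ x ∈ A.sub (Set.Iio (j - L)), r g x = x

/-- Covariance `α^(k) ∘ r^(k⁻¹gk) ∘ α^(k⁻¹) = r^(g)` of a right restriction. -/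
def IsCovariant (α : Symmetry G A) (r : G → (A.Alg ≃⋆ₐ[ℂ] A.Alg)) : Prop :=
  ∀ g k x, α k (r (k⁻¹ * g * k) (α k⁻¹ x)) = r g x

end Symmetry

/-- `U` is a unitary in `A_S` for some finite set `S` of sites. -/
def IsLocalUnitary {A : SpinChain} (U : A.Alg) : Prop :=
  U ∈ unitary A.Alg ∧ ∃ S : Finset ℤ, U ∈ A.sub S

namespace Symmetry

variable {G} {A B : SpinChain}

/-- `Φ` is a family of fusion operators of `r`: local unitaries with
`r^(g) ∘ r^(h) = Ad(Φ(g, h)) ∘ r^(gh)`. -/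
def IsFusion (r : G → (A.Alg ≃⋆ₐ[ℂ] A.Alg)) (Φ : G → G → A.Alg) : Prop :=
  ∀ g h, IsLocalUnitary (Φ g h) ∧ ∀ x, r g (r h x) = Φ g h * r (g * h) x * star (Φ g h)

/-- `X g k = X_g(k)` is a family of crossing operators of `r`: local unitaries with
`α^(k) ∘ r^(k⁻¹gk) ∘ α^(k⁻¹) ∘ (r^(g))⁻¹ = Ad(X_g(k))`. -/
def IsCrossing (α : Symmetry G A) (r : G → (A.Alg ≃⋆ₐ[ℂ] A.Alg)) (X : G → G → A.Alg) : Prop :=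
  ∀ g k, IsLocalUnitary (X g k) ∧
    ∀ x, α k (r (k⁻¹ * g * k) (α k⁻¹ ((r g).symm x))) = X g k * x * star (X g k)

end Symmetry

/-- The abelian group `U(1)[G]` of maps `G → U(1)`. -/
def U1G : Type := G → Circle

/-- The abelian group `U(1)[G²]` of maps `G² → U(1)`. -/
def U1GG : Type := G → G → Circle

noncomputable instance : CommGroup (U1G G) := inferInstanceAs (CommGroup (G → Circle))

noncomputable instance : CommGroup (U1GG G) := inferInstanceAs (CommGroup (G → G → Circle))

/-- The action `(k · λ)_g = λ_{k⁻¹gk}`. -/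
noncomputable instance : MulDistribMulAction G (U1G G) where
  smul k l := fun g => l (k⁻¹ * g * k)
  one_smul l := funext fun g => by change l _ = l g; simp
  mul_smul k k' l := funext fun g => by
    change l _ = l _
    simp [mul_assoc]
  smul_mul _ _ _ := rfl
  smul_one _ := rfl

/-- The action `(k · μ)_{g,h} = μ_{k⁻¹gk, k⁻¹hk}`. -/
noncomputable instance : MulDistribMulAction G (U1GG G) where
  smul k m := fun g h => m (k⁻¹ * g * k) (k⁻¹ * h * k)
  one_smul m := funext fun g => funext fun h => by change m _ _ = m g h; simp
  mul_smul k k' m := funext fun g => funext fun h => by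
    change m _ _ = m _ _
    simp [mul_assoc]
  smul_mul _ _ _ := rfl
  smul_one _ := rfl

/-- `U(1)[G]` as a representation over `ℤ`. -/
noncomputable abbrev repU1G : Rep ℤ G := Rep.ofMulDistribMulAction G (U1G G)

/-- `U(1)[G²]` as a representation over `ℤ`. -/
noncomputable abbrev repU1GG : Rep ℤ G := Rep.ofMulDistribMulAction G (U1GG G)

/-- The equivariant homomorphism `θ ↦ ((g, h) ↦ θ_g θ_h / θ_{gh})` -/
noncomputable def iotaHom : U1G G →* U1GG G where
  toFun θ := fun g h => θ g * θ h / θ (g * h)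
  map_one' := funext fun g => funext fun h => by
    change (1 * 1 / 1 : Circle) = 1
    simp
  map_mul' θ θ' := funext fun g => funext fun h => by
    change (θ g * θ' g) * (θ h * θ' h) / (θ (g * h) * θ' (g * h)) =
      (θ g * θ h / θ (g * h)) * (θ' g * θ' h / θ' (g * h))
    rw [mul_mul_mul_comm, mul_div_mul_comm]

theorem iotaHom_smul (k : G) (θ : U1G G) : iotaHom G (k • θ) = k • iotaHom G θ :=
  funext fun g => funext fun h => by
    change θ _ * θ _ / θ (k⁻¹ * (g * h) * k) = θ _ * θ _ / θ (k⁻¹ * g * k * (k⁻¹ * h * k))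
    congr 2
    group

/-- The homomorphism `θ ↦ ((g, h) ↦ θ_g θ_h / θ_{gh})` as a morphism of representations. -/
noncomputable def iotaRep : repU1G G ⟶ repU1GG G :=
  Rep.ofHom
    { (iotaHom G).toAdditive.toIntLinearMap with
      isIntertwining' := fun k => LinearMap.ext fun θ => iotaHom_smul G k θ }

/-- The induced homomorphism `ι : H¹(G, U(1)[G]) → H¹(G, U(1)[G²])`. -/
noncomputable def iota : groupCohomology.H1 (repU1G G) ⟶ groupCohomology.H1 (repU1GG G) :=
  groupCohomology.map (MonoidHom.id G) (iotaRep G) 1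

/-- The abelian group `𝔎 = H¹(G, U(1)[G²]) / ι(H¹(G, U(1)[G]))`, written multiplicatively. -/
abbrev KGroup : Type :=
  Multiplicative (groupCohomology.H1 (repU1GG G) ⧸ LinearMap.range (iota G).hom)

variable {G}

/-- The class in `𝔎` of a twisted 1-cocycle with values in `U(1)[G²]`. -/
noncomputable def muClass {μ : G → U1GG G} (hμ : groupCohomology.IsMulCocycle₁ μ) : KGroup G :=
  Multiplicative.ofAdd (Submodule.Quotient.mk
    ((groupCohomology.H1π (repU1GG G)).hom (groupCohomology.cocyclesOfIsMulCocycle₁ hμ)))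

/-- The class in `H²(G, U(1)[G])`, written multiplicatively, of a twisted 2-cocycle. -/
noncomputable def lambdaClass {l : G × G → U1G G} (hl : groupCohomology.IsMulCocycle₂ l) :
    Multiplicative (groupCohomology.H2 (repU1G G)) :=
  Multiplicative.ofAdd
    ((groupCohomology.H2π (repU1G G)).hom (groupCohomology.cocyclesOfIsMulCocycle₂ hl))

namespace Symmetry

variable {A : SpinChain}

/-- The phases `l (k, m) g = λ_g(k, m)` are those of the crossing operators `X`:
`α^(k)(X_{k⁻¹gk}(m)) X_g(k) = λ_g(k, m) X_g(km)`. -/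
def IsCrossingPhase (α : Symmetry G A) (X : G → G → A.Alg) (l : G × G → U1G G) : Prop :=
  ∀ g k m, α k (X (k⁻¹ * g * k) m) * X g k = ((l (k, m) g : Circle) : ℂ) • X g (k * m)

/-- The phases `μ k g h = μ_{g,h}(k)` are those obtained by conjugating the fusion operators `Φ`:
`α^(k)(Φ(k⁻¹gk, k⁻¹hk)) = μ_{g,h}(k) Φ(g, h)`. -/
def IsFusionPhase (α : Symmetry G A) (Φ : G → G → A.Alg) (μ : G → U1GG G) : Prop :=
  ∀ g h k, α k (Φ (k⁻¹ * g * k) (k⁻¹ * h * k)) = ((μ k g h : Circle) : ℂ) • Φ g h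

/-- `c` is the obstruction class `Λ(α) = [λ]`, computed from some right restriction of `α` (at any
site, with any defect size) and some choice of crossing operators. -/
def HasObstruction (α : Symmetry G A) (c : Multiplicative (groupCohomology.H2 (repU1G G))) : Prop :=
  ∃ (j : ℤ) (L : ℕ) (r : G → (A.Alg ≃⋆ₐ[ℂ] A.Alg)) (X : G → G → A.Alg) (l : G × G → U1G G)
    (hl : groupCohomology.IsMulCocycle₂ l),
    α.IsRightRestriction j L r ∧ α.IsCrossing r X ∧ α.IsCrossingPhase X l ∧ lambdaClass hl = c

/-- `c` is the class `[μ]` in `𝔎` computed from some covariant right restriction of `α` (at any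
site, with any defect size) and some choice of fusion operators. -/
def HasMuClass (α : Symmetry G A) (c : KGroup G) : Prop :=
  ∃ (j : ℤ) (L : ℕ) (r : G → (A.Alg ≃⋆ₐ[ℂ] A.Alg)) (Φ : G → G → A.Alg) (μ : G → U1GG G)
    (hμ : groupCohomology.IsMulCocycle₁ μ),
    α.IsRightRestriction j L r ∧ α.IsCovariant r ∧ IsFusion r Φ ∧ α.IsFusionPhase Φ μ ∧
      muClass hμ = c

end Symmetry

variable (G)

/-- The collection of all `G`-symmetries on arbitrary spin chains with `Λ = [1]`. -/
structure SymTriv where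
  chain : SpinChain
  sym : Symmetry G chain
  obstruction : sym.HasObstruction 1

variable {G}

/-- Stable equivalence on the symmetries with `Λ = [1]`. -/
def SymTriv.Rel (α β : SymTriv G) : Prop := α.sym.StablyEquivalent β.sym

end SpinChains

/-!
The index `Υ` of a symmetry `α` is computed from a right restriction `r` together with crossing
operators `X` whose phases `λ` are trivial (`IsFlatCrossing`; these exist exactly if `Λ(α) = [1]`).
For fusion operators `Φ` of `r` the equation

  `α^(k)(Φ(k⁻¹gk, k⁻¹hk)) X_{gh}(k) = μ_{g,h}(k) X_g(k) r^(g)(X_h(k)) Φ(g, h)`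

defines phases `μ` (`IsTwistedPhase`): both sides implement the same automorphism, and the centre of
the chain algebra consists of scalars. If `r` is covariant, `X = 1` is allowed and these are the
phases of the statement. The phases form a twisted 1-cocycle, and a change of `r` (by local
unitaries `V_g`, as two right restrictions differ by local automorphisms), of `X` and of `Φ` changes
`μ` by a coboundary and by an element of the image of `ι`. So the class in `𝔎` depends on `α` only:
`HasTwistedClass.unique`. This definition avoids covariance, and most properties become evident:

* the class is multiplicative under stacking (`HasTwistedClass.stack`), it is transported along
  isomorphisms of bounded range (`HasTwistedClass.transport`), in particular along finite depth
  circuits, and it is trivial for symmetries that can be cut exactly at some site, as range `0` and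
  decoupled ones can;
* after stacking with the regular symmetry, conjugating with `∑ₕ X_g(h) ⊗ |h⟩⟨h|` makes the right
  restriction covariant (`IsFlatCrossing.exists_covariant`), so `Υ` is the class of the statement.

For local computability, two symmetries that agree on an interval are glued to a third one, equal to
`α` on the left and to `β` on the right. Right restrictions can be moved to any site
(`IsRightRestriction.exists_left`, `IsRightRestriction.exists_right`), hence covariant ones exist
far to the left and far to the right, and these show that the glued symmetry has the class of `α` as
well as that of `β`.

The analytic input is small. The subalgebra `A_X` is the commutant of the on-site algebras outside
`X` (`SpinChain.mem_sub_of_commute`, by averaging over matrix units), and star homomorphisms from a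
finite matrix algebra `A_D'` into `A_D` are unitarily equivalent in `A_D`
(`SpinChain.exists_unitary_conj`, a version of the Skolem–Noether theorem); both give that
automorphisms that are trivial outside of a finite set are implemented by local unitaries.

Finiteness of `𝔎` follows as `U(1)` is divisible with finite torsion: every twisted cocycle is
cohomologous to one with values in the `|G|`-th roots of unity.
-/

open scoped ENNReal InnerProductSpace Kronecker
namespace SpinChains

/-! ### Instances on the chain algebra

The chain algebra is a subalgebra of an algebra of bounded operators, and finding its algebraic
structure from scratch is slow. The following are local shortcuts to the instances found that way.
-/

section Shortcuts

variable (A : SpinChain)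

noncomputable abbrev algCStarAlgebra : CStarAlgebra A.Alg := inferInstance
noncomputable abbrev algNonUnitalCStarAlgebra : NonUnitalCStarAlgebra A.Alg := inferInstance
noncomputable abbrev algSeminormedAddCommGroup : SeminormedAddCommGroup A.Alg := inferInstance
noncomputable abbrev algRing : Ring A.Alg := inferInstance
noncomputable abbrev algSemiring : Semiring A.Alg := inferInstance
noncomputable abbrev algNonUnitalNonAssocSemiring : NonUnitalNonAssocSemiring A.Alg := inferInstance
noncomputable abbrev algNonAssocSemiring : NonAssocSemiring A.Alg := inferInstance
noncomputable abbrev algMonoid : Monoid A.Alg := inferInstance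
noncomputable abbrev algMulOneClass : MulOneClass A.Alg := inferInstance
noncomputable abbrev algSemigroup : Semigroup A.Alg := inferInstance
noncomputable abbrev algMul : Mul A.Alg := inferInstance
noncomputable abbrev algAdd : Add A.Alg := inferInstance
noncomputable abbrev algAddCommMonoid : AddCommMonoid A.Alg := inferInstance
noncomputable abbrev algAddCommGroup : AddCommGroup A.Alg := inferInstance
noncomputable abbrev algStarRing : StarRing A.Alg := inferInstance
noncomputable abbrev algStarMul : StarMul A.Alg := inferInstance
noncomputable abbrev algStar : Star A.Alg := inferInstance
noncomputable abbrev algAlgebra : Algebra ℂ A.Alg := inferInstance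
noncomputable abbrev algModule : Module ℂ A.Alg := inferInstance
noncomputable abbrev algSMul : SMul ℂ A.Alg := inferInstance

end Shortcuts

attribute [local instance] algCStarAlgebra algNonUnitalCStarAlgebra algSeminormedAddCommGroup
  algRing algSemiring algNonUnitalNonAssocSemiring algNonAssocSemiring algMonoid
  algMulOneClass algSemigroup algMul algAdd algAddCommMonoid algAddCommGroup algStarRing
  algStarMul algStar algAlgebra algModule algSMul

open SpinChains.SpinChain

/-! ### Representations of matrix algebras are unitarily equivalent -/

namespace SpinChain

section SkolemNoether

variable {E : Type*} [NormedAddCommGroup E] [InnerProductSpace ℂ E] [FiniteDimensional ℂ E]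

/-- Orthogonal projections of equal rank are the initial and final projections of a partial
isometry. -/
theorem exists_partialIsometry {p q : E →L[ℂ] E} (hp : IsStarProjection p)
    (hq : IsStarProjection q)
    (h : LinearMap.trace ℂ E p.toLinearMap = LinearMap.trace ℂ E q.toLinearMap) :
    ∃ w : E →L[ℂ] E, star w * w = p ∧ w * star w = q := by
  obtain ⟨K, hK⟩ : ∃ K : Submodule ℂ E, p = K.starProjection := by
    refine ⟨p.range, (ContinuousLinearMap.IsStarProjection.ext_iff hp
      isStarProjection_starProjection).2 ?_⟩
    simp
  obtain ⟨K', hK'⟩ : ∃ K : Submodule ℂ E, q = K.starProjection := by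
    refine ⟨q.range, (ContinuousLinearMap.IsStarProjection.ext_iff hq
      isStarProjection_starProjection).2 ?_⟩
    simp
  have tr : ∀ K : Submodule ℂ E, LinearMap.trace ℂ E K.starProjection.toLinearMap =
      (Module.finrank ℂ K : ℂ) := fun K => by
    refine LinearMap.IsProj.trace (p := K) ⟨fun x => ?_, fun x hx => ?_⟩
    · simp
    · simpa [Submodule.starProjection_eq_self_iff] using hx
  subst hK hK'
  rw [tr, tr, Nat.cast_inj] at h
  let e : K ≃ₗᵢ[ℂ] K' :=
    (stdOrthonormalBasis ℂ K).equiv (stdOrthonormalBasis ℂ K') (finCongr h)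
  let w : E →L[ℂ] E := K'.subtypeL ∘L e.toLinearIsometry.toContinuousLinearMap ∘L
    K.orthogonalProjectionOnto
  let w' : E →L[ℂ] E := K.subtypeL ∘L e.symm.toLinearIsometry.toContinuousLinearMap ∘L
    K'.orthogonalProjectionOnto
  have hw : star w = w' := by
    rw [ContinuousLinearMap.star_eq_adjoint, eq_comm, ContinuousLinearMap.eq_adjoint_iff]
    intro x y
    change ⟪((e.symm (K'.orthogonalProjectionOnto x) : K) : E), y⟫_ℂ =
      ⟪x, ((e (K.orthogonalProjectionOnto y) : K') : E)⟫_ℂ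
    rw [← Submodule.inner_orthogonalProjectionOnto_eq_of_mem_left,
      ← Submodule.inner_orthogonalProjectionOnto_eq_of_mem_right]
    rw [← e.inner_map_map, e.apply_symm_apply]
  refine ⟨w, ?_, ?_⟩
  · rw [hw]
    ext x
    change ((e.symm (K'.orthogonalProjectionOnto
      ((e (K.orthogonalProjectionOnto x) : K') : E)) : K) : E) = _
    simp
  · rw [hw]
    ext x
    change ((e (K.orthogonalProjectionOnto
      ((e.symm (K'.orthogonalProjectionOnto x) : K) : E)) : K') : E) = _
    simp

variable {n : Type*} [Fintype n] [DecidableEq n]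

theorem sum_single_diag : ∑ j, (Matrix.single j j 1 : Matrix n n ℂ) = 1 := by
  ext a b
  simp [Matrix.sum_apply, Matrix.one_apply, Matrix.single_apply, Finset.filter_and,
    Finset.filter_eq']
  split_ifs with h <;> simp [h]

/-- All diagonal matrix units have the same trace, so it is determined by the dimension. -/
theorem trace_map_single (f : Matrix n n ℂ →⋆ₐ[ℂ] (E →L[ℂ] E)) (i : n) :
    Fintype.card n * LinearMap.trace ℂ E (f (Matrix.single i i 1)).toLinearMap =
      Module.finrank ℂ E := by
  have h1 : ∀ j, LinearMap.trace ℂ E (f (Matrix.single j j 1)).toLinearMap =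
      LinearMap.trace ℂ E (f (Matrix.single i i 1)).toLinearMap := fun j => by
    have e1 : (Matrix.single j j 1 : Matrix n n ℂ) = Matrix.single j i 1 * Matrix.single i j 1 := by
      simp
    have e2 : (Matrix.single i i 1 : Matrix n n ℂ) = Matrix.single i j 1 * Matrix.single j i 1 := by
      simp
    rw [e1, e2, map_mul, map_mul]
    exact LinearMap.trace_mul_comm ℂ _ _
  have h3 := congrArg (fun x => LinearMap.trace ℂ E (f x).toLinearMap)
    (sum_single_diag (n := n)).symm
  simp only [map_one, map_sum, ContinuousLinearMap.toLinearMap_sum, h1, Finset.sum_const,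
    Finset.card_univ] at h3
  rw [← nsmul_eq_mul, ← h3]
  exact LinearMap.trace_one ℂ E

/-- The Skolem-Noether theorem for unital `*`-homomorphisms between full matrix algebras: any two
of them are unitarily conjugate. -/
theorem exists_unitary_conj_linear [Nonempty n] (f g : Matrix n n ℂ →⋆ₐ[ℂ] (E →L[ℂ] E)) :
    ∃ u ∈ unitary (E →L[ℂ] E), ∀ x, u * f x = g x * u := by
  obtain ⟨i⟩ := ‹Nonempty n›
  have hproj : ∀ f : Matrix n n ℂ →⋆ₐ[ℂ] (E →L[ℂ] E), IsStarProjection (f (Matrix.single i i 1)) :=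
    fun f => ⟨by
      rw [IsIdempotentElem, ← map_mul]; simp, by
      rw [IsSelfAdjoint, ← map_star]
      simp [Matrix.star_eq_conjTranspose]⟩
  obtain ⟨w, hw1, hw2⟩ := exists_partialIsometry (hproj f) (hproj g) (by
    have h1 := trace_map_single f i
    rw [← trace_map_single g i] at h1
    exact mul_left_cancel₀ (by simp [Fintype.card_ne_zero]) h1)
  have hst : ∀ a b : n, star (Matrix.single a b 1 : Matrix n n ℂ) = Matrix.single b a 1 := by
    intro a b
    simp [Matrix.star_eq_conjTranspose]
  have h2 := sum_single_diag (n := n)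
  -- a partial isometry intertwines the corner projections
  have hpw : w * f (Matrix.single i i 1) = w := by
    have h : star (w * f (Matrix.single i i 1) - w) * (w * f (Matrix.single i i 1) - w) = 0 := by
      have hs := (hproj f).2.star_eq
      have hi := (hproj f).1.eq
      rw [star_sub, star_mul, hs, sub_mul, mul_sub, mul_sub]
      simp only [mul_assoc]
      rw [← mul_assoc (star w) w, hw1]
      simp [hi]
    exact sub_eq_zero.1 (CStarRing.star_mul_self_eq_zero_iff _ |>.1 h)
  have hqw : g (Matrix.single i i 1) * w = w := by
    rw [← hw2, mul_assoc, hw1, hpw]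
  let u := ∑ j, g (Matrix.single j i 1) * w * f (Matrix.single i j 1)
  have hu : ∀ a b, u * f (Matrix.single a b 1) = g (Matrix.single a b 1) * u := by
    intro a b
    simp only [u, Finset.sum_mul, Finset.mul_sum]
    rw [Finset.sum_eq_single a, Finset.sum_eq_single b]
    · rw [mul_assoc, ← map_mul, ← mul_assoc, ← mul_assoc, ← map_mul]
      simp
    · intro j _ hj
      rw [← mul_assoc, ← mul_assoc, ← map_mul, Matrix.single_mul_single_of_ne _ _ _ _ hj.symm]
      simp
    · simp
    · intro j _ hj
      rw [mul_assoc, ← map_mul, Matrix.single_mul_single_of_ne _ _ _ _ hj]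
      simp
    · simp
  have hu' : ∀ x, u * f x = g x * u := by
    intro x
    rw [Matrix.matrix_eq_sum_single x]
    simp only [map_sum, Finset.mul_sum, Finset.sum_mul]
    refine Finset.sum_congr rfl fun a _ => Finset.sum_congr rfl fun b _ => ?_
    have : (Matrix.single a b (x a b) : Matrix n n ℂ) = x a b • Matrix.single a b 1 := by
      simp
    rw [this, map_smul, map_smul, mul_smul_comm, smul_mul_assoc, hu]
  have hsu : star u = ∑ j, f (Matrix.single j i 1) * star w * g (Matrix.single i j 1) := by
    simp only [u, star_sum, star_mul, ← map_star, hst, mul_assoc]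
  refine ⟨u, ⟨?_, ?_⟩, hu'⟩
  · rw [hsu]
    simp only [Finset.sum_mul]
    rw [← map_one f, ← h2, map_sum]
    refine Finset.sum_congr rfl fun j _ => ?_
    rw [mul_assoc, ← hu, mul_assoc, ← mul_assoc (star w) u]
    have : star w * u = f (Matrix.single i i 1) := by
      simp only [u, Finset.mul_sum]
      rw [Finset.sum_eq_single i]
      · rw [hqw, hpw, hw1]
      · intro a _ ha
        rw [mul_assoc, ← mul_assoc]
        have : star w * g (Matrix.single a i 1) = 0 := by
          rw [← hqw, star_mul, ← map_star, hst, mul_assoc, ← map_mul,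
            Matrix.single_mul_single_of_ne _ _ _ _ ha.symm, map_zero, mul_zero]
        rw [this, zero_mul]
      · simp
    rw [this, ← map_mul, ← map_mul]
    simp
  · rw [hsu]
    simp only [Finset.mul_sum]
    rw [← map_one g, ← h2, map_sum]
    refine Finset.sum_congr rfl fun j _ => ?_
    rw [← mul_assoc, ← mul_assoc, hu, mul_assoc (g _) u]
    have : u * star w = g (Matrix.single i i 1) := by
      simp only [u, Finset.sum_mul]
      rw [Finset.sum_eq_single i]
      · rw [hqw, hpw, hw2]
      · intro a _ ha
        rw [mul_assoc]
        have : f (Matrix.single i a 1) * star w = 0 := by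
          rw [← hpw, star_mul, ← map_star, hst, ← mul_assoc, ← map_mul,
            Matrix.single_mul_single_of_ne _ _ _ _ ha, map_zero, zero_mul]
        rw [this, mul_zero]
      · simp
    rw [this, ← map_mul, ← map_mul]
    simp

end SkolemNoether

/-! ### Commutants in the chain algebra and implementation of automorphisms -/

section Commutant

variable {A : SpinChain}

theorem commute_of_mem_sub {X : Set ℤ} {x y : A.Alg} (hx : x ∈ A.sub X)
    (h : ∀ j ∈ X, ∀ a, Commute (A.ofSite j a) y) : Commute x y := by
  have hT : IsClosed (StarSubalgebra.centralizer ℂ {y} : Set A.Alg) := by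
    have : (StarSubalgebra.centralizer ℂ {y} : Set A.Alg) =
        {z | y * z = z * y} ∩ {z | star y * z = z * star y} := by
      ext z
      rw [SetLike.mem_coe, StarSubalgebra.mem_centralizer_iff]
      simp
    rw [this]
    exact (isClosed_eq (by fun_prop) (by fun_prop)).inter (isClosed_eq (by fun_prop) (by fun_prop))
  have h1 : x ∈ StarSubalgebra.centralizer ℂ {y} :=
    map_mem_of_mem_sub (f := StarAlgHom.id ℂ A.Alg) hT (fun j hj a => by
      change A.ofSite j a ∈ _
      rw [StarSubalgebra.mem_centralizer_iff]
      rintro _ rfl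
      refine ⟨(h j hj a).symm, ?_⟩
      have := (h j hj (star a)).star_star
      rw [map_star, star_star] at this
      exact this.symm) hx
  rw [StarSubalgebra.mem_centralizer_iff] at h1
  exact (h1 y rfl).1.symm

theorem sub_commute {X Y : Set ℤ} (h : Disjoint X Y) {x y : A.Alg} (hx : x ∈ A.sub X)
    (hy : y ∈ A.sub Y) : Commute x y :=
  commute_of_mem_sub hx fun _ hi a => (commute_of_mem_sub hy fun _ hj b =>
    (A.ofSite_commute (fun e => Set.disjoint_left.1 h hi (by rwa [e])) a b).symm).symm

theorem isClosed_range_matrixHom {n : Type*} [Fintype n] {C : Type*} [CStarAlgebra C]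
    [DecidableEq n] (π : Matrix n n ℂ →⋆ₐ[ℂ] C) : IsClosed (π.range : Set C) :=
  Submodule.closed_of_finiteDimensional (LinearMap.range π.toAlgHom.toLinearMap)

/-- The algebra of a finite set of sites is a full matrix algebra. -/
theorem exists_matrixModel {S : Set ℤ} (hS : S.Finite) :
    ∃ (n : Type) (_ : Fintype n) (_ : DecidableEq n) (_ : Nonempty n)
      (π : Matrix n n ℂ →⋆ₐ[ℂ] A.Alg), π.range = A.sub S := by
  suffices h : ∃ (n : Type) (_ : Fintype n) (_ : DecidableEq n) (_ : Nonempty n)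
      (π : Matrix n n ℂ →⋆ₐ[ℂ] A.Alg), (∀ j ∈ S, ∀ a, ∃ x, π x = A.ofSite j a) ∧
        ∀ x, π x ∈ A.sub S by
    obtain ⟨n, _, _, _, π, h1, h2⟩ := h
    refine ⟨n, inferInstance, inferInstance, inferInstance, π, le_antisymm ?_ fun x hx => ?_⟩
    · rintro _ ⟨x, rfl⟩
      exact h2 x
    · exact map_mem_of_mem_sub (f := StarAlgHom.id ℂ A.Alg) (isClosed_range_matrixHom π)
        (fun j hj a => h1 j hj a) hx
  induction S, hS using Set.Finite.induction_on with
  | empty =>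
    let e : Matrix Unit Unit ℂ ≃⋆ₐ[ℂ] ℂ :=
      StarAlgEquiv.ofAlgEquiv (Matrix.uniqueAlgEquiv) (fun x => by simp [Matrix.star_apply])
    exact ⟨Unit, inferInstance, inferInstance, inferInstance,
      (StarAlgHom.ofId ℂ A.Alg).comp e.toStarAlgHom, by simp,
      fun x => (A.sub ∅).algebraMap_mem (e x)⟩
  | @insert i S hi _ ih =>
    obtain ⟨n, _, _, _, π, h1, h2⟩ := ih
    obtain ⟨k, hk⟩ := exists_kronHom π (A.ofSite i) (fun x a =>
      sub_commute (Set.disjoint_singleton_right.2 hi) (h2 x)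
        (ofSite_mem_sub (Set.mem_singleton i) a))
    refine ⟨n × A.site i, inferInstance, inferInstance, inferInstance, k, fun j hj a => ?_,
      fun x => ?_⟩
    · rcases hj with rfl | hj
      · exact ⟨1 ⊗ₖ a, by rw [hk, map_one, one_mul]⟩
      · obtain ⟨x, hx⟩ := h1 j hj a
        exact ⟨x ⊗ₖ 1, by rw [hk, map_one, mul_one, hx]⟩
    · induction x using kron_induction with
      | h b c =>
        rw [hk]
        exact mul_mem (sub_mono (Set.subset_insert _ _) (h2 b))
          (ofSite_mem_sub (Set.mem_insert _ _) c)
      | hadd x y hx hy => rw [map_add]; exact add_mem hx hy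

section Twirl

variable {n : Type*} [Fintype n] [DecidableEq n] {C : Type*} [CStarAlgebra C]

/-- The average of `x` over the matrix algebra `π`, `n⁻¹ ∑ᵢⱼ π(eᵢⱼ) x π(eⱼᵢ)`: the conditional
expectation onto the commutant of `π`. -/
noncomputable def twirl (π : Matrix n n ℂ →⋆ₐ[ℂ] C) : C →ₗ[ℂ] C :=
  (Fintype.card n : ℂ)⁻¹ • ∑ i, ∑ j, LinearMap.mulLeftRight ℂ
    (π (Matrix.single i j 1), π (Matrix.single j i 1))

theorem twirl_apply (π : Matrix n n ℂ →⋆ₐ[ℂ] C) (x : C) : twirl π x =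
    (Fintype.card n : ℂ)⁻¹ • ∑ i, ∑ j, π (Matrix.single i j 1) * x * π (Matrix.single j i 1) := by
  simp [twirl]

theorem twirl_of_commute [Nonempty n] (π : Matrix n n ℂ →⋆ₐ[ℂ] C) {x : C}
    (h : ∀ a, Commute (π a) x) : twirl π x = x := by
  have h1 : ∀ i j, π (Matrix.single i j 1) * x * π (Matrix.single j i 1) =
      x * π (Matrix.single i i 1) := fun i j => by
    rw [(h _).eq, mul_assoc, ← map_mul]
    simp
  have h2 : ∑ i, x * π (Matrix.single i i 1) = x := by
    rw [← Finset.mul_sum, ← map_sum, sum_single_diag, map_one, mul_one]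
  simp only [twirl_apply, h1, Finset.sum_const, Finset.card_univ, ← Finset.smul_sum]
  rw [h2, ← Nat.cast_smul_eq_nsmul ℂ, smul_smul, inv_mul_cancel₀ (by simp), one_smul]

/-- On a product of an element `x` of the commutant with `π(b)` the average acts as the normalized
trace on the second factor. -/
theorem twirl_mul (π : Matrix n n ℂ →⋆ₐ[ℂ] C) {x : C} (h : ∀ a, Commute (π a) x)
    (b : Matrix n n ℂ) : twirl π (x * π b) = ((Fintype.card n : ℂ)⁻¹ * b.trace) • x := by
  have h1 : ∀ i j, π (Matrix.single i j 1) * (x * π b) * π (Matrix.single j i 1) =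
      b j j • (x * π (Matrix.single i i 1)) := fun i j => by
    rw [← mul_assoc, (h _).eq, mul_assoc, mul_assoc, ← map_mul, ← map_mul, ← mul_assoc,
      ← mul_smul_comm, ← map_smul]
    congr 2
    rw [Matrix.single_mul_mul_single]
    simp
  have h2 : ∑ i, x * π (Matrix.single i i 1) = x := by
    rw [← Finset.mul_sum, ← map_sum, sum_single_diag, map_one, mul_one]
  simp only [twirl_apply, h1]
  rw [Finset.sum_comm]
  simp only [← Finset.smul_sum, ← Finset.sum_smul, h2, Matrix.trace, Matrix.diag]
  rw [smul_smul]

open scoped CStarAlgebra ComplexOrder in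
/-- The average is positive and unital, so it is bounded independently of the matrix size. -/
theorem norm_twirl_le [Nonempty n] (π : Matrix n n ℂ →⋆ₐ[ℂ] C) (x : C) :
    ‖twirl π x‖ ≤ 6 * ‖x‖ := by
  nontriviality C
  let := CStarAlgebra.spectralOrder C
  let := CStarAlgebra.spectralOrderedRing C
  have h1 : twirl π 1 = 1 := twirl_of_commute π fun a => Commute.one_right _
  have hpos : ∀ y : C, 0 ≤ y → 0 ≤ twirl π y := fun y hy => by
    rw [twirl_apply]
    have : (0 : ℂ) ≤ (Fintype.card n : ℂ)⁻¹ := by positivity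
    have hs : 0 ≤ ∑ i, ∑ j, π (Matrix.single i j 1) * y * π (Matrix.single j i 1) := by
      refine Finset.sum_nonneg fun i _ => Finset.sum_nonneg fun j _ => ?_
      have : π (Matrix.single j i 1) = star (π (Matrix.single i j 1)) := by
        rw [← map_star]
        simp [Matrix.star_eq_conjTranspose]
      rw [this]
      exact star_right_conjugate_nonneg hy _
    have e : (Fintype.card n : ℂ)⁻¹ •
          ∑ i, ∑ j, π (Matrix.single i j 1) * y * π (Matrix.single j i 1) =
        (Fintype.card n : ℝ)⁻¹ •
          ∑ i, ∑ j, π (Matrix.single i j 1) * y * π (Matrix.single j i 1) := by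
      rw [← Complex.coe_smul]
      simp
    rw [e]
    exact smul_nonneg (by positivity) hs
  have hposn : ∀ y : C, 0 ≤ y → ‖twirl π y‖ ≤ ‖y‖ := fun y hy => by
    rw [CStarAlgebra.norm_le_iff_le_algebraMap _ (norm_nonneg y) (hpos y hy)]
    have h2 := hpos _ (sub_nonneg.2 (IsSelfAdjoint.of_nonneg hy).le_algebraMap_norm_self)
    rw [map_sub, sub_nonneg] at h2
    refine h2.trans (le_of_eq ?_)
    have e : algebraMap ℝ C ‖y‖ = ((‖y‖ : ℝ) : ℂ) • (1 : C) := by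
      rw [Complex.coe_smul, Algebra.algebraMap_eq_smul_one]
    rw [e, map_smul, h1]
  have hsa : ∀ y : C, IsSelfAdjoint y → ‖twirl π y‖ ≤ 3 * ‖y‖ := fun y hy => by
    have e : algebraMap ℝ C ‖y‖ = ((‖y‖ : ℝ) : ℂ) • (1 : C) := by
      rw [Complex.coe_smul, Algebra.algebraMap_eq_smul_one]
    have h2 : 0 ≤ algebraMap ℝ C ‖y‖ + y := by
      have := hy.neg_algebraMap_norm_le_self
      exact neg_le_iff_add_nonneg'.1 this
    have h3 := hposn _ h2
    have h4 : twirl π y = twirl π (algebraMap ℝ C ‖y‖ + y) - algebraMap ℝ C ‖y‖ := by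
      rw [map_add, e, map_smul, h1]
      abel
    have h5 : ‖algebraMap ℝ C ‖y‖‖ = ‖y‖ := by simp
    calc _ ≤ ‖twirl π (algebraMap ℝ C ‖y‖ + y)‖ + ‖algebraMap ℝ C ‖y‖‖ := by
          rw [h4]
          exact norm_sub_le _ _
      _ ≤ (‖algebraMap ℝ C ‖y‖‖ + ‖y‖) + ‖algebraMap ℝ C ‖y‖‖ :=
          add_le_add_left (h3.trans (norm_add_le _ _)) _
      _ = _ := by rw [h5]; ring
  have hre : ‖((realPart x : selfAdjoint C) : C)‖ ≤ ‖x‖ := realPart.norm_le x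
  have him : ‖((imaginaryPart x : selfAdjoint C) : C)‖ ≤ ‖x‖ := imaginaryPart.norm_le x
  have h6 : twirl π x = twirl π (realPart x : C) + Complex.I • twirl π (imaginaryPart x : C) := by
    rw [← map_smul, ← map_add, realPart_add_I_smul_imaginaryPart]
  rw [h6]
  refine (norm_add_le _ _).trans ?_
  rw [norm_smul, Complex.norm_I, one_mul]
  have := hsa _ (realPart x).2
  have := hsa _ (imaginaryPart x).2
  linarith

end Twirl

/-- Local elements are dense. -/
theorem exists_finite_near (x : A.Alg) {ε : ℝ} (hε : 0 < ε) :
    ∃ S : Set ℤ, S.Finite ∧ ∃ y ∈ A.sub S, ‖x - y‖ < ε := by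
  have h : x ∈ closure (StarAlgebra.adjoin ℂ (⋃ j, Set.range (A.ofSite j)) : Set A.Alg) := by
    have : x ∈ (StarAlgebra.adjoin ℂ (⋃ j, Set.range (A.ofSite j))).topologicalClosure := by
      rw [closure_adjoin_ofSite]
      trivial
    exact this
  obtain ⟨y, hy, hxy⟩ := Metric.mem_closure_iff.1 h ε hε
  obtain ⟨S, hS⟩ := A.exists_finset_of_mem_adjoin _ hy
  exact ⟨S, S.finite_toSet, y, hS _ fun j hj a => ofSite_mem_sub (by exact_mod_cast hj) a,
    by rwa [← dist_eq_norm]⟩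

/-- Haag duality: the commutant of the algebra of the complement of `X` is `A_X`. -/
theorem mem_sub_of_commute {X : Set ℤ} {x : A.Alg}
    (h : ∀ j ∉ X, ∀ a, Commute (A.ofSite j a) x) : x ∈ A.sub X := by
  have hc : x ∈ closure (A.sub X : Set A.Alg) := by
    refine Metric.mem_closure_iff.2 fun ε hε => ?_
    -- Averaging over the part `F \ X` of the support of a local approximation `y` of `x` fixes `x`,
    -- and it maps `y` into `A_X`.
    obtain ⟨F, hF, y, hy, hxy⟩ := exists_finite_near x (div_pos hε (by norm_num : (0 : ℝ) < 6))
    obtain ⟨n, _, _, _, π, hπ⟩ := exists_matrixModel (A := A)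
      (hF.subset Set.sdiff_subset : (F \ X).Finite)
    obtain ⟨m, _, _, _, σ, hσ⟩ := exists_matrixModel (A := A)
      (hF.subset Set.inter_subset_left : (F ∩ X).Finite)
    have hπm : ∀ a, π a ∈ A.sub (F \ X) := fun a => hπ ▸ ⟨a, rfl⟩
    have hσm : ∀ a, σ a ∈ A.sub (F ∩ X) := fun a => hσ ▸ ⟨a, rfl⟩
    have hdis : Disjoint (F ∩ X) (F \ X) :=
      Set.disjoint_left.2 fun _ h1 h2 => h2.2 h1.2
    obtain ⟨k, hk⟩ := exists_kronHom σ π fun a b => sub_commute hdis (hσm a) (hπm b)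
    have hyk : y ∈ k.range := by
      refine map_mem_of_mem_sub (f := StarAlgHom.id ℂ A.Alg) (isClosed_range_matrixHom k)
        (fun j hj a => ?_) hy
      by_cases hjX : j ∈ X
      · obtain ⟨b, hb⟩ : A.ofSite j a ∈ σ.range := by
          rw [hσ]
          exact ofSite_mem_sub (X := F ∩ X) ⟨hj, hjX⟩ a
        exact ⟨b ⊗ₖ 1, by change k _ = _; rw [hk, map_one, mul_one]; exact hb⟩
      · obtain ⟨b, hb⟩ : A.ofSite j a ∈ π.range := by
          rw [hπ]
          exact ofSite_mem_sub (X := F \ X) ⟨hj, hjX⟩ a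
        exact ⟨1 ⊗ₖ b, by change k _ = _; rw [hk, map_one, one_mul]; exact hb⟩
    have htk : ∀ c, twirl π (k c) ∈ A.sub X := fun c => by
      induction c using kron_induction with
      | h a b =>
        rw [hk, twirl_mul _ fun b => sub_commute hdis.symm (hπm b) (hσm a)]
        exact (A.sub X).smul_mem (sub_mono Set.inter_subset_right (hσm a)) _
      | hadd a b ha hb => rw [map_add, map_add]; exact add_mem ha hb
    have hty : twirl π y ∈ A.sub X := by
      obtain ⟨c, rfl⟩ := hyk
      exact htk c
    have htx : twirl π x = x := twirl_of_commute π fun a =>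
      commute_of_mem_sub (hπm a) fun j hj b => h j hj.2 b
    refine ⟨twirl π y, hty, ?_⟩
    rw [dist_eq_norm]
    calc ‖x - twirl π y‖ = ‖twirl π (x - y)‖ := by rw [map_sub, htx]
      _ ≤ 6 * ‖x - y‖ := norm_twirl_le π _
      _ < ε := by linarith
  rwa [(isClosed_sub X).closure_eq] at hc

theorem mem_sub_of_forall_commute {X : Set ℤ} {x : A.Alg}
    (h : ∀ y ∈ A.sub Xᶜ, Commute y x) : x ∈ A.sub X :=
  mem_sub_of_commute fun _ hj a => h _ (ofSite_mem_sub hj a)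

/-- The chain algebra has trivial centre. -/
theorem exists_scalar {x : A.Alg} (h : ∀ y, Commute y x) : ∃ c : ℂ, x = c • 1 := by
  have h1 : x ∈ A.sub ∅ := mem_sub_of_commute fun _ _ _ => h _
  have h2 : x ∈ (StarAlgHom.ofId ℂ A.Alg).range := by
    refine map_mem_of_mem_sub (f := StarAlgHom.id ℂ A.Alg) ?_ (fun j hj => hj.elim) h1
    exact Submodule.closed_of_finiteDimensional
      (LinearMap.range (StarAlgHom.ofId ℂ A.Alg).toAlgHom.toLinearMap)
  obtain ⟨c, hc⟩ := h2
  exact ⟨c, by rw [← hc]; exact Algebra.algebraMap_eq_smul_one c⟩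

/-- Two unitaries implementing the same automorphism differ by a phase. -/
theorem exists_phase {u v : A.Alg} (hu : u ∈ unitary A.Alg) (hv : v ∈ unitary A.Alg)
    (h : ∀ x, u * x * star u = v * x * star v) : ∃ c : Circle, u = (c : ℂ) • v := by
  have hw : ∀ y, Commute y (star v * u) := fun y => by
    have h1 : v * star v * u * y * star u * u = v * y * star v * u := by
      rw [Unitary.mul_star_self_of_mem hv, one_mul, h]
    have h2 := congrArg (fun z => star v * z) h1
    simp only [mul_assoc, Unitary.star_mul_self_of_mem hu, mul_one] at h2
    simp only [← mul_assoc, Unitary.star_mul_self_of_mem hv, one_mul] at h2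
    change _ * _ = _ * _
    rw [← mul_assoc, ← h2]
  obtain ⟨c, hc⟩ := exists_scalar hw
  have huv : u = c • v := by
    have := congrArg (fun z => v * z) hc
    simpa [← mul_assoc, Unitary.mul_star_self_of_mem hv] using this
  have hcc : ‖c‖ = 1 := by
    have h1 : ‖u‖ = 1 := CStarRing.norm_of_mem_unitary hu
    rw [huv, norm_smul, CStarRing.norm_of_mem_unitary hv, mul_one] at h1
    exact h1
  exact ⟨⟨c, by simp [Submonoid.unitSphere, hcc]⟩, huv⟩

/-- Two embeddings of one local algebra in another are unitarily conjugate. -/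
theorem exists_unitary_conj {D' D : Set ℤ} (hD' : D'.Finite) (hD : D.Finite)
    (f g : A.Alg →⋆ₐ[ℂ] A.Alg) (hf : ∀ x ∈ A.sub D', f x ∈ A.sub D)
    (hg : ∀ x ∈ A.sub D', g x ∈ A.sub D) :
    ∃ v ∈ unitary A.Alg, v ∈ A.sub D ∧ ∀ x ∈ A.sub D', v * f x * star v = g x := by
  obtain ⟨n, _, _, _, π, hπ⟩ := exists_matrixModel (A := A) hD'
  obtain ⟨m, _, _, _, σ, hσ⟩ := exists_matrixModel (A := A) hD
  have hinj : Function.Injective σ := RingHom.injective σ.toAlgHom.toRingHom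
  have hπm : ∀ a, π a ∈ A.sub D' := fun a => hπ ▸ ⟨a, rfl⟩
  let e : Matrix m m ℂ ≃⋆ₐ[ℂ] σ.range := StarAlgEquiv.ofInjective σ hinj
  let ε := Matrix.toEuclideanCLM (n := m) (𝕜 := ℂ)
  let F : ∀ f : A.Alg →⋆ₐ[ℂ] A.Alg, (∀ x ∈ A.sub D', f x ∈ A.sub D) →
      (Matrix n n ℂ →⋆ₐ[ℂ] (EuclideanSpace ℂ m →L[ℂ] EuclideanSpace ℂ m)) := fun f hf =>
    ε.toStarAlgHom.comp (e.symm.toStarAlgHom.comp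
      ((f.comp π).codRestrict σ.range fun a => by rw [hσ]; exact hf _ (hπm a)))
  have hF : ∀ f hf a, σ (ε.symm (F f hf a)) = f (π a) := fun f hf a => by
    change σ (ε.symm (ε (e.symm ⟨f (π a), _⟩))) = _
    rw [StarAlgEquiv.symm_apply_apply]
    exact congrArg Subtype.val (e.apply_symm_apply _)
  obtain ⟨u, hu, huc⟩ := exists_unitary_conj_linear (F f hf) (F g hg)
  have hv : σ (ε.symm u) ∈ unitary A.Alg :=
    Unitary.map_mem (σ.comp ε.symm.toStarAlgHom) hu
  refine ⟨σ (ε.symm u), hv, hσ ▸ ⟨_, rfl⟩, fun x hx => ?_⟩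
  rw [← hπ] at hx
  obtain ⟨a, rfl⟩ := hx
  change _ * f (π a) * _ = g (π a)
  have := congrArg (fun z => σ (ε.symm z)) (huc a)
  simp only [map_mul, hF] at this
  rw [this, mul_assoc, Unitary.mul_star_self_of_mem hv, mul_one]

theorem aut_ext {C : Type*} [CStarAlgebra C] {f g : A.Alg ≃⋆ₐ[ℂ] C}
    (h : ∀ j a, f (A.ofSite j a) = g (A.ofSite j a)) : f = g := by
  have : f.toStarAlgHom = g.toStarAlgHom := hom_ext h
  ext1 x
  exact DFunLike.congr_fun this x

/-- An automorphism that is trivial outside of a finite set `S` of sites is implemented by a unitary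
in `A_S`. -/
theorem exists_implement {S : Set ℤ} (hS : S.Finite) (ψ : A.Alg ≃⋆ₐ[ℂ] A.Alg)
    (h : ∀ x ∈ A.sub Sᶜ, ψ x = x) :
    ∃ u ∈ unitary A.Alg, u ∈ A.sub S ∧ ∀ x, ψ x = u * x * star u := by
  obtain ⟨u, hu, huS, huc⟩ := exists_unitary_conj (A := A) hS hS (StarAlgHom.id ℂ A.Alg)
    ψ.toStarAlgHom (fun x hx => hx) (fun x hx => mem_sub_of_forall_commute fun y hy => by
      have := (sub_commute disjoint_compl_left hy hx).map ψ
      rwa [h y hy] at this)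
  refine ⟨u, hu, huS, ?_⟩
  have : ψ = Unitary.conjStarAlgAut ℂ A.Alg ⟨u, hu⟩ := by
    refine aut_ext fun j a => ?_
    rw [Unitary.conjStarAlgAut_apply]
    by_cases hj : j ∈ S
    · exact (huc _ (ofSite_mem_sub hj a)).symm
    · have hm := ofSite_mem_sub (A := A) (X := Sᶜ) hj a
      rw [h _ hm]
      change _ = u * _ * star u
      rw [(sub_commute disjoint_compl_right huS hm).eq, mul_assoc, Unitary.mul_star_self_of_mem hu,
        mul_one]
  intro x
  rw [this, Unitary.conjStarAlgAut_apply]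

/-- A unitary whose adjoint action is trivial outside of `X` lies in `A_X`. -/
theorem mem_sub_of_conj {X : Set ℤ} {u : A.Alg} (hu : u ∈ unitary A.Alg)
    (h : ∀ x ∈ A.sub Xᶜ, u * x * star u = x) : u ∈ A.sub X :=
  mem_sub_of_forall_commute fun y hy => by
    have h1 := congrArg (fun z => z * u) (h y hy)
    simp only [mul_assoc, Unitary.star_mul_self_of_mem hu, mul_one] at h1
    exact h1.symm

end Commutant
end SpinChain

/-! ### Classes of multiplicative cocycles and finiteness of `𝔎` -/

section Cohomology
open groupCohomology

variable {G : Type} [Group G]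

theorem muClass_mul {μ ν : G → U1GG G} (hμ : IsMulCocycle₁ μ) (hν : IsMulCocycle₁ ν)
    (h : IsMulCocycle₁ (fun k => μ k * ν k)) : muClass h = muClass hμ * muClass hν := by
  have : cocyclesOfIsMulCocycle₁ h = cocyclesOfIsMulCocycle₁ hμ + cocyclesOfIsMulCocycle₁ hν := rfl
  rw [muClass, this, map_add]
  rfl

theorem muClass_one (h : IsMulCocycle₁ (fun _ : G => (1 : U1GG G))) : muClass h = 1 := by
  have : cocyclesOfIsMulCocycle₁ h = 0 := rfl
  rw [muClass, this, map_zero]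
  rfl

theorem iota_H1π (x : cocycles₁ (repU1G G)) : (iota G).hom ((H1π (repU1G G)).hom x) =
    (H1π (repU1GG G)).hom ((mapCocycles₁ (MonoidHom.id G) (iotaRep G)).hom x) := by
  have e := H1π_comp_map (A := repU1G G) (B := repU1GG G) (MonoidHom.id G) (iotaRep G)
  exact DFunLike.congr_fun (congrArg ModuleCat.Hom.hom e) x

/-- Coboundaries and the image of `ι` do not change the class in `𝔎`. -/
theorem muClass_eq_of_twist {μ μ' : G → U1GG G} (hμ : IsMulCocycle₁ μ) (hμ' : IsMulCocycle₁ μ')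
    {θ : G → U1G G} (hθ : IsMulCocycle₁ θ) (φ : U1GG G)
    (h : ∀ k, μ' k = μ k * iotaHom G (θ k) * (k • φ / φ)) : muClass hμ' = muClass hμ := by
  refine congrArg Multiplicative.ofAdd ((Submodule.Quotient.eq _).2
    ⟨(H1π (repU1G G)).hom (cocyclesOfIsMulCocycle₁ hθ), ?_⟩)
  rw [iota_H1π, ← map_sub]
  have hφ : ∀ k, k • φ⁻¹ / φ⁻¹ = iotaHom G (θ k) / (μ' k / μ k) := fun k => by
    rw [h, smul_inv']
    generalize iotaHom G (θ k) = a
    rw [mul_assoc, mul_div_cancel_left, div_mul_cancel_left, inv_div_inv, inv_div]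
  exact (H1π_eq_iff _ _).2 ⟨Additive.ofMul (φ⁻¹ : U1GG G), funext fun k =>
    congrArg Additive.ofMul (hφ k)⟩

theorem exists_of_lambdaClass_eq_one {l : G × G → U1G G} (hl : IsMulCocycle₂ l)
    (h : lambdaClass hl = 1) : IsMulCoboundary₂ l :=
  isMulCoboundary₂_of_mem_coboundaries₂ l ((H2π_eq_zero_iff _).1 h)

theorem lambdaClass_one (h : IsMulCocycle₂ (fun _ : G × G => (1 : U1G G))) :
    lambdaClass h = 1 := by
  have : cocyclesOfIsMulCocycle₂ h = 0 := rfl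
  rw [lambdaClass, this, map_zero]
  rfl

theorem isMulCocycle₂_one : IsMulCocycle₂ (fun _ : G × G => (1 : U1G G)) := fun g h j => by
  simp

theorem exists_circle_pow_eq {n : ℕ} (hn : n ≠ 0) (c : Circle) : ∃ d : Circle, d ^ n = c := by
  refine ⟨Circle.exp (Complex.arg c / n), ?_⟩
  rw [← Circle.exp_nsmul, nsmul_eq_mul, mul_div_cancel₀ _ (by exact_mod_cast hn), Circle.exp_arg]

theorem finite_circle_pow_eq_one {n : ℕ} (hn : n ≠ 0) : Finite {c : Circle // c ^ n = 1} := by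
  have : NeZero n := ⟨hn⟩
  refine Finite.of_injective (β := rootsOfUnity n ℂ)
    (fun c => ⟨Circle.toUnits c.1, ?_⟩) fun c d hcd => ?_
  · rw [mem_rootsOfUnity, ← map_pow, c.2, map_one]
  · have := congrArg (fun z => ((z : ℂˣ) : ℂ)) (congrArg Subtype.val hcd)
    exact Subtype.ext (Subtype.ext this)

/-- Every class of `H¹` is represented by a cocycle with values in the `|G|`-th roots of unity, as
the product `b` of the values of a cocycle `μ` satisfies `μ(k) ^ |G| = b / k • b` and `b` has a
`|G|`-th root. There are finitely many such cocycles. -/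
theorem finite_KGroup [Finite G] : Finite (KGroup G) := by
  have := Fintype.ofFinite G
  classical
  have hn : Fintype.card G ≠ 0 := Fintype.card_ne_zero
  let T := {μ : G → U1GG G // IsMulCocycle₁ μ ∧ ∀ k g h, μ k g h ^ Fintype.card G = 1}
  have : Finite {c : Circle // c ^ Fintype.card G = 1} := finite_circle_pow_eq_one hn
  have hT : Finite T := by
    refine Finite.of_injective (β := G → G → G → {c : Circle // c ^ Fintype.card G = 1})
      (fun μ k g h => ⟨μ.1 k g h, μ.2.2 k g h⟩) fun μ ν h => ?_
    refine Subtype.ext (funext fun k => funext fun g => funext fun h' => ?_)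
    exact congrArg Subtype.val (congrFun (congrFun (congrFun h k) g) h')
  refine Finite.of_surjective (fun μ : T => muClass μ.2.1) fun c => ?_
  obtain ⟨c, rfl⟩ := Multiplicative.ofAdd.surjective c
  obtain ⟨c, rfl⟩ := Submodule.Quotient.mk_surjective _ c
  induction c using H1_induction_on with
  | h x =>
  suffices h : ∀ (μ : G → U1GG G) (hc : IsMulCocycle₁ μ), ∃ ν : T, muClass ν.2.1 = muClass hc from
    h x.1 (isMulCocycle₁_of_mem_cocycles₁ (M := U1GG G) x.1 x.2)
  intro μ hc
  let b : U1GG G := ∏ l, μ l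
  have hb : ∀ k, k • b * μ k ^ Fintype.card G = b := fun k => by
    have h1 : ∏ l, (k • μ l * μ k) = ∏ l, μ l := by
      rw [← Equiv.prod_comp (Equiv.mulLeft k) μ]
      exact Finset.prod_congr rfl fun l _ => (hc k l).symm
    rw [Finset.prod_mul_distrib, Finset.prod_const, Finset.card_univ, ← Finset.smul_prod'] at h1
    exact h1
  choose d hd using fun g h => exists_circle_pow_eq hn (b g h)
  let φ : U1GG G := d
  have hφ : φ ^ Fintype.card G = b := funext fun g => funext fun h => hd g h
  let ν : G → U1GG G := fun k => μ k * (k • φ / φ)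
  have hν : IsMulCocycle₁ ν := fun k l => by
    simp only [ν]
    rw [hc k l, smul_mul', smul_div', mul_smul]
    rw [mul_mul_mul_comm, div_mul_div_cancel]
  have hνn : ∀ k, ν k ^ Fintype.card G = 1 := fun k => by
    simp only [ν]
    rw [mul_pow, div_pow, ← smul_pow', hφ, ← mul_div_assoc, mul_comm, hb, div_self']
  refine ⟨⟨ν, hν, fun k g h => congrFun (congrFun (hνn k) g) h⟩, ?_⟩
  refine muClass_eq_of_twist (θ := 1) hc hν (fun _ _ => by simp) φ fun k => ?_
  simp [ν]

end Cohomology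

/-! ### Local unitaries -/

section LocalUnitary
variable {A : SpinChain}

theorem SpinChain.hom_eq_on_sub {C : Type*} [CStarAlgebra C] {f g : A.Alg →⋆ₐ[ℂ] C} {X : Set ℤ}
    (h : ∀ j ∈ X, ∀ a, f (A.ofSite j a) = g (A.ofSite j a)) {x : A.Alg} (hx : x ∈ A.sub X) :
    f x = g x := by
  have hc : IsClosed (StarAlgHom.equalizer f g : Set A.Alg) :=
    isClosed_eq (continuous_starHom f) (continuous_starHom g)
  exact map_mem_of_mem_sub (f := StarAlgHom.id ℂ A.Alg) hc (fun j hj a => h j hj a) hx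

theorem SpinChain.aut_eq_on_sub {C : Type*} [CStarAlgebra C] {f g : A.Alg ≃⋆ₐ[ℂ] C} {X : Set ℤ}
    (h : ∀ j ∈ X, ∀ a, f (A.ofSite j a) = g (A.ofSite j a)) {x : A.Alg} (hx : x ∈ A.sub X) :
    f x = g x :=
  hom_eq_on_sub (f := f.toStarAlgHom) (g := g.toStarAlgHom) h hx

theorem SpinChain.finite_fatten {S : Set ℤ} (hS : S.Finite) (R : ℕ) : (fatten S R).Finite := by
  have : fatten S R ⊆ ⋃ i ∈ S, Set.Icc (i - R) (i + R) := by
    rintro j ⟨i, hi, hij⟩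
    rw [abs_le] at hij
    exact Set.mem_biUnion hi ⟨by omega, by omega⟩
  exact (hS.biUnion fun i _ => Set.finite_Icc _ _).subset this

theorem IsLocalUnitary.of_finite {u : A.Alg} {S : Set ℤ} (hu : u ∈ unitary A.Alg) (hS : S.Finite)
    (h : u ∈ A.sub S) : IsLocalUnitary u :=
  ⟨hu, hS.toFinset, by rwa [hS.coe_toFinset]⟩

theorem IsLocalUnitary.one : IsLocalUnitary (1 : A.Alg) := ⟨one_mem _, ∅, one_mem _⟩

theorem IsLocalUnitary.mul {u v : A.Alg} (hu : IsLocalUnitary u) (hv : IsLocalUnitary v) :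
    IsLocalUnitary (u * v) := by
  obtain ⟨hu, S, hS⟩ := hu
  obtain ⟨hv, T, hT⟩ := hv
  exact ⟨mul_mem hu hv, S ∪ T, mul_mem (sub_mono (by simp) hS) (sub_mono (by simp) hT)⟩

theorem IsLocalUnitary.star {u : A.Alg} (hu : IsLocalUnitary u) : IsLocalUnitary (star u) :=
  ⟨Unitary.star_mem hu.1, hu.2.choose, star_mem hu.2.choose_spec⟩

theorem IsLocalUnitary.smul {u : A.Alg} (hu : IsLocalUnitary u) (c : Circle) :
    IsLocalUnitary ((c : ℂ) • u) := by
  refine ⟨⟨?_, ?_⟩, hu.2.choose, (A.sub _).smul_mem hu.2.choose_spec _⟩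
  · rw [star_smul, smul_mul_smul_comm, Unitary.star_mul_self_of_mem hu.1]
    simp [← Circle.coe_inv_eq_conj]
  · rw [star_smul, smul_mul_smul_comm, Unitary.mul_star_self_of_mem hu.1]
    simp [← Circle.coe_inv_eq_conj]

theorem IsLocalUnitary.map {B : SpinChain} {f : A.Alg →⋆ₐ[ℂ] B.Alg} {R : ℕ}
    (hf : ∀ X : Set ℤ, ∀ x ∈ A.sub X, f x ∈ B.sub (fatten X R)) {u : A.Alg}
    (hu : IsLocalUnitary u) : IsLocalUnitary (f u) := by
  obtain ⟨hu, S, hS⟩ := hu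
  exact .of_finite (Unitary.map_mem f hu) (finite_fatten S.finite_toSet R) (hf _ _ hS)

theorem IsLocalUnitary.map_qca {α : A.Alg ≃⋆ₐ[ℂ] A.Alg} (h : IsQCA α) {u : A.Alg}
    (hu : IsLocalUnitary u) : IsLocalUnitary (α u) :=
  hu.map (f := α.toStarAlgHom) h.choose_spec

theorem star_mul_cancel {u : A.Alg} (hu : u ∈ unitary A.Alg) (x : A.Alg) :
    star u * (u * x) = x := by
  rw [← mul_assoc, Unitary.star_mul_self_of_mem hu, one_mul]

theorem mul_star_cancel {u : A.Alg} (hu : u ∈ unitary A.Alg) (x : A.Alg) :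
    u * (star u * x) = x := by
  rw [← mul_assoc, Unitary.mul_star_self_of_mem hu, one_mul]

theorem phase_unique {c d : Circle} {u : A.Alg} (hu : u ∈ unitary A.Alg)
    (h : (c : ℂ) • u = (d : ℂ) • u) : c = d := by
  have h0 : u ≠ 0 := by
    rintro rfl
    have := Unitary.star_mul_self_of_mem hu
    simp at this
  exact Circle.ext (smul_left_injective ℂ h0 h)

end LocalUnitary

/-! ### Right restrictions, fusion operators and the twisted class -/

namespace Symmetry

variable {G : Type} [Group G] {A B : SpinChain} {α : Symmetry G A}
  {r r' : G → (A.Alg ≃⋆ₐ[ℂ] A.Alg)} {X X' Φ Φ' : G → G → A.Alg} {μ μ' : G → U1GG G}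

theorem mul_apply (α : Symmetry G A) (k l : G) (x : A.Alg) : α (k * l) x = α k (α l x) := by
  rw [map_mul]; rfl

theorem one_apply (α : Symmetry G A) (x : A.Alg) : α 1 x = x := by
  rw [map_one]; rfl

theorem apply_inv_apply (α : Symmetry G A) (k : G) (x : A.Alg) : α k (α k⁻¹ x) = x := by
  rw [← mul_apply, mul_inv_cancel, one_apply]

theorem inv_apply_apply (α : Symmetry G A) (k : G) (x : A.Alg) : α k⁻¹ (α k x) = x := by
  rw [← mul_apply, inv_mul_cancel, one_apply]

theorem conj_mul (k g h : G) : k⁻¹ * (g * h) * k = k⁻¹ * g * k * (k⁻¹ * h * k) := by group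

theorem conj_conj (k l g : G) : (k * l)⁻¹ * g * (k * l) = l⁻¹ * (k⁻¹ * g * k) * l := by group

/-- A common bound for the ranges of the automorphisms of a symmetry of a finite group. -/
theorem exists_rangeLE [Finite G] (α : Symmetry G A) : ∃ R, α.RangeLE R := by
  have := Fintype.ofFinite G
  choose R hR using α.isQCA
  exact ⟨Finset.univ.sup R, fun g => (hR g).mono (Finset.le_sup (Finset.mem_univ g))⟩

theorem fatten_Ici (m : ℤ) (R : ℕ) : fatten (Set.Ici m) R ⊆ Set.Ici (m - R) := by
  rintro j ⟨i, hi, hij⟩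
  rw [abs_le] at hij
  simp only [Set.mem_Ici] at *
  omega

theorem fatten_Iio (m : ℤ) (R : ℕ) : fatten (Set.Iio m) R ⊆ Set.Iio (m + R) := by
  rintro j ⟨i, hi, hij⟩
  rw [abs_le] at hij
  simp only [Set.mem_Iio] at *
  omega

theorem fatten_Icc (m n : ℤ) (R : ℕ) : fatten (Set.Icc m n) R ⊆ Set.Icc (m - R) (n + R) := by
  rintro j ⟨i, hi, hij⟩
  rw [abs_le] at hij
  simp only [Set.mem_Icc] at *
  omega

theorem RangeLE.mem_Ici {R : ℕ} (h : α.RangeLE R) (g : G) {m : ℤ} {x : A.Alg}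
    (hx : x ∈ A.sub (Set.Ici m)) : α g x ∈ A.sub (Set.Ici (m - R)) :=
  sub_mono (fatten_Ici m R) (h g _ _ hx)

theorem RangeLE.mem_Iio {R : ℕ} (h : α.RangeLE R) (g : G) {m : ℤ} {x : A.Alg}
    (hx : x ∈ A.sub (Set.Iio m)) : α g x ∈ A.sub (Set.Iio (m + R)) :=
  sub_mono (fatten_Iio m R) (h g _ _ hx)

theorem RangeLE.mem_Icc {R : ℕ} (h : α.RangeLE R) (g : G) {m n : ℤ} {x : A.Alg}
    (hx : x ∈ A.sub (Set.Icc m n)) : α g x ∈ A.sub (Set.Icc (m - R) (n + R)) :=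
  sub_mono (fatten_Icc m n R) (h g _ _ hx)

namespace IsRightRestriction

variable {j : ℤ} {L : ℕ}

theorem symm_left (hr : α.IsRightRestriction j L r) (g : G) {x : A.Alg}
    (hx : x ∈ A.sub (Set.Iio (j - L))) : (r g).symm x = x := by
  rw [StarAlgEquiv.symm_apply_eq, hr.left g x hx]

theorem symm_right (hr : α.IsRightRestriction j L r) {R : ℕ} (hα : α.RangeLE R) (g : G)
    {x : A.Alg} (hx : x ∈ A.sub (Set.Ici (j + L + R))) : (r g).symm x = α g⁻¹ x := by
  have h1 : α g⁻¹ x ∈ A.sub (Set.Ici (j + L)) := by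
    have := hα.mem_Ici g⁻¹ hx
    rwa [add_sub_cancel_right] at this
  rw [StarAlgEquiv.symm_apply_eq, hr.right g _ h1, apply_inv_apply]

theorem mono (hr : α.IsRightRestriction j L r) {j' : ℤ} {L' : ℕ} (h1 : j + L ≤ j' + L')
    (h2 : j' - L' ≤ j - L) : α.IsRightRestriction j' L' r :=
  ⟨fun g x hx => hr.right g x (sub_mono (Set.Ici_subset_Ici.2 h1) hx),
    fun g x hx => hr.left g x (sub_mono (Set.Iio_subset_Iio h2) hx)⟩

end IsRightRestriction

theorem sub_compl_Ico {m n : ℤ} {ψ : A.Alg ≃⋆ₐ[ℂ] A.Alg} (h1 : ∀ x ∈ A.sub (Set.Iio m), ψ x = x)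
    (h2 : ∀ x ∈ A.sub (Set.Ici n), ψ x = x) : ∀ x ∈ A.sub (Set.Ico m n)ᶜ, ψ x = x := by
  intro x hx
  refine hom_eq_on_sub (f := ψ.toStarAlgHom) (g := StarAlgHom.id ℂ A.Alg) (fun i hi a => ?_) hx
  change ψ (A.ofSite i a) = A.ofSite i a
  by_cases him : i < m
  · exact h1 _ (ofSite_mem_sub (Set.mem_Iio.2 him) a)
  · simp only [Set.mem_compl_iff, Set.mem_Ico, not_and, not_lt] at hi him
    exact h2 _ (ofSite_mem_sub (Set.mem_Ici.2 (hi him)) a)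

/-- Two right restrictions of the same symmetry differ by conjugation with local unitaries. -/
theorem IsRightRestriction.exists_compare [Finite G] {j j' : ℤ} {L L' : ℕ}
    (hr : α.IsRightRestriction j L r) (hr' : α.IsRightRestriction j' L' r') :
    ∃ V : G → A.Alg, ∀ g, IsLocalUnitary (V g) ∧ ∀ x, r' g x = V g * r g x * star (V g) := by
  obtain ⟨R, hR⟩ := α.exists_rangeLE
  have hr := hr.mono (j' := j) (L' := L + (L' + (j - j').natAbs)) (by omega) (by omega)
  have hr' := hr'.mono (j' := j) (L' := L + (L' + (j - j').natAbs)) (by omega) (by omega)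
  have h : ∀ g, ∃ V, IsLocalUnitary V ∧ ∀ x, r' g x = V * r g x * star V := fun g => by
    obtain ⟨u, hu, hus, h⟩ := exists_implement (Set.finite_Ico _ _) ((r g).symm.trans (r' g))
      (sub_compl_Ico (fun x hx => by
          change r' g ((r g).symm x) = x
          rw [hr.symm_left g hx, hr'.left g _ hx])
        (fun x hx => by
          change r' g ((r g).symm x) = x
          have h1 := hR.mem_Ici g⁻¹ hx
          rw [add_sub_cancel_right] at h1
          rw [hr.symm_right hR g hx, hr'.right g _ h1, apply_inv_apply]))
    refine ⟨u, .of_finite hu (Set.finite_Ico _ _) hus, fun x => ?_⟩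
    rw [← h (r g x)]
    change _ = r' g ((r g).symm _)
    rw [StarAlgEquiv.symm_apply_apply]
  choose V hV using h
  exact ⟨V, hV⟩

/-- Right restrictions have fusion operators near the site of the restriction. -/
theorem IsRightRestriction.exists_fusion {j : ℤ} {L R : ℕ} (hα : α.RangeLE R)
    (hr : α.IsRightRestriction j L r) :
    ∃ Φ : G → G → A.Alg, IsFusion r Φ ∧
      ∀ g h, Φ g h ∈ A.sub (Set.Ico (j - L) (j + L + R)) := by
  have h : ∀ g h, ∃ Φ : A.Alg, Φ ∈ unitary A.Alg ∧ Φ ∈ A.sub (Set.Ico (j - L) (j + L + R)) ∧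
      ∀ x, r g (r h x) = Φ * r (g * h) x * star Φ := fun g h => by
    obtain ⟨u, hu, hus, hx⟩ := exists_implement (Set.finite_Ico (j - L) (j + L + R))
      ((r (g * h)).symm.trans ((r h).trans (r g)))
      (sub_compl_Ico (fun x hx => by
          change r g (r h ((r (g * h)).symm x)) = x
          rw [hr.symm_left _ hx, hr.left _ _ hx, hr.left _ _ hx])
        (fun x hx => by
          change r g (r h ((r (g * h)).symm x)) = x
          have h1 : ∀ k, α k x ∈ A.sub (Set.Ici (j + L)) := fun k => by
            have := hα.mem_Ici k hx
            rwa [add_sub_cancel_right] at this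
          rw [hr.symm_right hα _ hx, hr.right h _ (h1 _), ← mul_apply, hr.right g, ← mul_apply]
          · rw [mul_inv_rev, mul_inv_cancel_left, mul_inv_cancel, one_apply]
          · rw [mul_inv_rev, mul_inv_cancel_left]
            exact h1 _))
    refine ⟨u, hu, hus, fun x => ?_⟩
    rw [← hx]
    change _ = r g (r h ((r (g * h)).symm _))
    rw [StarAlgEquiv.symm_apply_apply]
  choose Φ hΦ using h
  exact ⟨Φ, fun g h => ⟨.of_finite (hΦ g h).1 (Set.finite_Ico _ _) (hΦ g h).2.1, (hΦ g h).2.2⟩,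
    fun g h => (hΦ g h).2.1⟩

/-- Crossing operators whose phases `λ` are all equal to `1`. -/
structure IsFlatCrossing (α : Symmetry G A) (r : G → (A.Alg ≃⋆ₐ[ℂ] A.Alg)) (X : G → G → A.Alg) :
    Prop where
  isCrossing : α.IsCrossing r X
  flat : ∀ g k m, α k (X (k⁻¹ * g * k) m) * X g k = X g (k * m)

/-- The phases `μ k g h = μ_{g,h}(k)` of a right restriction with flat crossing operators `X`, which
measure how far the fusion operators are from being preserved by the symmetry:
`α^(k)(Φ(k⁻¹gk, k⁻¹hk)) X_{gh}(k) = μ_{g,h}(k) X_g(k) r^(g)(X_h(k)) Φ(g, h)`. -/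
def IsTwistedPhase (α : Symmetry G A) (r : G → (A.Alg ≃⋆ₐ[ℂ] A.Alg)) (X Φ : G → G → A.Alg)
    (μ : G → U1GG G) : Prop :=
  ∀ g h k, α k (Φ (k⁻¹ * g * k) (k⁻¹ * h * k)) * X (g * h) k =
    ((μ k g h : Circle) : ℂ) • (X g k * r g (X h k) * Φ g h)

/-- `c` is the class `[μ]` computed from some right restriction with flat crossing operators. This
extends `HasMuClass` to right restrictions that are not covariant. -/
def HasTwistedClass (α : Symmetry G A) (c : KGroup G) : Prop :=
  ∃ (j : ℤ) (L : ℕ) (r : G → (A.Alg ≃⋆ₐ[ℂ] A.Alg)) (X Φ : G → G → A.Alg) (μ : G → U1GG G)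
    (hμ : groupCohomology.IsMulCocycle₁ μ),
    α.IsRightRestriction j L r ∧ α.IsFlatCrossing r X ∧ IsFusion r Φ ∧
      α.IsTwistedPhase r X Φ μ ∧ muClass hμ = c

theorem IsCrossing.apply (hX : α.IsCrossing r X) (g k : G) (x : A.Alg) :
    α k (r (k⁻¹ * g * k) x) = X g k * r g (α k x) * star (X g k) := by
  have := (hX g k).2 (r g (α k x))
  rwa [StarAlgEquiv.symm_apply_apply, inv_apply_apply] at this

theorem IsCrossing.unitary (hX : α.IsCrossing r X) (g k : G) : X g k ∈ unitary A.Alg := (hX g k).1.1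

theorem IsCrossing.apply_mul (hX : α.IsCrossing r X) (g k : G) (x : A.Alg) :
    α k (r (k⁻¹ * g * k) x) * X g k = X g k * r g (α k x) := by
  rw [hX.apply, mul_assoc, Unitary.star_mul_self_of_mem (hX.unitary g k), mul_one]

theorem IsFusion.unitary (hΦ : IsFusion r Φ) (g k : G) : Φ g k ∈ unitary A.Alg := (hΦ g k).1.1

/-- Both sides of the defining equation intertwine `r^(gh) α^(k)` with
`α^(k) r^(k⁻¹gk) r^(k⁻¹hk)`, so they differ by a phase. -/
theorem exists_twistedPhase (hX : α.IsCrossing r X) (hΦ : IsFusion r Φ) :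
    ∃ μ, α.IsTwistedPhase r X Φ μ := by
  have h : ∀ k g h, ∃ c : Circle, α k (Φ (k⁻¹ * g * k) (k⁻¹ * h * k)) * X (g * h) k =
      (c : ℂ) • (X g k * r g (X h k) * Φ g h) := fun k g h => by
    refine exists_phase (mul_mem (Unitary.map_mem (α k) (hΦ.unitary _ _)) (hX.unitary _ _))
      (mul_mem (mul_mem (hX.unitary _ _) (Unitary.map_mem (r g) (hX.unitary _ _)))
        (hΦ.unitary _ _)) fun x => ?_
    obtain ⟨x, rfl⟩ : ∃ y, r (g * h) y = x := (r (g * h)).surjective x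
    obtain ⟨x, rfl⟩ : ∃ y, α k y = x := (α k).surjective x
    trans α k (r (k⁻¹ * g * k) (r (k⁻¹ * h * k) x))
    · rw [(hΦ _ _).2, ← conj_mul, map_mul, map_mul, hX.apply, map_star, star_mul]
      simp only [mul_assoc (G := A.Alg)]
    · rw [hX.apply, hX.apply, map_mul, map_mul, (hΦ g h).2]
      simp only [star_mul, mul_assoc (G := A.Alg), map_star]
  choose μ hμ using h
  exact ⟨μ, fun g h k => hμ k g h⟩

/-- As `X` is flat, the equations for `μ(k)` and `μ(l)` compose to the one for `μ(kl)`. -/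
theorem IsTwistedPhase.isMulCocycle (hX : α.IsFlatCrossing r X) (hΦ : IsFusion r Φ)
    (hμ : α.IsTwistedPhase r X Φ μ) : groupCohomology.IsMulCocycle₁ μ := by
  intro k l
  refine funext fun g => funext fun h => ?_
  change μ (k * l) g h = μ l (k⁻¹ * g * k) (k⁻¹ * h * k) * μ k g h
  have hu : X g (k * l) * r g (X h (k * l)) * Φ g h ∈ unitary A.Alg :=
    mul_mem (mul_mem (hX.isCrossing.unitary _ _)
      (Unitary.map_mem (r g) (hX.isCrossing.unitary _ _))) (hΦ.unitary _ _)
  refine phase_unique hu ?_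
  rw [← hμ g h (k * l), mul_apply, ← hX.flat (g * h) k l, ← mul_assoc, ← map_mul, conj_conj,
    conj_conj, conj_mul k g h, hμ _ _ l, map_smul, map_mul, map_mul, smul_mul_assoc,
    mul_assoc (G := A.Alg), hμ g h k]
  rw [mul_smul_comm, smul_smul, Circle.coe_mul]
  congr 1
  rw [mul_assoc (α k _), ← mul_assoc _ (X g k * _), ← mul_assoc _ (X g k), hX.isCrossing.apply_mul,
    ← hX.flat g k l, ← hX.flat h k l, map_mul]
  simp only [mul_assoc (G := A.Alg)]

/-- How the phases `μ` change under a change `r'^(g) = Ad(V_g) r^(g)` of the right restriction. -/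
theorem IsTwistedPhase.twist_relation (hμ : α.IsTwistedPhase r X Φ μ) (hX : α.IsCrossing r X)
    (hX' : α.IsCrossing r' X') (hΦ : IsFusion r Φ) (hμ' : α.IsTwistedPhase r' X' Φ' μ')
    {V : G → A.Alg} (hVu : ∀ g, V g ∈ unitary A.Alg) (hVm : ∀ g x, r' g x * V g = V g * r g x)
    {θ φ : G → G → Circle}
    (hθ : ∀ k g, α k (V (k⁻¹ * g * k)) * X g k = (θ k g : ℂ) • (X' g k * V g))
    (hφ : ∀ g h, Φ' g h * V (g * h) = (φ g h : ℂ) • (V g * r g (V h) * Φ g h)) (k g h : G) :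
    θ k (g * h) * (μ' k g h * φ g h) =
      φ (k⁻¹ * g * k) (k⁻¹ * h * k) * (μ k g h * (θ k g * θ k h)) := by
  have hu : X' g k * V g * r g (X' h k * V h) * Φ g h ∈ unitary A.Alg :=
    mul_mem (mul_mem (mul_mem (hX'.unitary _ _) (hVu _)) (Unitary.map_mem (r g)
      (mul_mem (hX'.unitary _ _) (hVu _)))) (hΦ.unitary _ _)
  refine phase_unique hu ?_
  -- both sides are `α^(k)(Φ'(k⁻¹gk, k⁻¹hk)) α^(k)(V_{k⁻¹ghk}) X_{gh}(k)`
  trans α k (Φ' (k⁻¹ * g * k) (k⁻¹ * h * k)) * (α k (V (k⁻¹ * (g * h) * k)) * X (g * h) k)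
  · rw [hθ, mul_smul_comm, ← mul_assoc (α k _), hμ' g h k, smul_mul_assoc,
      mul_assoc _ (Φ' g h), hφ, mul_smul_comm, smul_smul, smul_smul, Circle.coe_mul,
      Circle.coe_mul]
    congr 1
    · ring
    · rw [map_mul]
      simp only [← mul_assoc (G := A.Alg)]
      rw [mul_assoc _ (r' g _), hVm]
      simp only [← mul_assoc (G := A.Alg)]
  · have e1 : α k (Φ' (k⁻¹ * g * k) (k⁻¹ * h * k)) * α k (V (k⁻¹ * (g * h) * k)) =
        (φ (k⁻¹ * g * k) (k⁻¹ * h * k) : ℂ) • (α k (V (k⁻¹ * g * k)) *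
          α k (r (k⁻¹ * g * k) (V (k⁻¹ * h * k))) * α k (Φ (k⁻¹ * g * k) (k⁻¹ * h * k))) := by
      rw [← map_mul, conj_mul, hφ, map_smul, map_mul, map_mul]
    have e2 : α k (r (k⁻¹ * g * k) (V (k⁻¹ * h * k))) * X g k =
        X g k * r g (α k (V (k⁻¹ * h * k))) :=
      hX.apply_mul g k _
    have e3 : r g (α k (V (k⁻¹ * h * k))) * r g (X h k) = (θ k h : ℂ) • r g (X' h k * V h) := by
      rw [← map_mul, hθ, map_smul]
    rw [← mul_assoc (α k _), e1, smul_mul_assoc, mul_assoc _ (α k (Φ _ _)), hμ g h k]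
    generalize r g (X' h k * V h) = z at *
    generalize α k (r (k⁻¹ * g * k) (V (k⁻¹ * h * k))) = w at *
    generalize r g (α k (V (k⁻¹ * h * k))) = w' at *
    calc _ = ((φ (k⁻¹ * g * k) (k⁻¹ * h * k) * μ k g h : Circle) : ℂ) •
          (α k (V (k⁻¹ * g * k)) * (w * X g k) * r g (X h k) * Φ g h) := by
          rw [mul_smul_comm, smul_smul, Circle.coe_mul]
          simp only [mul_assoc (G := A.Alg)]
      _ = ((φ (k⁻¹ * g * k) (k⁻¹ * h * k) * μ k g h : Circle) : ℂ) •
          ((α k (V (k⁻¹ * g * k)) * X g k) * (w' * r g (X h k)) * Φ g h) := by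
          rw [e2]
          simp only [mul_assoc (G := A.Alg)]
      _ = _ := by
          rw [hθ, e3, smul_mul_smul_comm, smul_mul_assoc, smul_smul, ← Circle.coe_mul,
            ← Circle.coe_mul, mul_assoc (φ _ _)]

/-- The class `[μ]` does not depend on the right restriction, its flat crossing operators and its
fusion operators. -/
theorem HasTwistedClass.unique [Finite G] {c c' : KGroup G} (h : α.HasTwistedClass c)
    (h' : α.HasTwistedClass c') : c' = c := by
  obtain ⟨j, L, r, X, Φ, μ, hμc, hr, hX, hΦ, hμ, rfl⟩ := h
  obtain ⟨j', L', r', X', Φ', μ', hμc', hr', hX', hΦ', hμ', rfl⟩ := h'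
  obtain ⟨V, hV⟩ := hr.exists_compare hr'
  have hVu := fun g => (hV g).1.1
  have hVm : ∀ g x, r' g x * V g = V g * r g x := fun g x => by
    rw [(hV g).2, mul_assoc, Unitary.star_mul_self_of_mem (hVu g), mul_one]
  have hθ : ∀ k g, ∃ c : Circle, α k (V (k⁻¹ * g * k)) * X g k = (c : ℂ) • (X' g k * V g) :=
    fun k g => by
      refine exists_phase (mul_mem (Unitary.map_mem (α k) (hVu _)) (hX.isCrossing.unitary _ _))
        (mul_mem (hX'.isCrossing.unitary _ _) (hVu _)) fun x => ?_
      obtain ⟨x, rfl⟩ : ∃ y, r g y = x := (r g).surjective x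
      obtain ⟨x, rfl⟩ : ∃ y, α k y = x := (α k).surjective x
      trans α k (r' (k⁻¹ * g * k) x)
      · rw [(hV _).2, map_mul, map_mul, hX.isCrossing.apply, map_star, star_mul]
        simp only [mul_assoc (G := A.Alg)]
      · rw [hX'.isCrossing.apply, (hV _).2, star_mul]
        simp only [mul_assoc (G := A.Alg)]
  choose θ hθ using hθ
  have hφ : ∀ g h, ∃ c : Circle, Φ' g h * V (g * h) = (c : ℂ) • (V g * r g (V h) * Φ g h) :=
    fun g h => by
      refine exists_phase (mul_mem (hΦ'.unitary _ _) (hVu _))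
        (mul_mem (mul_mem (hVu _) (Unitary.map_mem (r g) (hVu _))) (hΦ.unitary _ _)) fun x => ?_
      obtain ⟨x, rfl⟩ : ∃ y, r (g * h) y = x := (r (g * h)).surjective x
      trans r' g (r' h x)
      · rw [(hΦ' g h).2, (hV _).2, star_mul]
        simp only [mul_assoc (G := A.Alg)]
      · rw [(hV g).2, (hV h).2, map_mul, map_mul, (hΦ g h).2]
        simp only [star_mul, mul_assoc (G := A.Alg), map_star]
  choose φ hφ using hφ
  have hθc : groupCohomology.IsMulCocycle₁ (M := U1G G) θ := fun k l => funext fun g => by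
    change θ (k * l) g = θ l (k⁻¹ * g * k) * θ k g
    refine phase_unique (mul_mem (hX'.isCrossing.unitary g (k * l)) (hVu g)) ?_
    rw [← hθ, mul_apply, ← hX.flat g k l, ← mul_assoc, ← map_mul, conj_conj, hθ l, map_smul,
      map_mul, smul_mul_assoc, mul_assoc (G := A.Alg), hθ k g, mul_smul_comm, smul_smul,
      ← mul_assoc, hX'.flat, Circle.coe_mul]
  refine muClass_eq_of_twist hμc hμc' hθc φ fun k => funext fun g => funext fun h => ?_
  change μ' k g h = μ k g h * (θ k g * θ k h / θ k (g * h)) *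
    (φ (k⁻¹ * g * k) (k⁻¹ * h * k) / φ g h)
  have key := hμ.twist_relation hX.isCrossing hX'.isCrossing hΦ hμ' hVu hVm hθ hφ k g h
  have e : μ' k g h = φ (k⁻¹ * g * k) (k⁻¹ * h * k) * (μ k g h * (θ k g * θ k h)) /
      (θ k (g * h) * φ g h) := by
    rw [eq_div_iff_mul_eq', ← key]
    ac_rfl
  rw [e, mul_comm (φ (k⁻¹ * g * k) _), mul_div_mul_comm, mul_div_assoc]

end Symmetry

/-! ### Obstruction classes and flat crossing operators -/

namespace Symmetry

variable {G : Type} [Group G] {A B : SpinChain} {α : Symmetry G A} {β : Symmetry G B}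
  {r : G → (A.Alg ≃⋆ₐ[ℂ] A.Alg)} {X Φ : G → G → A.Alg}

theorem IsCrossing.of_apply (hu : ∀ g k, IsLocalUnitary (X g k))
    (h : ∀ g k x, α k (r (k⁻¹ * g * k) x) = X g k * r g (α k x) * star (X g k)) :
    α.IsCrossing r X := fun g k => ⟨hu g k, fun x => by
  rw [h, apply_inv_apply, StarAlgEquiv.apply_symm_apply]⟩

/-- If `Λ(α) = [1]`, the phases of the crossing operators can be normalized to `1`. -/
theorem HasObstruction.exists_flat (h : α.HasObstruction 1) :
    ∃ (j : ℤ) (L : ℕ) (r : G → (A.Alg ≃⋆ₐ[ℂ] A.Alg)) (X : G → G → A.Alg),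
      α.IsRightRestriction j L r ∧ α.IsFlatCrossing r X := by
  obtain ⟨j, L, r, X, l, hl, hr, hX, hXl, hc⟩ := h
  obtain ⟨χ, hχ⟩ := exists_of_lambdaClass_eq_one hl hc
  refine ⟨j, L, r, fun g k => (((χ k g)⁻¹ : Circle) : ℂ) • X g k, hr,
    ⟨fun g k => ⟨(hX g k).1.smul _, fun x => ?_⟩, fun g k m => ?_⟩⟩
  · rw [(hX g k).2, star_smul, smul_mul_assoc, smul_mul_smul_comm]
    simp [← Circle.coe_inv_eq_conj]
  · have h1 : χ m (k⁻¹ * g * k) / χ (k * m) g * χ k g = l (k, m) g := congrFun (hχ k m) g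
    rw [map_smul, smul_mul_smul_comm, hXl, smul_smul, ← h1]
    congr 1
    simp only [← Circle.coe_mul]
    congr 1
    rw [← mul_inv, div_mul_eq_mul_div, inv_mul_eq_div, div_div_cancel_left]

theorem IsFlatCrossing.hasObstruction {j : ℤ} {L : ℕ} (hr : α.IsRightRestriction j L r)
    (hX : α.IsFlatCrossing r X) : α.HasObstruction 1 :=
  ⟨j, L, r, X, fun _ => 1, isMulCocycle₂_one, hr, hX.isCrossing, fun g k m => by
    rw [hX.flat]
    exact (one_smul ℂ _).symm, lambdaClass_one _⟩

theorem HasTwistedClass.hasObstruction {c : KGroup G} (h : α.HasTwistedClass c) :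
    α.HasObstruction 1 := by
  obtain ⟨j, L, r, X, Φ, μ, hμc, hr, hX, -⟩ := h
  exact hX.hasObstruction hr

theorem IsFlatCrossing.exists_hasTwistedClass [Finite G] {j : ℤ} {L : ℕ}
    (hr : α.IsRightRestriction j L r) (hX : α.IsFlatCrossing r X) :
    ∃ c, α.HasTwistedClass c := by
  obtain ⟨R, hR⟩ := α.exists_rangeLE
  obtain ⟨Φ, hΦ, -⟩ := hr.exists_fusion hR
  obtain ⟨μ, hμ⟩ := exists_twistedPhase hX.isCrossing hΦ
  exact ⟨_, j, L, r, X, Φ, μ, hμ.isMulCocycle hX hΦ, hr, hX, hΦ, hμ, rfl⟩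

theorem HasObstruction.exists_hasTwistedClass [Finite G] (h : α.HasObstruction 1) :
    ∃ c, α.HasTwistedClass c := by
  obtain ⟨j, L, r, X, hr, hX⟩ := h.exists_flat
  exact hX.exists_hasTwistedClass hr

theorem IsCovariant.apply (hr : α.IsCovariant r) (g k : G) (x : A.Alg) :
    α k (r (k⁻¹ * g * k) x) = r g (α k x) := by
  rw [← hr g k, inv_apply_apply]

theorem IsCovariant.isFlatCrossing (hr : α.IsCovariant r) :
    α.IsFlatCrossing r fun _ _ => 1 where
  isCrossing := .of_apply (fun _ _ => .one) fun g k x => by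
    rw [hr.apply, star_one, mul_one, one_mul]
  flat g k m := by rw [map_one, mul_one]

theorem isTwistedPhase_one_iff {μ : G → U1GG G} :
    α.IsTwistedPhase r (fun _ _ => 1) Φ μ ↔ α.IsFusionPhase Φ μ := by
  simp only [IsTwistedPhase, IsFusionPhase, map_one, mul_one, one_mul]

theorem HasMuClass.hasTwistedClass {c : KGroup G} (h : α.HasMuClass c) : α.HasTwistedClass c := by
  obtain ⟨j, L, r, Φ, μ, hμc, hr, hc, hΦ, hμ, h⟩ := h
  exact ⟨j, L, r, fun _ _ => 1, Φ, μ, hμc, hr, hc.isFlatCrossing, hΦ,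
    isTwistedPhase_one_iff.2 hμ, h⟩

/-- A covariant right restriction that is itself an action of the group has trivial class. -/
theorem IsRightRestriction.hasMuClass_one {j : ℤ} {L : ℕ} (hr : α.IsRightRestriction j L r)
    (hc : α.IsCovariant r) (h : ∀ g h x, r g (r h x) = r (g * h) x) : α.HasMuClass 1 :=
  ⟨j, L, r, fun _ _ => 1, fun _ => 1, fun g h => by simp, hr, hc,
    fun g k => ⟨.one, fun x => by rw [h, star_one, mul_one, one_mul]⟩, fun g h k => by
      rw [map_one]
      exact (one_smul ℂ _).symm, muClass_one _⟩

end Symmetry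

/-! ### Homomorphisms glued along a cut, and symmetries that can be cut -/

/-- Homomorphisms on the left and on the right of a cut with commuting images glue. -/
theorem SpinChain.exists_glue {A : SpinChain} {C : Type*} [CStarAlgebra C] (f g : A.Alg →⋆ₐ[ℂ] C)
    (m : ℤ) (h : ∀ i < m, ∀ j ≥ m, ∀ a b, Commute (f (A.ofSite i a)) (g (A.ofSite j b))) :
    ∃ k : A.Alg →⋆ₐ[ℂ] C, (∀ x ∈ A.sub (Set.Iio m), k x = f x) ∧
      ∀ x ∈ A.sub (Set.Ici m), k x = g x := by
  let φ : ∀ j, A.OnSite j →⋆ₐ[ℂ] C := fun j =>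
    if j < m then f.comp (A.ofSite j) else g.comp (A.ofSite j)
  have hl : ∀ j < m, ∀ a, φ j a = f (A.ofSite j a) := fun j hj a => by
    simp only [φ, if_pos hj]
    rfl
  have hg : ∀ j ≥ m, ∀ a, φ j a = g (A.ofSite j a) := fun j hj a => by
    simp only [φ, if_neg (not_lt.2 hj)]
    rfl
  have hφ : ∀ i j, i ≠ j → ∀ a b, Commute (φ i a) (φ j b) := by
    intro i j hij a b
    rcases lt_or_ge i m with hi | hi <;> rcases lt_or_ge j m with hj | hj
    · rw [hl i hi, hl j hj]
      exact (A.ofSite_commute hij a b).map f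
    · rw [hl i hi, hg j hj]
      exact h i hi j hj a b
    · rw [hg i hi, hl j hj]
      exact (h j hj i hi b a).symm
    · rw [hg i hi, hg j hj]
      exact (A.ofSite_commute hij a b).map g
  refine ⟨A.lift φ hφ, fun x hx => ?_, fun x hx => ?_⟩
  · exact hom_eq_on_sub (fun j hj a => by rw [lift_ofSite, hl j hj]) hx
  · exact hom_eq_on_sub (fun j hj a => by rw [lift_ofSite, hg j hj]) hx

theorem SpinChain.aut_ext_cut {A : SpinChain} {C : Type*} [CStarAlgebra C] {f g : A.Alg →⋆ₐ[ℂ] C}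
    (m : ℤ) (h1 : ∀ x ∈ A.sub (Set.Iio m), f x = g x) (h2 : ∀ x ∈ A.sub (Set.Ici m), f x = g x) :
    f = g := hom_ext fun j a => by
  rcases lt_or_ge j m with hj | hj
  · exact h1 _ (ofSite_mem_sub (Set.mem_Iio.2 hj) a)
  · exact h2 _ (ofSite_mem_sub (Set.mem_Ici.2 hj) a)

/-- A homomorphism from a group to the endomorphisms of the chain algebra, as a homomorphism to the
automorphisms. -/
noncomputable def SpinChain.autHom {G : Type} [Group G] {A : SpinChain}
    (F : G → (A.Alg →⋆ₐ[ℂ] A.Alg)) (h1 : F 1 = StarAlgHom.id ℂ A.Alg)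
    (hmul : ∀ g h, (F g).comp (F h) = F (g * h)) : G →* (A.Alg ≃⋆ₐ[ℂ] A.Alg) where
  toFun g := autOf (F g) (F g⁻¹) (by rw [hmul, inv_mul_cancel, h1])
    (by rw [hmul, mul_inv_cancel, h1])
  map_one' := StarAlgEquiv.ext fun x => DFunLike.congr_fun h1 x
  map_mul' g h := StarAlgEquiv.ext fun x => (DFunLike.congr_fun (hmul g h) x).symm

theorem SpinChain.autHom_apply {G : Type} [Group G] {A : SpinChain}
    (F : G → (A.Alg →⋆ₐ[ℂ] A.Alg)) (h1 : F 1 = StarAlgHom.id ℂ A.Alg)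
    (hmul : ∀ g h, (F g).comp (F h) = F (g * h)) (g : G) (x : A.Alg) :
    autHom F h1 hmul g x = F g x := rfl

namespace Symmetry

variable {G : Type} [Group G] {A B : SpinChain} {α : Symmetry G A} {β : Symmetry G B}
  {r : G → (A.Alg ≃⋆ₐ[ℂ] A.Alg)} {X Φ : G → G → A.Alg}

/-- A symmetry that preserves the half chains on both sides of a cut restricts to the right half
chain as a covariant action. -/
theorem exists_cut (α : Symmetry G A) (m : ℤ)
    (hl : ∀ g, ∀ x ∈ A.sub (Set.Iio m), α g x ∈ A.sub (Set.Iio m))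
    (hr : ∀ g, ∀ x ∈ A.sub (Set.Ici m), α g x ∈ A.sub (Set.Ici m)) :
    ∃ r : G → (A.Alg ≃⋆ₐ[ℂ] A.Alg), α.IsRightRestriction m 0 r ∧ α.IsCovariant r ∧
      ∀ g h x, r g (r h x) = r (g * h) x := by
  have hF : ∀ g, ∃ k : A.Alg →⋆ₐ[ℂ] A.Alg, (∀ x ∈ A.sub (Set.Iio m), k x = x) ∧
      ∀ x ∈ A.sub (Set.Ici m), k x = α g x := fun g =>
    exists_glue (StarAlgHom.id ℂ A.Alg) (α g).toStarAlgHom m fun i hi j hj a b =>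
      sub_commute (Set.disjoint_left.2 fun i (hi : i < m) hj => (not_lt.2 hj) hi)
        (ofSite_mem_sub (Set.mem_Iio.2 hi) a) (hr g _ (ofSite_mem_sub (Set.mem_Ici.2 hj) b))
  choose F hFl hFr using hF
  have h1 : F 1 = StarAlgHom.id ℂ A.Alg := aut_ext_cut m (fun x hx => hFl 1 x hx)
    fun x hx => by
      rw [hFr 1 x hx, one_apply]
      rfl
  have hmul : ∀ g h, (F g).comp (F h) = F (g * h) := fun g h => by
    refine aut_ext_cut m (fun x hx => ?_) (fun x hx => ?_)
    · rw [StarAlgHom.comp_apply, hFl h x hx, hFl g x hx, hFl _ x hx]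
    · rw [StarAlgHom.comp_apply, hFr h x hx, hFr g _ (hr h x hx), hFr _ x hx, mul_apply]
  refine ⟨autHom F h1 hmul, ⟨fun g x hx => ?_, fun g x hx => ?_⟩, fun g k x => ?_,
    fun g h x => ?_⟩
  · exact hFr g x (by simpa using hx)
  · exact hFl g x (by simpa using hx)
  · have : ((α k).toStarAlgHom.comp (F (k⁻¹ * g * k))).comp (α k⁻¹).toStarAlgHom = F g := by
      refine aut_ext_cut m (fun x hx => ?_) (fun x hx => ?_)
      · change α k (F _ (α k⁻¹ x)) = _
        rw [hFl _ _ (hl _ _ hx), apply_inv_apply, hFl _ _ hx]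
      · change α k (F _ (α k⁻¹ x)) = _
        rw [hFr _ _ (hr _ _ hx), ← mul_apply, ← mul_apply, hFr _ _ hx]
        congr 2
        group
    exact DFunLike.congr_fun this x
  · rw [map_mul]
    rfl

theorem hasMuClass_one_of_cut (α : Symmetry G A) (m : ℤ)
    (hl : ∀ g, ∀ x ∈ A.sub (Set.Iio m), α g x ∈ A.sub (Set.Iio m))
    (hr : ∀ g, ∀ x ∈ A.sub (Set.Ici m), α g x ∈ A.sub (Set.Ici m)) : α.HasMuClass 1 := by
  obtain ⟨r, h1, h2, h3⟩ := α.exists_cut m hl hr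
  exact h1.hasMuClass_one h2 h3

theorem RangeLE.hasMuClass_one (h : α.RangeLE 0) : α.HasMuClass 1 :=
  α.hasMuClass_one_of_cut 0 (fun g x hx => by simpa using h.mem_Iio g hx)
    (fun g x hx => by simpa using h.mem_Ici g hx)

theorem triv_rangeLE : (triv G A).RangeLE 0 := fun _ X _ hx => sub_mono (subset_fatten X 0) hx

theorem regular_rangeLE [Fintype G] [DecidableEq G] : (regular G).RangeLE 0 := fun k X _ hx =>
  map_mem_of_mem_sub (f := regularHom k) (isClosed_sub _)
    (fun j hj a => by
      rw [regularHom_ofSite]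
      exact ofSite_mem_sub (subset_fatten X 0 hj) _) hx

end Symmetry

/-! ### Block products and decoupled symmetries -/

theorem SpinChain.IsBlockProduct.apply_mem {A : SpinChain} {I : ℤ → Set ℤ}
    {γ : A.Alg ≃⋆ₐ[ℂ] A.Alg} (h : IsBlockProduct I γ) {a : ℤ} {x : A.Alg} (hx : x ∈ A.sub (I a)) :
    γ x ∈ A.sub (I a) := by
  obtain ⟨U, hU⟩ := h
  rw [(hU a).2.2 x hx]
  exact mul_mem (mul_mem (hU a).2.1 hx) (star_mem (hU a).2.1)

theorem SpinChain.IsBlockProduct.symm {A : SpinChain} {I : ℤ → Set ℤ}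
    {γ : A.Alg ≃⋆ₐ[ℂ] A.Alg} (h : IsBlockProduct I γ) : IsBlockProduct I γ.symm := by
  obtain ⟨U, hU⟩ := h
  refine ⟨fun a => star (U a), fun a => ⟨Unitary.star_mem (hU a).1, star_mem (hU a).2.1,
    fun x hx => ?_⟩⟩
  rw [StarAlgEquiv.symm_apply_eq]
  change x = γ (star (U a) * x * star (star (U a)))
  rw [(hU a).2.2]
  · simp only [star_star, mul_assoc]
    rw [mul_star_cancel (hU a).1, Unitary.mul_star_self_of_mem (hU a).1, mul_one]
  · exact mul_mem (mul_mem (star_mem (hU a).2.1) hx) (star_mem (star_mem (hU a).2.1))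

theorem SpinChain.IsBlockPartition.exists_mem {I : ℤ → Set ℤ} (hI : IsBlockPartition I) (j : ℤ) :
    ∃ a, j ∈ I a := by
  have : j ∈ ⋃ a, I a := hI.cover ▸ Set.mem_univ j
  exact Set.mem_iUnion.1 this

theorem SpinChain.IsBlockPartition.eq_of_mem {I : ℤ → Set ℤ} (hI : IsBlockPartition I) {j a b : ℤ}
    (ha : j ∈ I a) (hb : j ∈ I b) : a = b := by
  by_contra h
  exact Set.disjoint_left.1 (hI.disjoint h) ha hb

/-- A block product preserves the algebra of every union of blocks. -/
theorem SpinChain.IsBlockProduct.apply_mem_sub {A : SpinChain} {I : ℤ → Set ℤ}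
    (hI : IsBlockPartition I) {γ : A.Alg ≃⋆ₐ[ℂ] A.Alg} (h : IsBlockProduct I γ) {X Y : Set ℤ}
    (hXY : ∀ a, ∀ j ∈ X, j ∈ I a → I a ⊆ Y) {x : A.Alg} (hx : x ∈ A.sub X) : γ x ∈ A.sub Y :=
  map_mem_of_mem_sub (f := γ.toStarAlgHom) (isClosed_sub _) (fun j hj b => by
    obtain ⟨a, ha⟩ := hI.exists_mem j
    exact sub_mono (hXY a j hj ha) (h.apply_mem (ofSite_mem_sub ha b))) hx

theorem SpinChain.IsBlockProduct.isQCA {A : SpinChain} {I : ℤ → Set ℤ}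
    (hI : IsBlockPartition I) {γ : A.Alg ≃⋆ₐ[ℂ] A.Alg} (h : IsBlockProduct I γ) : IsQCA γ := by
  obtain ⟨N, hN⟩ := hI.bounded
  have key : ∀ a, ∀ i ∈ I a, ∀ j ∈ I a, i ≤ j → j - i ≤ N := fun a i hi j hj hij => by
    have h1 : (Set.Icc i j).encard ≤ N :=
      (Set.encard_le_encard ((hI.interval a).out hi hj)).trans (hN a)
    rw [← Finset.coe_Icc, Set.encard_coe_eq_coe_finsetCard, Int.card_Icc] at h1
    have h2 : (j + 1 - i).toNat ≤ N := by exact_mod_cast h1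
    omega
  refine ⟨N, fun X x hx => h.apply_mem_sub hI (Y := fatten X N)
    (fun a j hj hja i hi => ⟨j, hj, ?_⟩) hx⟩
  rw [abs_le]
  rcases le_total i j with hij | hij
  · have := key a i hi j hja hij
    constructor <;> omega
  · have := key a j hja i hi hij
    constructor <;> omega

namespace Symmetry

variable {G : Type} [Group G] {A B : SpinChain} {α : Symmetry G A} {β : Symmetry G B}

/-- A decoupled symmetry can be cut at the left end of a block. -/
theorem IsDecoupled.hasMuClass_one (h : α.IsDecoupled) : α.HasMuClass 1 := by
  obtain ⟨I, hI, hU⟩ := h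
  obtain ⟨m, hm, hmin⟩ : ∃ m ∈ I 0, ∀ i ∈ I 0, m ≤ i := by
    obtain ⟨N, hN⟩ := hI.bounded
    have hfin : (I 0).Finite := Set.finite_of_encard_le_coe (hN 0)
    obtain ⟨m, hm, h⟩ := hfin.exists_minimalFor id _ (hI.nonempty 0)
    exact ⟨m, hm, fun i hi => (le_total m i).elim id fun h' => h hi h'⟩
  have hb : ∀ a, ∀ i ∈ I a, ∀ j ∈ I a, i < m → m ≤ j → False := fun a i hi j hj him hmj => by
    have ha := hI.eq_of_mem ((hI.interval a).out hi hj ⟨him.le, hmj⟩) hm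
    subst ha
    exact absurd (hmin i hi) (not_le.2 him)
  refine α.hasMuClass_one_of_cut m (fun g x hx => (hU g).apply_mem_sub hI ?_ hx)
    (fun g x hx => (hU g).apply_mem_sub hI ?_ hx)
  · exact fun a j hj hja i hi => Set.mem_Iio.2 (lt_of_not_ge fun h => hb a j hja i hi hj h)
  · exact fun a j hj hja i hi => Set.mem_Ici.2 (le_of_not_gt fun h => hb a i hi j hja h hj)

end Symmetry

/-! ### Stacking -/

section StackTools

variable {A B : SpinChain}

theorem SpinChain.ofSite_kron (j : ℤ) (a : A.OnSite j) (b : B.OnSite j) :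
    (A.stack B).ofSite j (a ⊗ₖ b) = A.inl B (A.ofSite j a) * A.inr B (B.ofSite j b) := by
  rw [inl_ofSite, inr_ofSite, ← map_mul, ← Matrix.mul_kronecker_mul, mul_one, one_mul]

theorem SpinChain.stack_eq_on_sub {C : Type*} [CStarAlgebra C] {f g : (A.stack B).Alg →⋆ₐ[ℂ] C}
    {X : Set ℤ} (h1 : ∀ x ∈ A.sub X, f (A.inl B x) = g (A.inl B x))
    (h2 : ∀ x ∈ B.sub X, f (A.inr B x) = g (A.inr B x)) {x : (A.stack B).Alg}
    (hx : x ∈ (A.stack B).sub X) : f x = g x := by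
  refine hom_eq_on_sub (fun j hj c => ?_) hx
  induction c using kron_induction (m := A.site j) (n := B.site j) with
  | h a b =>
    rw [ofSite_kron, map_mul, map_mul, h1 _ (ofSite_mem_sub hj a), h2 _ (ofSite_mem_sub hj b)]
  | hadd x y hx hy => rw [map_add, map_add, map_add, hx, hy]

theorem SpinChain.stackAut_eq_on_sub {f g : (A.stack B).Alg ≃⋆ₐ[ℂ] (A.stack B).Alg}
    {X : Set ℤ} (h1 : ∀ x ∈ A.sub X, f (A.inl B x) = g (A.inl B x))
    (h2 : ∀ x ∈ B.sub X, f (A.inr B x) = g (A.inr B x)) {x : (A.stack B).Alg}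
    (hx : x ∈ (A.stack B).sub X) : f x = g x :=
  stack_eq_on_sub (f := f.toStarAlgHom) (g := g.toStarAlgHom) h1 h2 hx

theorem SpinChain.inl_inr_mul (a c : A.Alg) (b d : B.Alg) :
    (A.inl B a * A.inr B b) * (A.inl B c * A.inr B d) = A.inl B (a * c) * A.inr B (b * d) := by
  rw [map_mul, map_mul, mul_assoc, ← mul_assoc (A.inr B b), ← (commute_inl_inr c b).eq]
  simp only [mul_assoc]

theorem SpinChain.inl_inr_star (a : A.Alg) (b : B.Alg) :
    star (A.inl B a * A.inr B b) = A.inl B (star a) * A.inr B (star b) := by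
  rw [star_mul, ← map_star, ← map_star, (commute_inl_inr _ _).eq]

theorem IsLocalUnitary.inl_inr {a : A.Alg} {b : B.Alg} (ha : IsLocalUnitary a)
    (hb : IsLocalUnitary b) : IsLocalUnitary (A.inl B a * A.inr B b) :=
  (ha.map (R := 0) (f := A.inl B) fun X _ hx => sub_mono (subset_fatten X 0) (inl_mem_sub hx)).mul
    (hb.map (R := 0) (f := A.inr B) fun X _ hx => sub_mono (subset_fatten X 0) (inr_mem_sub hx))

theorem SpinChain.stackAut_inl_inr (f : A.Alg ≃⋆ₐ[ℂ] A.Alg) (g : B.Alg ≃⋆ₐ[ℂ] B.Alg) (a : A.Alg)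
    (b : B.Alg) : stackAut f g (A.inl B a * A.inr B b) = A.inl B (f a) * A.inr B (g b) := by
  rw [map_mul, stackAut_inl, stackAut_inr]

/-- The automorphism `x ↦ u x u*`. -/
noncomputable def SpinChain.conjAut (u : A.Alg) (hu : u ∈ unitary A.Alg) : A.Alg ≃⋆ₐ[ℂ] A.Alg :=
  Unitary.conjStarAlgAut ℂ A.Alg ⟨u, hu⟩

theorem SpinChain.conjAut_apply (u : A.Alg) (hu : u ∈ unitary A.Alg) (x : A.Alg) :
    conjAut u hu x = u * x * star u :=
  Unitary.conjStarAlgAut_apply _ _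

theorem SpinChain.conjAut_of_commute {u : A.Alg} (hu : u ∈ unitary A.Alg) {x : A.Alg}
    (h : Commute u x) : conjAut u hu x = x := by
  rw [conjAut_apply, h.eq, mul_assoc, Unitary.mul_star_self_of_mem hu, mul_one]

theorem SpinChain.disjoint_Ico_Ici (m n : ℤ) : Disjoint (Set.Ico m n) (Set.Ici n) :=
  Set.disjoint_left.2 fun _ hi hi' => absurd hi.2 (not_lt.2 hi')

theorem SpinChain.disjoint_Ico_Iio (m n : ℤ) : Disjoint (Set.Ico m n) (Set.Iio m) :=
  Set.disjoint_left.2 fun _ hi hi' => absurd hi.1 (not_le.2 hi')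

theorem SpinChain.conj_inl {u : A.Alg} {v : B.Alg} (hv : v ∈ unitary B.Alg) (x : A.Alg) :
    (A.inl B u * A.inr B v) * A.inl B x * star (A.inl B u * A.inr B v) =
      A.inl B (u * x * star u) := by
  have h : A.inl B x = A.inl B x * A.inr B 1 := by rw [map_one, mul_one]
  rw [h, inl_inr_star, inl_inr_mul, inl_inr_mul, mul_one, Unitary.mul_star_self_of_mem hv, map_one,
    mul_one]

theorem SpinChain.conj_inr {u : A.Alg} {v : B.Alg} (hu : u ∈ unitary A.Alg) (x : B.Alg) :
    (A.inl B u * A.inr B v) * A.inr B x * star (A.inl B u * A.inr B v) =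
      A.inr B (v * x * star v) := by
  have h : A.inr B x = A.inl B 1 * A.inr B x := by rw [map_one, one_mul]
  rw [h, inl_inr_star, inl_inr_mul, inl_inr_mul, mul_one, Unitary.mul_star_self_of_mem hu, map_one,
    one_mul]

/-- If `f(x) = u g(x) u*` on both factors of a stack, with unitaries `u` in either factor, the same
holds on the stack with the product of the unitaries. -/
theorem SpinChain.stack_conj_ext {f g : (A.stack B).Alg ≃⋆ₐ[ℂ] (A.stack B).Alg}
    {f₁ g₁ : A.Alg → A.Alg} {f₂ g₂ : B.Alg → B.Alg} {u : A.Alg} {v : B.Alg}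
    (hu : u ∈ unitary A.Alg) (hv : v ∈ unitary B.Alg)
    (hf₁ : ∀ x, f (A.inl B x) = A.inl B (f₁ x)) (hf₂ : ∀ x, f (A.inr B x) = A.inr B (f₂ x))
    (hg₁ : ∀ x, g (A.inl B x) = A.inl B (g₁ x)) (hg₂ : ∀ x, g (A.inr B x) = A.inr B (g₂ x))
    (h1 : ∀ x, f₁ x = u * g₁ x * star u) (h2 : ∀ x, f₂ x = v * g₂ x * star v)
    (x : (A.stack B).Alg) :
    f x = (A.inl B u * A.inr B v) * g x * star (A.inl B u * A.inr B v) := by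
  let k := conjAut (A.inl B u * A.inr B v)
    (mul_mem (Unitary.map_mem (A.inl B) hu) (Unitary.map_mem (A.inr B) hv))
  have hk : ∀ y, k y = (A.inl B u * A.inr B v) * y * star (A.inl B u * A.inr B v) :=
    conjAut_apply _ _
  have : f = g.trans k :=
    aut_ext_stack
      (fun x => (hf₁ x).trans (((congrArg (A.inl B) (h1 x)).trans (conj_inl hv _).symm).trans
        (((hk _).symm).trans (congrArg k (hg₁ x).symm))))
      (fun x => (hf₂ x).trans (((congrArg (A.inr B) (h2 x)).trans (conj_inr hu _).symm).trans
        (((hk _).symm).trans (congrArg k (hg₂ x).symm))))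
  exact (DFunLike.congr_fun this x).trans (hk _)

end StackTools

namespace Symmetry

variable {G : Type} [Group G] {A B : SpinChain} {α : Symmetry G A} {β : Symmetry G B}
  {r : G → (A.Alg ≃⋆ₐ[ℂ] A.Alg)} {s : G → (B.Alg ≃⋆ₐ[ℂ] B.Alg)} {X Φ : G → G → A.Alg}
  {Y Ψ : G → G → B.Alg}

theorem stack_inl (α : Symmetry G A) (β : Symmetry G B) (g : G) (x : A.Alg) :
    α.stack β g (A.inl B x) = A.inl B (α g x) := stackAut_inl _ _ x

theorem stack_inr (α : Symmetry G A) (β : Symmetry G B) (g : G) (x : B.Alg) :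
    α.stack β g (A.inr B x) = A.inr B (β g x) := stackAut_inr _ _ x

theorem IsRightRestriction.stack {j : ℤ} {L : ℕ} (hr : α.IsRightRestriction j L r)
    (hs : β.IsRightRestriction j L s) :
    (α.stack β).IsRightRestriction j L fun g => stackAut (r g) (s g) where
  right g x hx := stackAut_eq_on_sub
    (fun x hx => by rw [stackAut_inl, stack_inl, hr.right g x hx])
    (fun x hx => by rw [stackAut_inr, stack_inr, hs.right g x hx]) hx
  left g x hx := stack_eq_on_sub (f := (stackAut (r g) (s g)).toStarAlgHom)
    (g := StarAlgHom.id ℂ (A.stack B).Alg)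
    (fun x hx => (stackAut_inl (r g) (s g) x).trans (by rw [hr.left g x hx]; rfl))
    (fun x hx => (stackAut_inr (r g) (s g) x).trans (by rw [hs.left g x hx]; rfl)) hx

theorem IsCrossing.stack (hX : α.IsCrossing r X) (hY : β.IsCrossing s Y) :
    (α.stack β).IsCrossing (fun g => stackAut (r g) (s g))
      fun g k => A.inl B (X g k) * A.inr B (Y g k) :=
  .of_apply (fun g k => (hX g k).1.inl_inr (hY g k).1) fun g k x =>
    stack_conj_ext (f := (stackAut (r (k⁻¹ * g * k)) (s (k⁻¹ * g * k))).trans (α.stack β k))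
      (g := (StarAlgEquiv.trans (α.stack β k) (stackAut (r g) (s g)))) (hX.unitary g k)
      (hY.unitary g k)
      (fun x => (congrArg (α.stack β k) (stackAut_inl _ _ x)).trans (stack_inl α β k _))
      (fun x => (congrArg (α.stack β k) (stackAut_inr _ _ x)).trans (stack_inr α β k _))
      (fun x => (congrArg (stackAut (r g) (s g)) (stack_inl α β k x)).trans (stackAut_inl _ _ _))
      (fun x => (congrArg (stackAut (r g) (s g)) (stack_inr α β k x)).trans (stackAut_inr _ _ _))
      (hX.apply g k) (hY.apply g k) x

theorem stack_inl_inr (α : Symmetry G A) (β : Symmetry G B) (g : G) (a : A.Alg) (b : B.Alg) :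
    α.stack β g (A.inl B a * A.inr B b) = A.inl B (α g a) * A.inr B (β g b) :=
  stackAut_inl_inr _ _ a b

theorem IsFlatCrossing.stack (hX : α.IsFlatCrossing r X) (hY : β.IsFlatCrossing s Y) :
    (α.stack β).IsFlatCrossing (fun g => stackAut (r g) (s g))
      fun g k => A.inl B (X g k) * A.inr B (Y g k) where
  isCrossing := hX.isCrossing.stack hY.isCrossing
  flat g k m := by rw [stack_inl_inr, inl_inr_mul, hX.flat, hY.flat]

theorem IsFusion.stack (hΦ : IsFusion r Φ) (hΨ : IsFusion s Ψ) :
    IsFusion (fun g => stackAut (r g) (s g)) fun g k => A.inl B (Φ g k) * A.inr B (Ψ g k) :=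
  fun g h => ⟨(hΦ g h).1.inl_inr (hΨ g h).1, fun x =>
    stack_conj_ext (f := (stackAut (r h) (s h)).trans (stackAut (r g) (s g)))
      (g := stackAut (r (g * h)) (s (g * h))) (hΦ.unitary g h) (hΨ.unitary g h)
      (fun x => (congrArg (stackAut (r g) (s g)) (stackAut_inl _ _ x)).trans (stackAut_inl _ _ _))
      (fun x => (congrArg (stackAut (r g) (s g)) (stackAut_inr _ _ x)).trans (stackAut_inr _ _ _))
      (fun x => stackAut_inl _ _ x) (fun x => stackAut_inr _ _ x) (hΦ g h).2 (hΨ g h).2 x⟩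

theorem IsTwistedPhase.stack {μ ν : G → U1GG G} (hμ : α.IsTwistedPhase r X Φ μ)
    (hν : β.IsTwistedPhase s Y Ψ ν) :
    (α.stack β).IsTwistedPhase (fun g => stackAut (r g) (s g))
      (fun g k => A.inl B (X g k) * A.inr B (Y g k)) (fun g k => A.inl B (Φ g k) * A.inr B (Ψ g k))
      fun k => μ k * ν k := fun g h k => by
  rw [stack_inl_inr, inl_inr_mul, hμ, hν, stackAut_inl_inr, inl_inr_mul, inl_inr_mul, map_smul,
    map_smul, smul_mul_smul_comm]
  exact congrArg (· • _) (Circle.coe_mul (μ k g h) (ν k g h)).symm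

/-- The class `[μ]` is multiplicative under stacking. -/
theorem HasTwistedClass.stack {c d : KGroup G} (h : α.HasTwistedClass c)
    (h' : β.HasTwistedClass d) : (α.stack β).HasTwistedClass (c * d) := by
  obtain ⟨j, L, r, X, Φ, μ, hμc, hr, hX, hΦ, hμ, rfl⟩ := h
  obtain ⟨j', L', s, Y, Ψ, ν, hνc, hs, hY, hΨ, hν, rfl⟩ := h'
  have hr := hr.mono (j' := j) (L' := L + (L' + (j - j').natAbs)) (by omega) (by omega)
  have hs := hs.mono (j' := j) (L' := L + (L' + (j - j').natAbs)) (by omega) (by omega)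
  have hc := (hμ.stack hν).isMulCocycle (hX.stack hY) (hΦ.stack hΨ)
  exact ⟨_, _, _, _, _, _, hc, hr.stack hs, hX.stack hY, hΦ.stack hΨ, hμ.stack hν,
    muClass_mul hμc hνc hc⟩

/-! ### Covariant right restrictions of stacks with the regular symmetry -/

/-- Crossing operators are located near the site of the restriction. -/
theorem IsRightRestriction.crossing_mem {j : ℤ} {L R : ℕ} (hα : α.RangeLE R)
    (hr : α.IsRightRestriction j L r) (hX : α.IsCrossing r X) (g k : G) :
    X g k ∈ A.sub (Set.Ico (j - L - R) (j + L + R)) := by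
  refine mem_sub_of_conj (hX.unitary g k) ?_
  let ψ : A.Alg ≃⋆ₐ[ℂ] A.Alg := Unitary.conjStarAlgAut ℂ A.Alg ⟨X g k, hX.unitary g k⟩
  have hψ : ∀ x, ψ x = X g k * x * star (X g k) := fun x => Unitary.conjStarAlgAut_apply _ _
  have hψ' : ∀ x, ψ x = α k (r (k⁻¹ * g * k) (α k⁻¹ ((r g).symm x))) := fun x => by
    rw [hψ, (hX g k).2]
  have key := sub_compl_Ico (m := j - L - R) (n := j + L + R) (ψ := ψ) (fun x hx => ?_)
    (fun x hx => ?_)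
  · exact fun x hx => (hψ x).symm.trans (key x hx)
  · have h1 : α k⁻¹ x ∈ A.sub (Set.Iio (j - L)) := by
      have := hα.mem_Iio k⁻¹ hx
      rwa [sub_add_cancel] at this
    rw [hψ', hr.symm_left g (sub_mono (Set.Iio_subset_Iio (by omega)) hx), hr.left _ _ h1,
      apply_inv_apply]
  · have h1 : ∀ l, α l x ∈ A.sub (Set.Ici (j + L)) := fun l => by
      have := hα.mem_Ici l hx
      rwa [add_sub_cancel_right] at this
    rw [hψ', hr.symm_right hα g hx, ← mul_apply α k⁻¹, hr.right _ _ (h1 _), ← mul_apply,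
      ← mul_apply]
    have : k * (k⁻¹ * g * k) * (k⁻¹ * g⁻¹) = 1 := by group
    rw [this, one_apply]

/-- Changing a right restriction by unitaries near its site gives a right restriction with a larger
defect. -/
theorem IsRightRestriction.conj {j m n : ℤ} {L L' R : ℕ} (hα : α.RangeLE R)
    (hr : α.IsRightRestriction j L r) {V : G → A.Alg} (hV : ∀ g, V g ∈ unitary A.Alg)
    (hVm : ∀ g, V g ∈ A.sub (Set.Ico m n)) (hL : L ≤ L') (hm : j - L' ≤ m) (hn : n + R ≤ j + L') :
    α.IsRightRestriction j L' fun g => (r g).trans (conjAut (V g) (hV g)) := by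
  refine ⟨fun g x hx => ?_, fun g x hx => ?_⟩
  · have h1 : α g x ∈ A.sub (Set.Ici n) :=
      sub_mono (Set.Ici_subset_Ici.2 (by omega)) (hα.mem_Ici g hx)
    have h2 : r g x = α g x := hr.right g x (sub_mono (Set.Ici_subset_Ici.2 (by omega)) hx)
    exact (congrArg (conjAut (V g) (hV g)) h2).trans (conjAut_of_commute _
      (sub_commute (disjoint_Ico_Ici m n) (hVm g) h1))
  · have h2 : r g x = x := hr.left g x (sub_mono (Set.Iio_subset_Iio (by omega)) hx)
    exact (congrArg (conjAut (V g) (hV g)) h2).trans (conjAut_of_commute _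
      (sub_commute (disjoint_Ico_Iio m n)
        (hVm g) (sub_mono (Set.Iio_subset_Iio hm) hx)))

/-- Changing a right restriction by unitaries `V_g` replaces the crossing operators `X_g(k)` by
`α^(k)(V_{k⁻¹gk}) X_g(k) V_g*`. -/
theorem IsCrossing.conj (hX : α.IsCrossing r X) {V : G → A.Alg} (hV : ∀ g, IsLocalUnitary (V g)) :
    α.IsCrossing (fun g => (r g).trans (conjAut (V g) (hV g).1))
      fun g k => α k (V (k⁻¹ * g * k)) * X g k * star (V g) :=
  .of_apply (fun g k => (((hV _).map_qca (α.isQCA k)).mul (hX g k).1).mul (hV g).star)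
    fun g k x => by
      change α k (conjAut _ _ (r (k⁻¹ * g * k) x)) = _ * conjAut _ _ (r g (α k x)) * _
      rw [conjAut_apply, conjAut_apply, map_mul, map_mul, map_star, hX.apply]
      simp only [star_mul, star_star, mul_assoc, star_mul_cancel (hV g).1]

theorem IsCrossing.isCovariant (hX : α.IsCrossing r X) (h : ∀ g k, X g k = 1) :
    α.IsCovariant r := fun g k x => by
  rw [hX.apply, h, apply_inv_apply, one_mul, star_one, mul_one]

theorem IsFlatCrossing.conj (hX : α.IsFlatCrossing r X) {V : G → A.Alg}
    (hV : ∀ g, IsLocalUnitary (V g)) :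
    α.IsFlatCrossing (fun g => (r g).trans (conjAut (V g) (hV g).1))
      fun g k => α k (V (k⁻¹ * g * k)) * X g k * star (V g) where
  isCrossing := hX.isCrossing.conj hV
  flat g k m := by
    rw [map_mul, map_mul, map_star, ← mul_apply, ← hX.flat]
    have : (k * m)⁻¹ * g * (k * m) = m⁻¹ * (k⁻¹ * g * k) * m := by group
    rw [this]
    simp only [mul_assoc (G := A.Alg)]
    rw [star_mul_cancel (Unitary.map_mem (α k) (hV _).1)]

section Covariant

variable [Fintype G] [DecidableEq G]

/-- The projection `|h⟩⟨h|` at the site `j` of the regular chain. -/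
noncomputable def siteProj (j : ℤ) (h : G) : (regularChain G).Alg :=
  (regularChain G).ofSite j (Matrix.single h h 1)

theorem regular_siteProj (k : G) (j : ℤ) (h : G) :
    regular G k (siteProj j h) = siteProj j (k * h) := by
  change regularHom k ((regularChain G).ofSite j (Matrix.single h h 1)) = _
  rw [regularHom_ofSite, siteProj]
  congr 1
  ext a b
  rw [conjRegular_apply]
  simp only [Matrix.single_apply, eq_inv_mul_iff_mul_eq]

theorem siteProj_mul_self (j : ℤ) (h : G) : siteProj j h * siteProj j h = siteProj j h := by
  rw [siteProj, ← map_mul, Matrix.single_mul_single_same, one_mul]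

theorem siteProj_mul_of_ne (j : ℤ) {h h' : G} (hh : h ≠ h') : siteProj j h * siteProj j h' = 0 := by
  rw [siteProj, siteProj, ← map_mul, Matrix.single_mul_single_of_ne _ _ _ _ hh, map_zero]

theorem star_siteProj (j : ℤ) (h : G) : star (siteProj j h) = siteProj j h := by
  rw [siteProj, ← map_star]
  simp [Matrix.star_eq_conjTranspose]

theorem sum_siteProj (j : ℤ) : ∑ h : G, siteProj j h = 1 := by
  simp only [siteProj, ← map_sum, sum_single_diag, map_one]

theorem siteProj_mem (j : ℤ) (h : G) : siteProj j h ∈ (regularChain G).sub {j} :=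
  ofSite_mem_sub (Set.mem_singleton j) _

/-- The unitary `∑ₕ u(h) ⊗ |h⟩⟨h|` controlled by the site `j` of the regular chain. -/
noncomputable def controlled (j : ℤ) (u : G → A.Alg) : (A.stack (regularChain G)).Alg :=
  ∑ h, A.inl _ (u h) * A.inr _ (siteProj j h)

theorem controlled_mul (j : ℤ) (u v : G → A.Alg) :
    controlled j u * controlled j v = controlled j fun h => u h * v h := by
  rw [controlled, controlled, Finset.sum_mul]
  refine Finset.sum_congr rfl fun h _ => ?_
  rw [Finset.mul_sum, Finset.sum_eq_single h]
  · rw [inl_inr_mul, siteProj_mul_self]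
  · intro b _ hb
    rw [inl_inr_mul, siteProj_mul_of_ne j hb.symm, map_zero, mul_zero]
  · simp

theorem controlled_const (j : ℤ) (x : A.Alg) :
    (controlled j fun _ : G => x) = A.inl (regularChain G) x := by
  rw [controlled, ← Finset.mul_sum, ← map_sum, sum_siteProj, map_one, mul_one]

theorem star_controlled (j : ℤ) (u : G → A.Alg) :
    star (controlled j u) = controlled j fun h => star (u h) := by
  simp only [controlled, star_sum, inl_inr_star, star_siteProj]

theorem controlled_mem_unitary (j : ℤ) {u : G → A.Alg} (hu : ∀ h, u h ∈ unitary A.Alg) :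
    controlled j u ∈ unitary (A.stack (regularChain G)).Alg := by
  constructor
  · rw [star_controlled, controlled_mul]
    simp only [Unitary.star_mul_self_of_mem (hu _), controlled_const, map_one]
  · rw [star_controlled, controlled_mul]
    simp only [Unitary.mul_star_self_of_mem (hu _), controlled_const, map_one]

theorem stack_regular_controlled (k : G) (j : ℤ) (u : G → A.Alg) :
    α.stack (regular G) k (controlled j u) = controlled j fun h => α k (u (k⁻¹ * h)) := by
  rw [controlled, map_sum, controlled]
  refine Eq.trans ?_ (Equiv.sum_comp (Equiv.mulLeft k) fun h =>
    A.inl (regularChain G) (α k (u (k⁻¹ * h))) * A.inr _ (siteProj j h))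
  refine Finset.sum_congr rfl fun h _ => ?_
  rw [stack_inl_inr, regular_siteProj]
  simp

theorem controlled_mem {j : ℤ} {S : Set ℤ} (hj : j ∈ S) {u : G → A.Alg}
    (hu : ∀ h, u h ∈ A.sub S) : controlled j u ∈ (A.stack (regularChain G)).sub S :=
  sum_mem fun h _ => mul_mem (inl_mem_sub (hu h))
    (inr_mem_sub (sub_mono (Set.singleton_subset_iff.2 hj) (siteProj_mem j h)))

/-- A right restriction with flat crossing operators `X` becomes covariant after stacking with the
regular symmetry: if `ρ_≥` is the restriction of the latter, the family
`Ad(W_g) ∘ (r^(g) ⊗ ρ_≥^(g))` with `W_g = ∑ₕ X_g(h) ⊗ |h⟩⟨h|` is covariant. -/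
theorem IsFlatCrossing.exists_covariant {j : ℤ} {L R : ℕ} (hα : α.RangeLE R)
    (hr : α.IsRightRestriction j L r) (hX : α.IsFlatCrossing r X) :
    ∃ s, (α.stack (regular G)).IsRightRestriction j (L + 2 * R + 1) s ∧
      (α.stack (regular G)).IsCovariant s := by
  obtain ⟨ρ, hρ, hρc, -⟩ := (regular G).exists_cut j
    (fun g x hx => by simpa using regular_rangeLE.mem_Iio g hx)
    (fun g x hx => by simpa using regular_rangeLE.mem_Ici g hx)
  have hu : ∀ g h, X g h ∈ unitary A.Alg := hX.isCrossing.unitary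
  have hWm : ∀ g, controlled j (X g) ∈ (A.stack (regularChain G)).sub
      (Set.Ico (j - L - R - 1) (j + L + R + 1)) := fun g =>
    controlled_mem (by constructor <;> omega) fun h =>
      sub_mono (Set.Ico_subset_Ico (by omega) (by omega))
        (hr.crossing_mem hα hX.isCrossing g h)
  have hW : ∀ g, IsLocalUnitary (controlled j (X g)) := fun g =>
    .of_finite (controlled_mem_unitary j (hu g)) (Set.finite_Ico _ _) (hWm g)
  have hWk : ∀ g k, α.stack (regular G) k (controlled j (X (k⁻¹ * g * k))) *
      (A.inl (regularChain G) (X g k) * A.inr _ 1) = controlled j (X g) :=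
    fun g k => by
      rw [map_one, mul_one, stack_regular_controlled, ← controlled_const j, controlled_mul]
      congr 1
      funext h
      rw [hX.flat, mul_inv_cancel_left]
  have hT : (α.stack (regular G)).RangeLE R := fun g =>
    (hα g).stackAut ((regular_rangeLE g).mono (Nat.zero_le R))
  have hq := hr.stack (hρ.mono (j' := j) (L' := L) (by push_cast; omega) (by push_cast; omega))
  have hX' := (hX.isCrossing.stack hρc.isFlatCrossing.isCrossing).conj hW
  refine ⟨_, hq.conj hT (fun g => (hW g).1) hWm (by omega) (by push_cast; omega)
    (by push_cast; omega), hX'.isCovariant fun g k => ?_⟩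
  rw [hWk, Unitary.mul_star_self_of_mem (hW g).1]

end Covariant

/-! ### Transport along isomorphisms of bounded range -/

/-- The class `[μ]` is unchanged by transport along an isomorphism of the chain algebras of bounded
range, in particular by conjugation with a finite depth quantum circuit. -/
theorem HasTwistedClass.transport {c : KGroup G} (h : α.HasTwistedClass c) {R : ℕ}
    (f : A.Alg ≃⋆ₐ[ℂ] B.Alg) (hf : ∀ X : Set ℤ, ∀ x ∈ A.sub X, f x ∈ B.sub (fatten X R))
    (hf' : ∀ X : Set ℤ, ∀ x ∈ B.sub X, f.symm x ∈ A.sub (fatten X R))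
    (hβ : ∀ g x, β g x = f (α g (f.symm x))) : β.HasTwistedClass c := by
  obtain ⟨j, L, r, X, Φ, μ, hμc, hr, hX, hΦ, hμ, rfl⟩ := h
  have hfl : ∀ {u : A.Alg}, IsLocalUnitary u → IsLocalUnitary (f u) := fun hu =>
    hu.map (f := f.toStarAlgHom) hf
  have hβf : ∀ g x, β g (f x) = f (α g x) := fun g x => by
    rw [hβ, StarAlgEquiv.symm_apply_apply]
  let s : G → (B.Alg ≃⋆ₐ[ℂ] B.Alg) := fun g => (f.symm.trans (r g)).trans f
  have hs : ∀ g x, s g (f x) = f (r g x) := fun g x =>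
    congrArg (fun y => f (r g y)) (f.symm_apply_apply x)
  refine ⟨j, L + R, s, fun g k => f (X g k), fun g k => f (Φ g k), μ, hμc, ⟨fun g x hx => ?_,
    fun g x hx => ?_⟩, ⟨.of_apply (fun g k => hfl (hX.isCrossing g k).1) fun g k x => ?_,
    fun g k m => ?_⟩, fun g h => ⟨hfl (hΦ g h).1, fun x => ?_⟩, fun g h k => ?_, rfl⟩
  · have h1 : f.symm x ∈ A.sub (Set.Ici (j + L)) := by
      refine sub_mono ((fatten_Ici _ R).trans (Set.Ici_subset_Ici.2 ?_)) (hf' _ x hx)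
      push_cast
      omega
    obtain ⟨x, rfl⟩ : ∃ y, f y = x := f.surjective x
    rw [StarAlgEquiv.symm_apply_apply] at h1
    rw [hs, hr.right g x h1, hβf]
  · have h1 : f.symm x ∈ A.sub (Set.Iio (j - L)) := by
      refine sub_mono ((fatten_Iio _ R).trans (Set.Iio_subset_Iio ?_)) (hf' _ x hx)
      push_cast
      omega
    obtain ⟨x, rfl⟩ : ∃ y, f y = x := f.surjective x
    rw [StarAlgEquiv.symm_apply_apply] at h1
    rw [hs, hr.left g x h1]
  · obtain ⟨x, rfl⟩ : ∃ y, f y = x := f.surjective x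
    rw [hs, hβf, hX.isCrossing.apply, hβf, hs, map_mul, map_mul, map_star]
  · rw [hβf, ← map_mul, hX.flat]
  · obtain ⟨x, rfl⟩ : ∃ y, f y = x := f.surjective x
    rw [hs, hs, hs, (hΦ g h).2, map_mul, map_mul, map_star]
  · rw [hβf, ← map_mul, hμ, map_smul, map_mul, map_mul, hs]

end Symmetry

/-! ### Right restrictions at other sites -/

section Translate

theorem SpinChain.apply_mem_sub {A : SpinChain} {f : A.Alg ≃⋆ₐ[ℂ] A.Alg} {X : Set ℤ} {x : A.Alg}
    (h : ∀ i ∉ X, ∀ a, Commute (f.symm (A.ofSite i a)) x) : f x ∈ A.sub X :=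
  mem_sub_of_commute fun i hi a => by
    have := (h i hi a).map f
    rwa [StarAlgEquiv.apply_symm_apply] at this

theorem SpinChain.not_mem_Ico {m n i : ℤ} (h : i ∉ Set.Ico m n) : i < m ∨ n ≤ i := by
  by_contra! h'
  exact h h'

theorem SpinChain.disjoint_Iio_Ici (m : ℤ) : Disjoint (Set.Iio m) (Set.Ici m) :=
  Set.disjoint_left.2 fun _ hi hi' => absurd (Set.mem_Iio.1 hi) (not_lt.2 hi')

end Translate

namespace Symmetry

variable {G : Type} [Group G] {A : SpinChain} {α : Symmetry G A}
  {r : G → (A.Alg ≃⋆ₐ[ℂ] A.Alg)} {j : ℤ} {L R : ℕ}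

/-- The automorphism `r^(g)` is trivial on the left, so it preserves right half chains that contain
the defect. -/
theorem IsRightRestriction.mem_Ici (hr : α.IsRightRestriction j L r) (g : G) {m : ℤ}
    (hm : m ≤ j - L) {x : A.Alg} (hx : x ∈ A.sub (Set.Ici m)) : r g x ∈ A.sub (Set.Ici m) := by
  refine apply_mem_sub fun i hi a => ?_
  have hi : i < m := not_le.1 hi
  rw [hr.symm_left g (ofSite_mem_sub (Set.mem_Iio.2 (hi.trans_le hm)) a)]
  exact sub_commute (disjoint_Iio_Ici m) (ofSite_mem_sub (Set.mem_Iio.2 hi) a) hx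

theorem IsRightRestriction.mem_Iio (hα : α.RangeLE R) (hr : α.IsRightRestriction j L r) (g : G)
    {m : ℤ} (hm : j + L ≤ m) {x : A.Alg} (hx : x ∈ A.sub (Set.Iio m)) :
    r g x ∈ A.sub (Set.Iio (m + R)) := by
  refine apply_mem_sub fun i hi a => ?_
  have hi : m + R ≤ i := not_lt.1 hi
  have h1 := ofSite_mem_sub (A := A) (Set.mem_Ici.2 hi) a
  rw [hr.symm_right hα g (sub_mono (Set.Ici_subset_Ici.2 (by omega)) h1)]
  have h2 := hα.mem_Ici g⁻¹ h1
  rw [add_sub_cancel_right] at h2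
  exact (sub_commute (disjoint_Iio_Ici m) hx h2).symm

theorem IsRightRestriction.symm_mem_Ico (hα : α.RangeLE R) (hr : α.IsRightRestriction j L r) (g : G)
    {m : ℤ} (hm : j + L ≤ m) {x : A.Alg} (hx : x ∈ A.sub (Set.Ico (j - L) m)) :
    (r g).symm x ∈ A.sub (Set.Ico (j - L) (m + R)) := by
  refine apply_mem_sub fun i hi a => ?_
  change Commute (r g (A.ofSite i a)) x
  rcases not_mem_Ico hi with hi | hi
  · have h1 := ofSite_mem_sub (A := A) (Set.mem_Iio.2 hi) a
    rw [hr.left g _ h1]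
    exact (sub_commute (disjoint_Ico_Iio (j - L) m) hx h1).symm
  · have h1 := ofSite_mem_sub (A := A) (Set.mem_Ici.2 hi) a
    rw [hr.right g _ (sub_mono (Set.Ici_subset_Ici.2 (by omega)) h1)]
    have h2 := hα.mem_Ici g h1
    rw [add_sub_cancel_right] at h2
    exact (sub_commute (disjoint_Ico_Ici (j - L) m) hx h2).symm

/-- A right restriction can be moved to the right: undo it on the sites `< m` by a unitary, which
exists as the inverse of `r^(g)` maps a finite matrix algebra into another one. -/
theorem IsRightRestriction.exists_right (hα : α.RangeLE R) (hr : α.IsRightRestriction j L r)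
    (n : ℤ) : ∃ m ≥ n, ∃ s, α.IsRightRestriction (m + R) R s := by
  obtain ⟨m, hmn, hm⟩ : ∃ m, n ≤ m ∧ j + L ≤ m := ⟨max n (j + L), le_max_left _ _, le_max_right _ _⟩
  have hv : ∀ g, ∃ v ∈ unitary A.Alg, v ∈ A.sub (Set.Ico (j - L) (m + R)) ∧
      ∀ x ∈ A.sub (Set.Ico (j - L) m), v * (r g).symm x * star v = x := fun g =>
    exists_unitary_conj (Set.finite_Ico _ _) (Set.finite_Ico _ _) (r g).symm.toStarAlgHom
      (StarAlgHom.id ℂ A.Alg) (fun x hx => hr.symm_mem_Ico hα g hm hx)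
      (fun x hx => sub_mono (Set.Ico_subset_Ico_right (by omega)) hx)
  choose v hvu hvm hv using hv
  have hvs : ∀ g, star (v g) ∈ unitary A.Alg := fun g => Unitary.star_mem (hvu g)
  refine ⟨m, hmn, fun g => (conjAut (star (v g)) (hvs g)).trans (r g), fun g x hx => ?_,
    fun g x hx => ?_⟩
  · change r g (conjAut _ _ x) = _
    have h1 : x ∈ A.sub (Set.Ici (m + R)) := sub_mono (Set.Ici_subset_Ici.2 (by omega)) hx
    rw [conjAut_of_commute (hvs g) (sub_commute (disjoint_Ico_Ici _ _) (star_mem (hvm g)) h1)]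
    exact hr.right g x (sub_mono (Set.Ici_subset_Ici.2 (by omega)) h1)
  · rw [add_sub_cancel_right] at hx
    refine aut_eq_on_sub (g := StarAlgEquiv.refl ℂ A.Alg) (fun i hi a => ?_) hx
    change r g (conjAut _ _ (A.ofSite i a)) = A.ofSite i a
    rcases lt_or_ge i (j - L) with hi' | hi'
    · have h1 := ofSite_mem_sub (A := A) (Set.mem_Iio.2 hi') a
      rw [conjAut_of_commute (hvs g) (sub_commute (disjoint_Ico_Iio _ _) (star_mem (hvm g)) h1)]
      exact hr.left g _ h1
    · have h1 := hv g _ (ofSite_mem_sub (A := A) (Set.mem_Ico.2 ⟨hi', Set.mem_Iio.1 hi⟩) a)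
      have h2 : conjAut (star (v g)) (hvs g) (A.ofSite i a) = (r g).symm (A.ofSite i a) := by
        rw [conjAut_apply]
        conv_lhs => rw [← h1]
        simp only [mul_assoc, star_star, star_mul_cancel (hvu g),
          Unitary.star_mul_self_of_mem (hvu g), mul_one]
      rw [h2, StarAlgEquiv.apply_symm_apply]

/-- A right restriction can be moved to the left: `(α^(g))⁻¹ ∘ r^(g)` is trivial on the right and is
undone on the sites `≥ m` by a unitary. -/
theorem IsRightRestriction.exists_left (hα : α.RangeLE R) (hr : α.IsRightRestriction j L r)
    (n : ℤ) : ∃ m ≤ n, ∃ s, α.IsRightRestriction (m - R) R s := by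
  obtain ⟨m, hmn, hm⟩ : ∃ m, m ≤ n ∧ m ≤ j - L := ⟨min n (j - L), min_le_left _ _, min_le_right _ _⟩
  have hq : ∀ g, ∀ x ∈ A.sub (Set.Ico m (j + L)),
      α g⁻¹ (r g x) ∈ A.sub (Set.Ico (m - R) (j + L)) := fun g x hx => by
    refine apply_mem_sub (f := (r g).trans (α g⁻¹)) fun i hi a => ?_
    have h0 : ((r g).trans (α g⁻¹)).symm (A.ofSite i a) = (r g).symm (α g (A.ofSite i a)) := by
      rw [StarAlgEquiv.symm_apply_eq]
      change _ = α g⁻¹ (r g _)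
      rw [StarAlgEquiv.apply_symm_apply, inv_apply_apply]
    rw [h0]
    rcases not_mem_Ico hi with hi | hi
    · have h1 := hα.mem_Iio g (ofSite_mem_sub (A := A) (Set.mem_Iio.2 hi) a)
      rw [sub_add_cancel] at h1
      rw [hr.symm_left g (sub_mono (Set.Iio_subset_Iio hm) h1)]
      exact (sub_commute (disjoint_Ico_Iio m (j + L)) hx h1).symm
    · have h1 := ofSite_mem_sub (A := A) (Set.mem_Ici.2 hi) a
      rw [← hr.right g _ h1, StarAlgEquiv.symm_apply_apply]
      exact (sub_commute (disjoint_Ico_Ici m (j + L)) hx h1).symm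
  have hv : ∀ g, ∃ v ∈ unitary A.Alg, v ∈ A.sub (Set.Ico (m - R) (j + L)) ∧
      ∀ x ∈ A.sub (Set.Ico m (j + L)), v * α g⁻¹ (r g x) * star v = x := fun g =>
    exists_unitary_conj (Set.finite_Ico _ _) (Set.finite_Ico _ _)
      ((r g).trans (α g⁻¹)).toStarAlgHom (StarAlgHom.id ℂ A.Alg) (hq g)
      (fun x hx => sub_mono (Set.Ico_subset_Ico_left (by omega)) hx)
  choose v hvu hvm hv using hv
  refine ⟨m, hmn, fun g => ((r g).trans (α g⁻¹)).trans ((conjAut (v g) (hvu g)).trans (α g)),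
    fun g x hx => ?_, fun g x hx => ?_⟩
  · rw [sub_add_cancel] at hx
    refine aut_eq_on_sub (fun i hi a => ?_) hx
    change α g (conjAut _ _ (α g⁻¹ (r g (A.ofSite i a)))) = α g (A.ofSite i a)
    congr 1
    rcases lt_or_ge i (j + L) with hi' | hi'
    · rw [conjAut_apply, hv g _ (ofSite_mem_sub (Set.mem_Ico.2 ⟨Set.mem_Ici.1 hi, hi'⟩) a)]
    · have h1 := ofSite_mem_sub (A := A) (Set.mem_Ici.2 hi') a
      rw [hr.right g _ h1, inv_apply_apply,
        conjAut_of_commute (hvu g) (sub_commute (disjoint_Ico_Ici _ _) (hvm g) h1)]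
  · change α g (conjAut _ _ (α g⁻¹ (r g x))) = x
    have h1 := hα.mem_Iio g⁻¹ hx
    rw [hr.left g x (sub_mono (Set.Iio_subset_Iio (by omega)) hx),
      conjAut_of_commute (hvu g) (sub_commute (disjoint_Ico_Iio _ _) (hvm g)
        (sub_mono (Set.Iio_subset_Iio (by omega)) h1)), apply_inv_apply]

/-- Flat crossing operators exist for every right restriction as soon as they exist for one. -/
theorem IsFlatCrossing.of_isRightRestriction [Finite G] {j' : ℤ} {L' : ℕ} {X : G → G → A.Alg}
    {s : G → (A.Alg ≃⋆ₐ[ℂ] A.Alg)} (hr : α.IsRightRestriction j L r) (hX : α.IsFlatCrossing r X)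
    (hs : α.IsRightRestriction j' L' s) : ∃ Y, α.IsFlatCrossing s Y := by
  obtain ⟨V, hV⟩ := hr.exists_compare hs
  have : s = fun g => (r g).trans (conjAut (V g) (hV g).1.1) := funext fun g =>
    StarAlgEquiv.ext fun x => ((hV g).2 x).trans (conjAut_apply _ (hV g).1.1 _).symm
  rw [this]
  exact ⟨_, hX.conj fun g => (hV g).1⟩

end Symmetry

/-! ### Gluing symmetries that agree on an interval -/

theorem SpinChain.aut_apply_eq_of_cut {A : SpinChain} {f g : A.Alg ≃⋆ₐ[ℂ] A.Alg} (m : ℤ)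
    (h1 : ∀ x ∈ A.sub (Set.Iio m), f x = g x) (h2 : ∀ x ∈ A.sub (Set.Ici m), f x = g x)
    (x : A.Alg) : f x = g x :=
  DFunLike.congr_fun (aut_ext_cut (f := f.toStarAlgHom) (g := g.toStarAlgHom) m h1 h2) x

theorem SpinChain.rangeLE_of_ofSite {A : SpinChain} {f : A.Alg ≃⋆ₐ[ℂ] A.Alg} {R : ℕ}
    (h : ∀ i a, f (A.ofSite i a) ∈ A.sub (fatten {i} R)) : SpinChain.RangeLE f R :=
  fun _ _ hx => map_mem_of_mem_sub (f := f.toStarAlgHom) (isClosed_sub _)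
    (fun i hi a => sub_mono (fatten_singleton_subset hi R) (h i a)) hx

namespace Symmetry

variable {G : Type} [Group G] {A : SpinChain} {α β γ : Symmetry G A}
  {r : G → (A.Alg ≃⋆ₐ[ℂ] A.Alg)} {j : ℤ} {L R : ℕ}

theorem RangeLE.ofSite_mem (h : α.RangeLE R) (g : G) (i : ℤ) (a : A.OnSite i) :
    α g (A.ofSite i a) ∈ A.sub (Set.Icc (i - R) (i + R)) :=
  h.mem_Icc g (ofSite_mem_sub (Set.mem_Icc.2 ⟨le_rfl, le_rfl⟩) a)

/-- Two symmetries that agree on an interval are glued to one symmetry, equal to `α` to the left of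
the end and equal to `β` to the right of the beginning of the interval. -/
theorem exists_glued (hα : α.RangeLE R) (hβ : β.RangeLE R) (a : ℤ)
    (h : ∀ g, ∀ x ∈ A.sub (Set.Icc a (a + 12 * R)), α g x = β g x) :
    ∃ γ : Symmetry G A, γ.RangeLE R ∧
      (∀ g, ∀ x ∈ A.sub (Set.Iio (a + 12 * R + 1)), γ g x = α g x) ∧
      ∀ g, ∀ x ∈ A.sub (Set.Ici a), γ g x = β g x := by
  have hsite : ∀ g i, a ≤ i → i ≤ a + 12 * R → ∀ b, α g (A.ofSite i b) = β g (A.ofSite i b) :=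
    fun g i h1 h2 b => h g _ (ofSite_mem_sub (Set.mem_Icc.2 ⟨h1, h2⟩) b)
  -- The images of the two halves commute: sites `i < a` and `l > a + 12R` are too far apart to
  -- interact, and otherwise one of `α` and `β` can be used at both sites.
  have hF : ∀ g, ∃ k : A.Alg →⋆ₐ[ℂ] A.Alg, (∀ x ∈ A.sub (Set.Iio (a + 6 * R)), k x = α g x) ∧
      ∀ x ∈ A.sub (Set.Ici (a + 6 * R)), k x = β g x := fun g =>
    exists_glue (α g).toStarAlgHom (β g).toStarAlgHom (a + 6 * R) fun i hi l hl b c => by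
      have hil : i ≠ l := by omega
      change Commute (α g (A.ofSite i b)) (β g (A.ofSite l c))
      by_cases h1 : a ≤ i
      · rw [hsite g i h1 (by omega)]
        exact (A.ofSite_commute hil b c).map (β g)
      by_cases h2 : l ≤ a + 12 * R
      · rw [← hsite g l (by omega) h2]
        exact (A.ofSite_commute hil b c).map (α g)
      refine sub_commute (Set.disjoint_left.2 fun p hp hp' => ?_) (hα.ofSite_mem g i b)
        (hβ.ofSite_mem g l c)
      have := hp.2
      have := hp'.1
      omega
  choose F hFl hFr using hF
  have hFl' : ∀ g, ∀ x ∈ A.sub (Set.Iio (a + 12 * R + 1)), F g x = α g x := fun g x hx =>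
    hom_eq_on_sub (g := (α g).toStarAlgHom) (fun i hi b => by
      have hi : i < a + 12 * R + 1 := hi
      rcases lt_or_ge i (a + 6 * R) with hi' | hi'
      · exact hFl g _ (ofSite_mem_sub (Set.mem_Iio.2 hi') b)
      · rw [hFr g _ (ofSite_mem_sub (Set.mem_Ici.2 hi') b), ← hsite g i (by omega) (by omega)]
        rfl) hx
  have hFr' : ∀ g, ∀ x ∈ A.sub (Set.Ici a), F g x = β g x := fun g x hx =>
    hom_eq_on_sub (g := (β g).toStarAlgHom) (fun i hi b => by
      have hi : a ≤ i := hi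
      rcases lt_or_ge i (a + 6 * R) with hi' | hi'
      · rw [hFl g _ (ofSite_mem_sub (Set.mem_Iio.2 hi') b), hsite g i (by omega) (by omega)]
        rfl
      · exact hFr g _ (ofSite_mem_sub (Set.mem_Ici.2 hi') b)) hx
  have h1 : F 1 = StarAlgHom.id ℂ A.Alg := aut_ext_cut (a + 6 * R)
    (fun x hx => by rw [hFl 1 x hx, one_apply]; rfl)
    (fun x hx => by rw [hFr 1 x hx, one_apply]; rfl)
  have hmul : ∀ g h, (F g).comp (F h) = F (g * h) := fun g h => aut_ext_cut (a + 6 * R)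
    (fun x hx => by
      have h1 := hα.mem_Iio h hx
      change F g (F h x) = F (g * h) x
      rw [hFl h x hx, hFl (g * h) x hx, mul_apply,
        hFl' g _ (sub_mono (Set.Iio_subset_Iio (by omega)) h1)])
    (fun x hx => by
      have h1 := hβ.mem_Ici h hx
      change F g (F h x) = F (g * h) x
      rw [hFr h x hx, hFr (g * h) x hx, mul_apply,
        hFr' g _ (sub_mono (Set.Ici_subset_Ici.2 (by omega)) h1)])
  have hR : ∀ g, SpinChain.RangeLE (autHom F h1 hmul g) R := fun g =>
    rangeLE_of_ofSite fun i b => by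
      have hb := ofSite_mem_sub (A := A) (Set.mem_singleton i) b
      rcases lt_or_ge i (a + 6 * R) with hi' | hi'
      · rw [autHom_apply, hFl g _ (ofSite_mem_sub (Set.mem_Iio.2 hi') b)]
        exact hα g _ _ hb
      · rw [autHom_apply, hFr g _ (ofSite_mem_sub (Set.mem_Ici.2 hi') b)]
        exact hβ g _ _ hb
  exact ⟨⟨autHom F h1 hmul, fun g => ⟨R, hR g⟩⟩, hR,
    fun g x hx => (autHom_apply F h1 hmul g x).trans (hFl' g x hx),
    fun g x hx => (autHom_apply F h1 hmul g x).trans (hFr' g x hx)⟩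

theorem IsCovariant.exists_fusionPhase (hc : α.IsCovariant r) {Φ : G → G → A.Alg}
    (hΦ : IsFusion r Φ) :
    ∃ μ : G → U1GG G, α.IsFusionPhase Φ μ ∧ groupCohomology.IsMulCocycle₁ μ := by
  obtain ⟨μ, hμ⟩ := exists_twistedPhase hc.isFlatCrossing.isCrossing hΦ
  exact ⟨μ, isTwistedPhase_one_iff.1 hμ, hμ.isMulCocycle hc.isFlatCrossing hΦ⟩

/-- A covariant right restriction of `β` far to the right is also one for a symmetry `γ` that agrees
with `β` on the right. -/
theorem exists_hasMuClass_of_eq_right (hβ : β.RangeLE R) (hγ : γ.RangeLE R) {a : ℤ}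
    (h : ∀ g, ∀ x ∈ A.sub (Set.Ici a), γ g x = β g x) (hr : β.IsRightRestriction j L r)
    (hc : β.IsCovariant r) (ha : a + 2 * R ≤ j - L) : ∃ c, β.HasMuClass c ∧ γ.HasMuClass c := by
  obtain ⟨Φ, hΦ, hΦm⟩ := hr.exists_fusion hβ
  obtain ⟨μ, hμ, hμc⟩ := hc.exists_fusionPhase hΦ
  refine ⟨_, ⟨j, L, r, Φ, μ, hμc, hr, hc, hΦ, hμ, rfl⟩, ⟨j, L, r, Φ, μ, hμc,
    ⟨fun g x hx => ?_, hr.left⟩, fun g k x => ?_, hΦ, fun g g' k => ?_, rfl⟩⟩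
  · rw [hr.right g x hx, h g x (sub_mono (Set.Ici_subset_Ici.2 (by omega)) hx)]
  · refine aut_apply_eq_of_cut (f := ((γ k⁻¹).trans (r (k⁻¹ * g * k))).trans (γ k)) (g := r g)
      (a + R) (fun x hx => ?_) (fun x hx => ?_) x
    · change γ k (r (k⁻¹ * g * k) (γ k⁻¹ x)) = r g x
      rw [hr.left (k⁻¹ * g * k) _ (sub_mono (Set.Iio_subset_Iio (by omega)) (hγ.mem_Iio k⁻¹ hx)),
        hr.left g x (sub_mono (Set.Iio_subset_Iio (by omega)) hx), apply_inv_apply]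
    · change γ k (r (k⁻¹ * g * k) (γ k⁻¹ x)) = r g x
      have h1 := hβ.mem_Ici k⁻¹ hx
      rw [add_sub_cancel_right] at h1
      rw [h k⁻¹ x (sub_mono (Set.Ici_subset_Ici.2 (by omega)) hx),
        h k _ (hr.mem_Ici _ (by omega) h1), hc]
  · rw [h k _ (sub_mono (Set.Ico_subset_Ici_self.trans (Set.Ici_subset_Ici.2 (by omega)))
      (hΦm _ _)), hμ]

/-- If `γ` agrees with `α` on the left, then `r^(g) ∘ (α^(g))⁻¹ ∘ γ^(g)`, for a covariant right
restriction `r` of `α` far to the left, is a covariant right restriction of `γ`, and it has the same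
fusion operators as `r`. -/
theorem exists_hasMuClass_of_eq_left (hα : α.RangeLE R) (hγ : γ.RangeLE R) {e : ℤ}
    (h : ∀ g, ∀ x ∈ A.sub (Set.Iio e), γ g x = α g x) (hr : α.IsRightRestriction j L r)
    (hc : α.IsCovariant r) (he : j + L + 5 * R ≤ e) : ∃ c, α.HasMuClass c ∧ γ.HasMuClass c := by
  obtain ⟨Φ, hΦ, hΦm⟩ := hr.exists_fusion hα
  obtain ⟨μ, hμ, hμc⟩ := hc.exists_fusionPhase hΦ
  let q : G → (A.Alg ≃⋆ₐ[ℂ] A.Alg) := fun g => ((γ g).trans (α g⁻¹)).trans (r g)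
  have hq : ∀ g x, q g x = r g (α g⁻¹ (γ g x)) := fun _ _ => rfl
  have hql : ∀ g, ∀ x ∈ A.sub (Set.Iio e), q g x = r g x := fun g x hx => by
    rw [hq, h g x hx, inv_apply_apply]
  have hqr : ∀ g, ∀ x ∈ A.sub (Set.Ici (j + L + 2 * R)), q g x = γ g x := fun g x hx => by
    rw [hq, hr.right g _ (sub_mono (Set.Ici_subset_Ici.2 (by omega))
      (hα.mem_Ici g⁻¹ (hγ.mem_Ici g hx))), apply_inv_apply]
  refine ⟨_, ⟨j, L, r, Φ, μ, hμc, hr, hc, hΦ, hμ, rfl⟩, ⟨j, L + 2 * R, q, Φ, μ, hμc,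
    ⟨fun g x hx => hqr g x (sub_mono (Set.Ici_subset_Ici.2 (by push_cast; omega)) hx),
      fun g x hx => ?_⟩, fun g k x => ?_, fun g g' => ⟨(hΦ g g').1, fun x => ?_⟩,
    fun g g' k => ?_, rfl⟩⟩
  · rw [hql g x (sub_mono (Set.Iio_subset_Iio (by push_cast; omega)) hx),
      hr.left g x (sub_mono (Set.Iio_subset_Iio (by push_cast; omega)) hx)]
  · refine aut_apply_eq_of_cut (f := ((γ k⁻¹).trans (q (k⁻¹ * g * k))).trans (γ k)) (g := q g)
      (j + L + 3 * R) (fun x hx => ?_) (fun x hx => ?_) x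
    · change γ k (q (k⁻¹ * g * k) (γ k⁻¹ x)) = q g x
      have h1 := hα.mem_Iio k⁻¹ hx
      rw [h k⁻¹ x (sub_mono (Set.Iio_subset_Iio (by omega)) hx),
        hql _ _ (sub_mono (Set.Iio_subset_Iio (by omega)) h1),
        h k _ (sub_mono (Set.Iio_subset_Iio (by omega)) (hr.mem_Iio hα _ (by omega) h1)), hc,
        hql g x (sub_mono (Set.Iio_subset_Iio (by omega)) hx)]
    · change γ k (q (k⁻¹ * g * k) (γ k⁻¹ x)) = q g x
      rw [hqr _ _ (sub_mono (Set.Ici_subset_Ici.2 (by omega)) (hγ.mem_Ici k⁻¹ hx)),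
        hqr g x (sub_mono (Set.Ici_subset_Ici.2 (by omega)) hx), ← mul_apply γ (k⁻¹ * g * k),
        ← mul_apply]
      congr 2
      group
  · have hu : Φ g g' ∈ unitary A.Alg := (hΦ g g').1.1
    refine Eq.trans ?_ (conjAut_apply _ hu _)
    refine aut_apply_eq_of_cut (f := (q g').trans (q g)) (g := (q (g * g')).trans (conjAut _ hu))
      (j + L + 3 * R) (fun x hx => ?_) (fun x hx => ?_) x
    · change q g (q g' x) = conjAut _ hu (q (g * g') x)
      rw [hql g' x (sub_mono (Set.Iio_subset_Iio (by omega)) hx),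
        hql g _ (sub_mono (Set.Iio_subset_Iio (by omega)) (hr.mem_Iio hα _ (by omega) hx)),
        hql _ x (sub_mono (Set.Iio_subset_Iio (by omega)) hx), (hΦ g g').2, conjAut_apply]
    · change q g (q g' x) = conjAut _ hu (q (g * g') x)
      have h1 : γ (g * g') x ∈ A.sub (Set.Ici (j + L + R)) :=
        sub_mono (Set.Ici_subset_Ici.2 (by omega)) (hγ.mem_Ici _ hx)
      rw [hqr g' x (sub_mono (Set.Ici_subset_Ici.2 (by omega)) hx),
        hqr g _ (sub_mono (Set.Ici_subset_Ici.2 (by omega)) (hγ.mem_Ici g' hx)),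
        hqr _ x (sub_mono (Set.Ici_subset_Ici.2 (by omega)) hx),
        conjAut_of_commute hu (sub_commute (disjoint_Ico_Ici _ _) (hΦm g g') h1), mul_apply]
  · rw [h k _ (sub_mono (fun i hi => Set.mem_Iio.2 (hi.2.trans_le (by omega))) (hΦm _ _)), hμ]

theorem HasTwistedClass.stack_regular [Fintype G] [DecidableEq G] {c : KGroup G}
    (h : α.HasTwistedClass c) : (α.stack (regular G)).HasTwistedClass c := by
  have := h.stack regular_rangeLE.hasMuClass_one.hasTwistedClass
  rwa [mul_one] at this

theorem RangeLE.stack_regular [Fintype G] [DecidableEq G] (h : α.RangeLE R) :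
    (α.stack (regular G)).RangeLE R := fun g =>
  (h g).stackAut ((regular_rangeLE g).mono (Nat.zero_le R))

/-- The class `[μ]` can be computed from the symmetry on an interval: after stacking with the
regular symmetry, the symmetry glued from `α` and `β` has the class of `α`, from a covariant right
restriction far to the left, and that of `β`, from one far to the right. -/
theorem HasTwistedClass.eq_of_eq_on_Icc [Fintype G] [DecidableEq G] {c d : KGroup G}
    (h : α.HasTwistedClass c) (h' : β.HasTwistedClass d) (hα : α.RangeLE R) (hβ : β.RangeLE R)
    (a : ℤ) (hI : ∀ g, ∀ x ∈ A.sub (Set.Icc a (a + 12 * R)), α g x = β g x) : c = d := by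
  obtain ⟨γ, hγ, hγl, hγr⟩ := exists_glued hα.stack_regular hβ.stack_regular a fun g x hx =>
    stackAut_eq_on_sub (f := α.stack (regular G) g) (g := β.stack (regular G) g)
      (fun x hx => by rw [stack_inl, stack_inl, hI g x hx])
      (fun x hx => by rw [stack_inr, stack_inr]) hx
  have h1 : γ.HasTwistedClass c := by
    obtain ⟨j, L, r, X, hr, hX⟩ := h.hasObstruction.exists_flat
    -- A covariant restriction at `m - R` with defect size `3R + 1` needs `γ = α` on the sites below
    -- `m + 7R + 1`.
    obtain ⟨m, hm, s, hs⟩ := hr.exists_left hα (a + 2 * R)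
    obtain ⟨Y, hY⟩ := hX.of_isRightRestriction hr hs
    obtain ⟨t, ht, htc⟩ := hY.exists_covariant hα hs
    obtain ⟨c', hc, hc'⟩ := exists_hasMuClass_of_eq_left hα.stack_regular hγ hγl ht htc
      (by push_cast; omega)
    rw [← h.stack_regular.unique hc.hasTwistedClass]
    exact hc'.hasTwistedClass
  have h2 : γ.HasTwistedClass d := by
    obtain ⟨j, L, r, X, hr, hX⟩ := h'.hasObstruction.exists_flat
    -- A covariant restriction at `m + R` with defect size `3R + 1` needs `γ = β` on the sites from
    -- `m - 4R - 1` on.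
    obtain ⟨m, hm, s, hs⟩ := hr.exists_right hβ (a + 4 * R + 1)
    obtain ⟨Y, hY⟩ := hX.of_isRightRestriction hr hs
    obtain ⟨t, ht, htc⟩ := hY.exists_covariant hβ hs
    obtain ⟨d', hd, hd'⟩ := exists_hasMuClass_of_eq_right hβ.stack_regular hγ hγr ht htc
      (by push_cast; omega)
    rw [← h'.stack_regular.unique hd.hasTwistedClass]
    exact hd'.hasTwistedClass
  exact h2.unique h1

end Symmetry

/-! ### Homomorphisms from stacks and on-site isomorphisms -/

namespace SpinChain

variable {A B C D : SpinChain} {E : Type*} [CStarAlgebra E]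

theorem commute_of_stack {k : (A.stack B).Alg →⋆ₐ[ℂ] E} {y : E}
    (h1 : ∀ a, Commute (k (A.inl B a)) y) (h2 : ∀ b, Commute (k (A.inr B b)) y)
    (x : (A.stack B).Alg) : Commute (k x) y := by
  refine commute_of_ofSite (fun j c => ?_) x
  induction c using kron_induction (m := A.site j) (n := B.site j) with
  | h a b => rw [ofSite_kron, map_mul]; exact (h1 _).mul_left (h2 _)
  | hadd x y hx hy => rw [map_add, map_add]; exact hx.add_left hy

/-- The homomorphism on a stack given by two commuting homomorphisms on the factors. -/
noncomputable def stackLift (f : A.Alg →⋆ₐ[ℂ] E) (g : B.Alg →⋆ₐ[ℂ] E)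
    (h : ∀ x y, Commute (f x) (g y)) : (A.stack B).Alg →⋆ₐ[ℂ] E :=
  (exists_stackHom f g h).choose

theorem stackLift_inl {f : A.Alg →⋆ₐ[ℂ] E} {g : B.Alg →⋆ₐ[ℂ] E} (h : ∀ x y, Commute (f x) (g y))
    (x : A.Alg) : stackLift f g h (A.inl B x) = f x :=
  (exists_stackHom f g h).choose_spec.1 x

theorem stackLift_inr {f : A.Alg →⋆ₐ[ℂ] E} {g : B.Alg →⋆ₐ[ℂ] E} (h : ∀ x y, Commute (f x) (g y))
    (y : B.Alg) : stackLift f g h (A.inr B y) = g y :=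
  (exists_stackHom f g h).choose_spec.2 y

/-- A homomorphism of chain algebras is on-site if it maps the on-site algebra of every site into
that of the same site. -/
def IsOnSite (f : A.Alg →⋆ₐ[ℂ] B.Alg) : Prop := ∀ j a, f (A.ofSite j a) ∈ B.sub {j}

theorem IsOnSite.mem_sub {f : A.Alg →⋆ₐ[ℂ] B.Alg} (hf : IsOnSite f) {X : Set ℤ} {x : A.Alg}
    (hx : x ∈ A.sub X) : f x ∈ B.sub X := by
  have h : ∀ j ∈ X, ∀ a, f (A.ofSite j a) ∈ B.sub X := fun j hj a =>
    sub_mono (Set.singleton_subset_iff.2 hj) (hf j a)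
  exact map_mem_of_mem_sub (f := f) (T := B.sub X) (isClosed_sub X) h hx

theorem IsOnSite.comp {g : B.Alg →⋆ₐ[ℂ] C.Alg} {f : A.Alg →⋆ₐ[ℂ] B.Alg} (hg : IsOnSite g)
    (hf : IsOnSite f) : IsOnSite (g.comp f) := fun j a => hg.mem_sub (hf j a)

theorem isOnSite_id : IsOnSite (StarAlgHom.id ℂ A.Alg) := fun j a =>
  ofSite_mem_sub (Set.mem_singleton j) a

theorem isOnSite_inl : IsOnSite (A.inl B) := fun j a =>
  inl_mem_sub (ofSite_mem_sub (Set.mem_singleton j) a)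

theorem isOnSite_inr : IsOnSite (A.inr B) := fun j a =>
  inr_mem_sub (ofSite_mem_sub (Set.mem_singleton j) a)

theorem IsOnSite.stackLift {f : A.Alg →⋆ₐ[ℂ] C.Alg} {g : B.Alg →⋆ₐ[ℂ] C.Alg}
    (h : ∀ x y, Commute (f x) (g y)) (hf : IsOnSite f) (hg : IsOnSite g) :
    IsOnSite (stackLift f g h) := fun j c => by
  induction c using kron_induction (m := A.site j) (n := B.site j) with
  | h a b =>
    rw [ofSite_kron, map_mul, stackLift_inl, stackLift_inr]
    exact mul_mem (hf j a) (hg j b)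
  | hadd x y hx hy => rw [map_add, map_add]; exact add_mem hx hy

/-- The isomorphism given by two mutually inverse homomorphisms of chain algebras. -/
noncomputable def isoOf (f : A.Alg →⋆ₐ[ℂ] B.Alg) (g : B.Alg →⋆ₐ[ℂ] A.Alg)
    (hgf : ∀ x, g (f x) = x) (hfg : ∀ y, f (g y) = y) : A.Alg ≃⋆ₐ[ℂ] B.Alg :=
  StarAlgEquiv.ofStarAlgHom f g (StarAlgHom.ext hgf) (StarAlgHom.ext hfg)

theorem IsOnSite.mem_iff {f : A.Alg →⋆ₐ[ℂ] B.Alg} {g : B.Alg →⋆ₐ[ℂ] A.Alg}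
    (hgf : ∀ x, g (f x) = x) (hf : IsOnSite f) (hg : IsOnSite g) {X : Set ℤ} {x : A.Alg} :
    f x ∈ B.sub X ↔ x ∈ A.sub X :=
  ⟨fun h => by have := hg.mem_sub h; rwa [hgf] at this, hf.mem_sub⟩

/-- The tensor product of two homomorphisms of chain algebras. -/
noncomputable def stackMap (f : A.Alg →⋆ₐ[ℂ] C.Alg) (g : B.Alg →⋆ₐ[ℂ] D.Alg) :
    (A.stack B).Alg →⋆ₐ[ℂ] (C.stack D).Alg :=
  stackLift ((C.inl D).comp f) ((C.inr D).comp g) fun x y => commute_inl_inr (f x) (g y)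

theorem stackMap_inl (f : A.Alg →⋆ₐ[ℂ] C.Alg) (g : B.Alg →⋆ₐ[ℂ] D.Alg) (x : A.Alg) :
    stackMap f g (A.inl B x) = C.inl D (f x) := stackLift_inl _ x

theorem stackMap_inr (f : A.Alg →⋆ₐ[ℂ] C.Alg) (g : B.Alg →⋆ₐ[ℂ] D.Alg) (y : B.Alg) :
    stackMap f g (A.inr B y) = C.inr D (g y) := stackLift_inr _ y

theorem IsOnSite.stackMap {f : A.Alg →⋆ₐ[ℂ] C.Alg} {g : B.Alg →⋆ₐ[ℂ] D.Alg} (hf : IsOnSite f)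
    (hg : IsOnSite g) : IsOnSite (stackMap f g) :=
  .stackLift _ (isOnSite_inl.comp hf) (isOnSite_inr.comp hg)

theorem stack_apply_eq {f g : (A.stack B).Alg →⋆ₐ[ℂ] E} (hl : ∀ x, f (A.inl B x) = g (A.inl B x))
    (hr : ∀ y, f (A.inr B y) = g (A.inr B y)) (x : (A.stack B).Alg) : f x = g x :=
  DFunLike.congr_fun (stack_hom_ext hl hr) x

theorem stackMap_stackMap_eq {f : A.Alg →⋆ₐ[ℂ] C.Alg} {f' : C.Alg →⋆ₐ[ℂ] A.Alg}
    {g : B.Alg →⋆ₐ[ℂ] D.Alg} {g' : D.Alg →⋆ₐ[ℂ] B.Alg} (hf : ∀ x, f' (f x) = x)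
    (hg : ∀ x, g' (g x) = x) (x : (A.stack B).Alg) : stackMap f' g' (stackMap f g x) = x :=
  stack_apply_eq (f := (stackMap f' g').comp (stackMap f g)) (g := StarAlgHom.id ℂ _)
    (fun x => (congrArg _ (stackMap_inl f g x)).trans ((stackMap_inl _ _ _).trans
      (congrArg _ (hf x))))
    (fun x => (congrArg _ (stackMap_inr f g x)).trans ((stackMap_inr _ _ _).trans
      (congrArg _ (hg x)))) x

/-- The on-site algebras of the trivial chain are `ℂ`, so its algebra maps to any other one. -/
noncomputable def unitHom (E : Type*) [CStarAlgebra E] : unitChain.Alg →⋆ₐ[ℂ] E :=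
  unitChain.lift (fun _ =>
    { toFun a := algebraMap ℂ E (a () ())
      map_one' := by simp
      map_mul' a b := by
        rw [← map_mul]
        simp [Matrix.mul_apply]
      map_zero' := by simp
      map_add' a b := by rw [← map_add]; rfl
      commutes' c := by simp [Matrix.algebraMap_matrix_apply]
      map_star' a := (algebraMap_star_comm _) }) fun _ _ _ a b => Algebra.commutes _ _

theorem unitChain_onSite_eq (j : ℤ) (a : unitChain.OnSite j) :
    a = algebraMap ℂ (unitChain.OnSite j) (a () ()) := by
  ext
  simp [Matrix.algebraMap_matrix_apply]

theorem unitChain_ofSite (f : unitChain.Alg →⋆ₐ[ℂ] E) (j : ℤ) (a : unitChain.OnSite j) :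
    f (unitChain.ofSite j a) = algebraMap ℂ E (a () ()) := by
  rw [unitChain_onSite_eq j a, AlgHomClass.commutes, AlgHomClass.commutes,
    ← unitChain_onSite_eq j a]

theorem unitChain_apply_eq (f g : unitChain.Alg →⋆ₐ[ℂ] E) (x : unitChain.Alg) : f x = g x :=
  DFunLike.congr_fun (hom_ext fun j a => by rw [unitChain_ofSite, unitChain_ofSite]) x

theorem isOnSite_of_unitChain (f : unitChain.Alg →⋆ₐ[ℂ] A.Alg) : IsOnSite f := fun j a => by
  rw [unitChain_ofSite]
  exact (A.sub {j}).algebraMap_mem _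

end SpinChain

/-! ### Finite depth quantum circuits -/

namespace SpinChain

variable {A B : SpinChain}

theorem IsQCA.mul {f g : A.Alg ≃⋆ₐ[ℂ] A.Alg} (hf : IsQCA f) (hg : IsQCA g) : IsQCA (f * g) := by
  obtain ⟨r, hr⟩ := hf
  obtain ⟨s, hs⟩ := hg
  refine ⟨s + r, fun X x hx => sub_mono ?_ (hr _ _ (hs X x hx))⟩
  rintro j ⟨i, ⟨l, hl, hil⟩, hji⟩
  refine ⟨l, hl, ?_⟩
  push_cast
  have := abs_sub_le j i l
  omega

theorem IsFDQC.isQCA {γ : A.Alg ≃⋆ₐ[ℂ] A.Alg} (h : IsFDQC γ) : IsQCA γ ∧ IsQCA γ.symm := by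
  obtain ⟨l, hl, rfl⟩ := h
  induction l with
  | nil =>
    have : IsQCA (1 : A.Alg ≃⋆ₐ[ℂ] A.Alg) := ⟨0, fun X _ hx => sub_mono (subset_fatten X 0) hx⟩
    exact ⟨this, this⟩
  | cons β l ih =>
    obtain ⟨I, hI, hβ⟩ := hl β List.mem_cons_self
    have := ih fun b hb => hl b (List.mem_cons_of_mem _ hb)
    rw [List.prod_cons]
    exact ⟨(hβ.isQCA hI).mul this.1, this.2.mul (hβ.symm.isQCA hI)⟩

theorem IsBlockProduct.stackAut {I : ℤ → Set ℤ} {β : A.Alg ≃⋆ₐ[ℂ] A.Alg} (h : IsBlockProduct I β) :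
    IsBlockProduct I (stackAut β (1 : B.Alg ≃⋆ₐ[ℂ] B.Alg)) := by
  obtain ⟨U, hU⟩ := h
  refine ⟨fun a => A.inl B (U a), fun a => ?_⟩
  have hu := Unitary.map_mem (A.inl B) (hU a).1
  refine ⟨hu, inl_mem_sub (hU a).2.1, fun x hx => Eq.trans ?_ (conjAut_apply _ hu x)⟩
  refine stackAut_eq_on_sub (g := conjAut _ hu) (fun x hx => ?_) (fun x hx => ?_) hx
  · rw [stackAut_inl, (hU a).2.2 x hx, conjAut_apply, map_mul, map_mul, map_star]
  · rw [stackAut_inr, conjAut_of_commute hu (commute_inl_inr _ _)]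
    rfl

theorem IsFDQC.stackAut {γ : A.Alg ≃⋆ₐ[ℂ] A.Alg} (h : IsFDQC γ) :
    IsFDQC (stackAut γ (1 : B.Alg ≃⋆ₐ[ℂ] B.Alg)) := by
  obtain ⟨l, hl, rfl⟩ := h
  refine ⟨l.map fun β => SpinChain.stackAut β 1, fun β hβ => ?_, ?_⟩
  · obtain ⟨β', hβ', rfl⟩ := List.mem_map.1 hβ
    obtain ⟨I, hI, h⟩ := hl β' hβ'
    exact ⟨I, hI, h.stackAut⟩
  · clear hl
    induction l with
    | nil =>
      exact aut_ext_stack (fun x => stackAut_inl _ _ x) (fun x => stackAut_inr _ _ x)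
    | cons β l ih =>
      rw [List.prod_cons, List.map_cons, List.prod_cons, ← ih]
      refine aut_ext_stack (fun x => ?_) (fun x => ?_)
      · change _ = SpinChain.stackAut β 1 (SpinChain.stackAut l.prod 1 _)
        rw [stackAut_inl, stackAut_inl, stackAut_inl]
        rfl
      · change _ = SpinChain.stackAut β 1 (SpinChain.stackAut l.prod 1 _)
        rw [stackAut_inr, stackAut_inr, stackAut_inr]
        rfl

end SpinChain

/-! ### Stable equivalence -/

namespace Symmetry

variable {G : Type} [Group G] {A B C : SpinChain} {α : Symmetry G A} {β : Symmetry G B}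
  {γ : Symmetry G C}

/-- An on-site isomorphism that intertwines two symmetries makes them equivalent, with trivial
circuit. -/
theorem equivalent_of_homs (f : A.Alg →⋆ₐ[ℂ] B.Alg) (g : B.Alg →⋆ₐ[ℂ] A.Alg)
    (hgf : ∀ x, g (f x) = x) (hfg : ∀ y, f (g y) = y) (hf : IsOnSite f) (hg : IsOnSite g)
    (h : ∀ k x, f (α k x) = β k (f x)) : Equivalent α β :=
  ⟨isoOf f g hgf hfg, fun _ _ => hf.mem_iff hgf hg, 1, ⟨[], by simp, rfl⟩, fun k x => by
    change β k x = f (α k (g x))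
    rw [h, hfg]⟩

theorem equivalent_comm (α : Symmetry G A) (β : Symmetry G B) :
    Equivalent (α.stack β) (β.stack α) := by
  have key : ∀ {A B : SpinChain}, ∃ f : (A.stack B).Alg →⋆ₐ[ℂ] (B.stack A).Alg,
      (∀ x, f (A.inl B x) = B.inr A x) ∧ (∀ x, f (A.inr B x) = B.inl A x) ∧ IsOnSite f :=
    fun {A B} => ⟨stackLift (B.inr A) (B.inl A) fun x y => (commute_inl_inr y x).symm,
      stackLift_inl _, stackLift_inr _, .stackLift _ isOnSite_inr isOnSite_inl⟩
  have inv : ∀ {A B : SpinChain} (f : (A.stack B).Alg →⋆ₐ[ℂ] (B.stack A).Alg)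
      (g : (B.stack A).Alg →⋆ₐ[ℂ] (A.stack B).Alg), (∀ x, f (A.inl B x) = B.inr A x) →
      (∀ x, f (A.inr B x) = B.inl A x) → (∀ x, g (B.inl A x) = A.inr B x) →
      (∀ x, g (B.inr A x) = A.inl B x) → ∀ x, g (f x) = x := fun f g h1 h2 h3 h4 x =>
    stack_apply_eq (f := g.comp f) (g := StarAlgHom.id ℂ _)
      (fun x => (congrArg g (h1 x)).trans (h4 x)) (fun x => (congrArg g (h2 x)).trans (h3 x)) x
  obtain ⟨f, f1, f2, hf⟩ := key (A := A) (B := B)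
  obtain ⟨g, g1, g2, hg⟩ := key (A := B) (B := A)
  refine equivalent_of_homs f g (inv f g f1 f2 g1 g2) (inv g f g1 g2 f1 f2) hf hg fun k x => ?_
  refine stack_apply_eq (f := f.comp (α.stack β k).toStarAlgHom)
    (g := (β.stack α k).toStarAlgHom.comp f) (fun x => ?_) (fun x => ?_) x
  · change f (α.stack β k (A.inl B x)) = β.stack α k (f (A.inl B x))
    rw [stack_inl, f1, f1, stack_inr]
  · change f (α.stack β k (A.inr B x)) = β.stack α k (f (A.inr B x))
    rw [stack_inr, f2, f2, stack_inl]

theorem stack_stack_apply_eq {E : Type*} [CStarAlgebra E]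
    {f g : ((A.stack B).stack C).Alg →⋆ₐ[ℂ] E}
    (h1 : ∀ x, f ((A.stack B).inl C (A.inl B x)) = g ((A.stack B).inl C (A.inl B x)))
    (h2 : ∀ x, f ((A.stack B).inl C (A.inr B x)) = g ((A.stack B).inl C (A.inr B x)))
    (h3 : ∀ x, f ((A.stack B).inr C x) = g ((A.stack B).inr C x)) (x : ((A.stack B).stack C).Alg) :
    f x = g x :=
  stack_apply_eq (stack_apply_eq (f := f.comp ((A.stack B).inl C))
    (g := g.comp ((A.stack B).inl C)) h1 h2) h3 x

theorem stack_stack_apply_eq' {E : Type*} [CStarAlgebra E]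
    {f g : (A.stack (B.stack C)).Alg →⋆ₐ[ℂ] E}
    (h1 : ∀ x, f (A.inl (B.stack C) x) = g (A.inl (B.stack C) x))
    (h2 : ∀ x, f (A.inr (B.stack C) (B.inl C x)) = g (A.inr (B.stack C) (B.inl C x)))
    (h3 : ∀ x, f (A.inr (B.stack C) (B.inr C x)) = g (A.inr (B.stack C) (B.inr C x)))
    (x : (A.stack (B.stack C)).Alg) : f x = g x :=
  stack_apply_eq h1 (stack_apply_eq (f := f.comp (A.inr (B.stack C)))
    (g := g.comp (A.inr (B.stack C))) h2 h3) x

/-- The associator of stacks; `exists_assocHom_symm` gives its inverse. -/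
theorem exists_assocHom (A B C : SpinChain) :
    ∃ f : ((A.stack B).stack C).Alg →⋆ₐ[ℂ] (A.stack (B.stack C)).Alg,
      (∀ x, f ((A.stack B).inl C (A.inl B x)) = A.inl (B.stack C) x) ∧
      (∀ x, f ((A.stack B).inl C (A.inr B x)) = A.inr (B.stack C) (B.inl C x)) ∧
      (∀ x, f ((A.stack B).inr C x) = A.inr (B.stack C) (B.inr C x)) ∧ IsOnSite f := by
  obtain ⟨q, q1, q2, hq⟩ : ∃ q : (A.stack B).Alg →⋆ₐ[ℂ] (A.stack (B.stack C)).Alg,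
      (∀ x, q (A.inl B x) = A.inl (B.stack C) x) ∧
      (∀ x, q (A.inr B x) = A.inr (B.stack C) (B.inl C x)) ∧ IsOnSite q :=
    ⟨stackLift (A.inl (B.stack C)) ((A.inr (B.stack C)).comp (B.inl C)) fun x y =>
      commute_inl_inr x (B.inl C y), stackLift_inl _, stackLift_inr _,
      .stackLift _ isOnSite_inl (isOnSite_inr.comp isOnSite_inl)⟩
  have hc : ∀ x y, Commute (q x) (((A.inr (B.stack C)).comp (B.inr C)) y) := fun x y =>
    commute_of_stack (fun a => by rw [q1]; exact commute_inl_inr a (B.inr C y))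
      (fun b => by rw [q2]; exact (commute_inl_inr b y).map (A.inr (B.stack C))) x
  refine ⟨stackLift q _ hc, fun x => ?_, fun x => ?_, fun x => stackLift_inr hc x,
    .stackLift hc hq (isOnSite_inr.comp isOnSite_inr)⟩
  · rw [stackLift_inl, q1]
  · rw [stackLift_inl, q2]

theorem exists_assocHom_symm (A B C : SpinChain) :
    ∃ f : (A.stack (B.stack C)).Alg →⋆ₐ[ℂ] ((A.stack B).stack C).Alg,
      (∀ x, f (A.inl (B.stack C) x) = (A.stack B).inl C (A.inl B x)) ∧
      (∀ x, f (A.inr (B.stack C) (B.inl C x)) = (A.stack B).inl C (A.inr B x)) ∧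
      (∀ x, f (A.inr (B.stack C) (B.inr C x)) = (A.stack B).inr C x) ∧ IsOnSite f := by
  obtain ⟨q, q1, q2, hq⟩ : ∃ q : (B.stack C).Alg →⋆ₐ[ℂ] ((A.stack B).stack C).Alg,
      (∀ x, q (B.inl C x) = (A.stack B).inl C (A.inr B x)) ∧
      (∀ x, q (B.inr C x) = (A.stack B).inr C x) ∧ IsOnSite q :=
    ⟨stackLift (((A.stack B).inl C).comp (A.inr B)) ((A.stack B).inr C) fun x y =>
      commute_inl_inr (A.inr B x) y, stackLift_inl _, stackLift_inr _,
      .stackLift _ (isOnSite_inl.comp isOnSite_inr) isOnSite_inr⟩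
  have hc : ∀ x y, Commute ((((A.stack B).inl C).comp (A.inl B)) x) (q y) := fun x y =>
    (commute_of_stack (fun a => by
      rw [q1]
      exact (commute_inl_inr x a).symm.map ((A.stack B).inl C))
      (fun b => by rw [q2]; exact (commute_inl_inr (A.inl B x) b).symm) y).symm
  refine ⟨stackLift _ q hc, fun x => stackLift_inl hc x, fun x => ?_, fun x => ?_,
    .stackLift hc (isOnSite_inl.comp isOnSite_inl) hq⟩
  · rw [stackLift_inr, q1]
  · rw [stackLift_inr, q2]

theorem equivalent_assoc (α : Symmetry G A) (β : Symmetry G B) (γ : Symmetry G C) :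
    Equivalent ((α.stack β).stack γ) (α.stack (β.stack γ)) := by
  obtain ⟨f, f1, f2, f3, hf⟩ := exists_assocHom A B C
  obtain ⟨g, g1, g2, g3, hg⟩ := exists_assocHom_symm A B C
  refine equivalent_of_homs f g
    (stack_stack_apply_eq (f := g.comp f) (g := StarAlgHom.id ℂ _)
      (fun x => (congrArg g (f1 x)).trans (g1 x)) (fun x => (congrArg g (f2 x)).trans (g2 x))
      (fun x => (congrArg g (f3 x)).trans (g3 x)))
    (stack_stack_apply_eq' (f := f.comp g) (g := StarAlgHom.id ℂ _)
      (fun x => (congrArg f (g1 x)).trans (f1 x)) (fun x => (congrArg f (g2 x)).trans (f2 x))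
      (fun x => (congrArg f (g3 x)).trans (f3 x))) hf hg fun k x => ?_
  refine stack_stack_apply_eq (f := f.comp ((α.stack β).stack γ k).toStarAlgHom)
    (g := (α.stack (β.stack γ) k).toStarAlgHom.comp f) (fun x => ?_) (fun x => ?_) (fun x => ?_) x
  · change f ((α.stack β).stack γ k _) = α.stack (β.stack γ) k (f _)
    rw [stack_inl, stack_inl, f1, f1, stack_inl]
  · change f ((α.stack β).stack γ k _) = α.stack (β.stack γ) k (f _)
    rw [stack_inl, stack_inr, f2, f2, stack_inr, stack_inl]
  · change f ((α.stack β).stack γ k _) = α.stack (β.stack γ) k (f _)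
    rw [stack_inr, f3, f3, stack_inr, stack_inr]

theorem equivalent_stack_unit (α : Symmetry G A) :
    Equivalent (α.stack (triv G unitChain)) α := by
  have hc : ∀ x y, Commute (StarAlgHom.id ℂ A.Alg x) (unitHom A.Alg y) := fun x y =>
    (commute_of_ofSite (fun j a => by
      rw [unitChain_ofSite]
      exact Algebra.commutes _ _) y).symm
  refine equivalent_of_homs (stackLift _ _ hc) (A.inl unitChain)
    (stack_apply_eq (f := (A.inl unitChain).comp (stackLift _ _ hc)) (g := StarAlgHom.id ℂ _)
      (fun x => congrArg (A.inl unitChain) (stackLift_inl hc x))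
      (fun x => unitChain_apply_eq (((A.inl unitChain).comp (stackLift _ _ hc)).comp
        (A.inr unitChain)) (A.inr unitChain) x))
    (stackLift_inl hc) (.stackLift hc isOnSite_id (isOnSite_of_unitChain _)) isOnSite_inl
    fun k x => ?_
  refine stack_apply_eq (f := (stackLift _ _ hc).comp (α.stack (triv G unitChain) k).toStarAlgHom)
    (g := (α k).toStarAlgHom.comp (stackLift _ _ hc)) (fun x => ?_) (fun x => ?_) x
  · change stackLift _ _ hc (α.stack (triv G unitChain) k (A.inl unitChain x)) =
      α k (stackLift _ _ hc (A.inl unitChain x))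
    rw [stack_inl, stackLift_inl, stackLift_inl]
    rfl
  · exact unitChain_apply_eq
      (((stackLift _ _ hc).comp (α.stack (triv G unitChain) k).toStarAlgHom).comp (A.inr unitChain))
      (((α k).toStarAlgHom.comp (stackLift _ _ hc)).comp (A.inr unitChain)) x

theorem isOnSite_of_mem_iff {θ : A.Alg ≃⋆ₐ[ℂ] B.Alg} (hθ : ∀ j x, θ x ∈ B.sub {j} ↔ x ∈ A.sub {j}) :
    IsOnSite θ.toStarAlgHom ∧ IsOnSite θ.symm.toStarAlgHom := by
  refine ⟨fun j a => (hθ j _).2 (ofSite_mem_sub (Set.mem_singleton j) a), fun j a => (hθ j _).1 ?_⟩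
  change θ (θ.symm _) ∈ _
  rw [StarAlgEquiv.apply_symm_apply]
  exact ofSite_mem_sub (Set.mem_singleton j) a

theorem stackMap_conj (f : A.Alg →⋆ₐ[ℂ] B.Alg) (f' : B.Alg →⋆ₐ[ℂ] A.Alg) (a : A.Alg ≃⋆ₐ[ℂ] A.Alg)
    (b d : B.Alg ≃⋆ₐ[ℂ] B.Alg) (c : C.Alg ≃⋆ₐ[ℂ] C.Alg) (h : ∀ x, f (a (f' (d x))) = d (b x))
    (x : (B.stack C).Alg) :
    stackMap f (StarAlgHom.id ℂ C.Alg)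
      (stackAut a c (stackMap f' (StarAlgHom.id ℂ C.Alg) (stackAut d 1 x))) =
      stackAut d 1 (stackAut b c x) := by
  refine stack_apply_eq (f := (stackMap f (StarAlgHom.id ℂ C.Alg)).comp
      ((stackAut a c).toStarAlgHom.comp ((stackMap f' (StarAlgHom.id ℂ C.Alg)).comp
        (stackAut d 1).toStarAlgHom)))
    (g := (stackAut d 1).toStarAlgHom.comp (stackAut b c).toStarAlgHom)
    (fun x => ?_) (fun x => ?_) x
  · have h1 : ∀ x, stackAut d (1 : C.Alg ≃⋆ₐ[ℂ] C.Alg) (B.inl C x) = B.inl C (d x) :=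
      stackAut_inl _ _
    exact (congrArg (fun y => stackMap _ _ (stackAut a c (stackMap _ _ y))) (h1 x)).trans
      ((congrArg (fun y => stackMap _ _ (stackAut a c y)) (stackMap_inl _ _ _)).trans
      ((congrArg (stackMap _ _) (stackAut_inl a c _)).trans ((stackMap_inl _ _ _).trans
      ((congrArg (B.inl C) (h x)).trans ((h1 _).symm.trans
      (congrArg (stackAut d 1) (stackAut_inl b c x).symm))))))
  · have h1 : ∀ x, stackAut d (1 : C.Alg ≃⋆ₐ[ℂ] C.Alg) (B.inr C x) = B.inr C x :=
      stackAut_inr _ _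
    exact (congrArg (fun y => stackMap _ _ (stackAut a c (stackMap _ _ y))) (h1 x)).trans
      ((congrArg (fun y => stackMap _ _ (stackAut a c y)) (stackMap_inr _ _ _)).trans
      ((congrArg (stackMap _ _) (stackAut_inr a c _)).trans ((stackMap_inr _ _ _).trans
      ((h1 _).symm.trans (congrArg (stackAut d 1) (stackAut_inr b c x).symm)))))

theorem Equivalent.stack (h : Equivalent α β) (γ : Symmetry G C) :
    Equivalent (α.stack γ) (β.stack γ) := by
  obtain ⟨θ, hθ, δ, hδ, h⟩ := h
  obtain ⟨hθ1, hθ2⟩ := isOnSite_of_mem_iff hθ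
  have hgf := stackMap_stackMap_eq (f := θ.toStarAlgHom) (f' := θ.symm.toStarAlgHom)
    (g := StarAlgHom.id ℂ C.Alg) (g' := StarAlgHom.id ℂ C.Alg) θ.symm_apply_apply fun _ => rfl
  have hfg := stackMap_stackMap_eq (f := θ.symm.toStarAlgHom) (f' := θ.toStarAlgHom)
    (g := StarAlgHom.id ℂ C.Alg) (g' := StarAlgHom.id ℂ C.Alg) θ.apply_symm_apply fun _ => rfl
  have h1 : IsOnSite (stackMap θ.toStarAlgHom (StarAlgHom.id ℂ C.Alg)) := hθ1.stackMap isOnSite_id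
  have h2 : IsOnSite (stackMap θ.symm.toStarAlgHom (StarAlgHom.id ℂ C.Alg)) :=
    hθ2.stackMap isOnSite_id
  have hδ' : IsFDQC (stackAut δ (1 : C.Alg ≃⋆ₐ[ℂ] C.Alg)) := hδ.stackAut
  have hmem : ∀ j x, isoOf _ _ hgf hfg x ∈ (B.stack C).sub {j} ↔ x ∈ (A.stack C).sub {j} :=
    fun _ _ => h1.mem_iff hgf h2
  refine ⟨isoOf _ _ hgf hfg, hmem, stackAut δ 1, hδ', fun k x => ?_⟩
  refine (StarAlgEquiv.symm_apply_eq _).2 ?_ |>.symm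
  refine stackMap_conj θ.toStarAlgHom θ.symm.toStarAlgHom (α k) (β k) δ (γ k) (fun x => ?_) x
  rw [h]
  exact (δ.apply_symm_apply _).symm

theorem Equivalent.stablyEquivalent (h : Equivalent α β) : α.StablyEquivalent β :=
  ⟨unitChain, unitChain, triv G _, triv G _, triv_rangeLE, triv_rangeLE, h.stack _⟩

theorem RangeLE.stablyEquivalent (h : β.RangeLE 0) : (α.stack β).StablyEquivalent α :=
  ⟨unitChain, B, triv G _, β, triv_rangeLE, h, equivalent_stack_unit _⟩

/-- An equivalence transports the class along the on-site identification, which preserves supports,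
composed with the inverse of the circuit. -/
theorem HasTwistedClass.of_equivalent {c : KGroup G} (h : α.HasTwistedClass c)
    (he : Equivalent α β) : β.HasTwistedClass c := by
  obtain ⟨θ, hθ, γ, hγ, hβ⟩ := he
  obtain ⟨⟨R, hR⟩, ⟨S, hS⟩⟩ := hγ.isQCA
  obtain ⟨hθ1, hθ2⟩ := isOnSite_of_mem_iff hθ
  exact h.transport (R := max R S) (θ.trans γ.symm)
    (fun X x hx => hS.mono (le_max_right R S) X _ (hθ1.mem_sub hx))
    (fun X x hx => hθ2.mem_sub (hR.mono (le_max_left R S) X _ hx)) hβ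

theorem HasTwistedClass.eq_of_stablyEquivalent [Finite G] {c d : KGroup G}
    (hc : α.HasTwistedClass c) (hd : β.HasTwistedClass d) (h : α.StablyEquivalent β) : c = d := by
  obtain ⟨A', B', α', β', hα', hβ', he⟩ := h
  have h1 := (hc.stack hα'.hasMuClass_one.hasTwistedClass).of_equivalent he
  have h2 := hd.stack hβ'.hasMuClass_one.hasTwistedClass
  simpa using h2.unique h1

end Symmetry

/-! ### The class `Υ` and the monoid of stable equivalence classes -/

namespace SymTriv

variable {G : Type} [Group G]

/-- A choice of the class `[μ]`, computed with flat crossing operators. -/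
noncomputable def upsilon [Finite G] (α : SymTriv G) : KGroup G :=
  α.obstruction.exists_hasTwistedClass.choose

theorem hasTwistedClass_upsilon [Finite G] (α : SymTriv G) : α.sym.HasTwistedClass α.upsilon :=
  α.obstruction.exists_hasTwistedClass.choose_spec

theorem eq_upsilon [Finite G] {α : SymTriv G} {c : KGroup G} (h : α.sym.HasTwistedClass c) :
    c = α.upsilon :=
  α.hasTwistedClass_upsilon.unique h

theorem hasMuClass_stack_regular_iff [Fintype G] [DecidableEq G] (α : SymTriv G) (c : KGroup G) :
    (α.sym.stack (Symmetry.regular G)).HasMuClass c ↔ c = α.upsilon := by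
  have h := α.hasTwistedClass_upsilon.stack_regular
  refine ⟨fun hc => h.unique hc.hasTwistedClass, ?_⟩
  rintro rfl
  obtain ⟨j, L, r, X, hr, hX⟩ := α.obstruction.exists_flat
  obtain ⟨R, hR⟩ := α.sym.exists_rangeLE
  obtain ⟨s, hs, hsc⟩ := hX.exists_covariant hR hr
  obtain ⟨Φ, hΦ, -⟩ := hs.exists_fusion hR.stack_regular
  obtain ⟨μ, hμ, hμc⟩ := hsc.exists_fusionPhase hΦ
  have hm : (α.sym.stack (Symmetry.regular G)).HasMuClass (muClass hμc) :=
    ⟨_, _, s, Φ, μ, hμc, hs, hsc, hΦ, hμ, rfl⟩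
  rwa [← h.unique hm.hasTwistedClass]

/-- The stack of two symmetries with trivial obstruction. -/
noncomputable def stack [Finite G] (α β : SymTriv G) : SymTriv G :=
  ⟨_, α.sym.stack β.sym,
    (α.hasTwistedClass_upsilon.stack β.hasTwistedClass_upsilon).hasObstruction⟩

theorem upsilon_stack [Finite G] (α β : SymTriv G) :
    (α.stack β).upsilon = α.upsilon * β.upsilon :=
  (eq_upsilon (α.hasTwistedClass_upsilon.stack β.hasTwistedClass_upsilon)).symm

theorem upsilon_eq_of_rel [Finite G] {α β : SymTriv G} (h : α.Rel β) : α.upsilon = β.upsilon :=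
  α.hasTwistedClass_upsilon.eq_of_stablyEquivalent β.hasTwistedClass_upsilon h

/-- A symmetry of range `0`, whose obstruction is trivial. -/
def ofRangeZero [Finite G] {A : SpinChain} {α : Symmetry G A} (h : α.RangeLE 0) : SymTriv G :=
  ⟨A, α, h.hasMuClass_one.hasTwistedClass.hasObstruction⟩

theorem mk_eq_of_equivalent {α β : SymTriv G} (h : Symmetry.Equivalent α.sym β.sym) :
    Quot.mk Rel α = Quot.mk Rel β :=
  Quot.sound h.stablyEquivalent

variable [Finite G]

theorem mk_stack_comm (α β : SymTriv G) :
    Quot.mk Rel (α.stack β) = Quot.mk Rel (β.stack α) :=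
  mk_eq_of_equivalent (Symmetry.equivalent_comm α.sym β.sym)

theorem mk_stack_assoc (α β γ : SymTriv G) :
    Quot.mk Rel ((α.stack β).stack γ) = Quot.mk Rel (α.stack (β.stack γ)) :=
  mk_eq_of_equivalent (Symmetry.equivalent_assoc α.sym β.sym γ.sym)

theorem mk_stack_eq_of_equivalent {α β : SymTriv G} (h : Symmetry.Equivalent α.sym β.sym)
    (γ : SymTriv G) : Quot.mk Rel (α.stack γ) = Quot.mk Rel (β.stack γ) :=
  mk_eq_of_equivalent (h.stack γ.sym)

theorem mk_stack_ofRangeZero (α : SymTriv G) {B : SpinChain} {β : Symmetry G B}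
    (h : β.RangeLE 0) : Quot.mk Rel (α.stack (ofRangeZero h)) = Quot.mk Rel α :=
  Quot.sound h.stablyEquivalent

/-- Stacking with a symmetry of range `0` inside a stack does not change the stable class. -/
theorem mk_stack_ofRangeZero_stack (α γ : SymTriv G) {B : SpinChain} {β : Symmetry G B}
    (h : β.RangeLE 0) :
    Quot.mk Rel ((α.stack (ofRangeZero h)).stack γ) = Quot.mk Rel (α.stack γ) :=
  calc Quot.mk Rel ((α.stack (ofRangeZero h)).stack γ)
      = Quot.mk Rel (((ofRangeZero h).stack α).stack γ) :=
        mk_stack_eq_of_equivalent (Symmetry.equivalent_comm α.sym β) γ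
    _ = Quot.mk Rel ((ofRangeZero h).stack (α.stack γ)) := mk_stack_assoc _ _ _
    _ = Quot.mk Rel ((α.stack γ).stack (ofRangeZero h)) := mk_stack_comm _ _
    _ = Quot.mk Rel (α.stack γ) := mk_stack_ofRangeZero _ h

/-- The symmetries of range `0` that witness `α ∼ β` are moved past `γ` and dropped. -/
theorem mk_stack_eq_of_rel {α β : SymTriv G} (h : α.Rel β) (γ : SymTriv G) :
    Quot.mk Rel (α.stack γ) = Quot.mk Rel (β.stack γ) := by
  obtain ⟨A', B', α', β', hα', hβ', he⟩ := h
  rw [← mk_stack_ofRangeZero_stack α γ hα', ← mk_stack_ofRangeZero_stack β γ hβ']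
  exact mk_stack_eq_of_equivalent (α := α.stack (ofRangeZero hα'))
    (β := β.stack (ofRangeZero hβ')) he γ

/-- The commutative monoid of stable equivalence classes under stacking. -/
noncomputable abbrev commMonoid : CommMonoid (Quot (Rel (G := G))) where
  mul a b := Quot.lift₂ (fun α β => Quot.mk Rel (stack α β))
    (fun γ _ _ h => (mk_stack_comm _ _).trans ((mk_stack_eq_of_rel h γ).trans (mk_stack_comm _ _)))
    (fun _ _ γ h => mk_stack_eq_of_rel h γ) a b
  mul_assoc := by
    rintro ⟨α⟩ ⟨β⟩ ⟨γ⟩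
    exact mk_stack_assoc α β γ
  one := Quot.mk Rel (ofRangeZero (Symmetry.triv_rangeLE (G := G) (A := unitChain)))
  one_mul := by
    rintro ⟨α⟩
    exact (mk_stack_comm _ _).trans (mk_stack_ofRangeZero α _)
  mul_one := by
    rintro ⟨α⟩
    exact mk_stack_ofRangeZero α _
  mul_comm := by
    rintro ⟨α⟩ ⟨β⟩
    exact mk_stack_comm α β

attribute [local instance] commMonoid in
/-- The homomorphism of monoids induced by `Υ`. -/
noncomputable def upsilonHom : Quot (Rel (G := G)) →* KGroup G where
  toFun := Quot.lift upsilon fun _ _ h => upsilon_eq_of_rel h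
  map_one' := (eq_upsilon (α := ofRangeZero Symmetry.triv_rangeLE)
    Symmetry.triv_rangeLE.hasMuClass_one.hasTwistedClass).symm
  map_mul' := by
    rintro ⟨α⟩ ⟨β⟩
    exact α.upsilon_stack β

end SymTriv

end SpinChains

open SpinChains in
theorem mainTheorem7 (G : Type) [Group G] [Fintype G] [DecidableEq G] :
    -- right restrictions have fusion operators, supported near the site of the restriction
    (∀ (A : SpinChain) (α : Symmetry G A) (R : ℕ) (j : ℤ) (L : ℕ)
        (r : G → (A.Alg ≃⋆ₐ[ℂ] A.Alg)), α.RangeLE R → α.IsRightRestriction j L r →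
      ∃ Φ : G → G → A.Alg, Symmetry.IsFusion r Φ ∧
        ∀ g h, Φ g h ∈ A.sub (Set.Icc (j - L) (j + L + R))) ∧
    -- for covariant right restrictions the phases `μ` exist, are unique and form a 1-cocycle
    (∀ (A : SpinChain) (α : Symmetry G A) (j : ℤ) (L : ℕ) (r : G → (A.Alg ≃⋆ₐ[ℂ] A.Alg))
        (Φ : G → G → A.Alg), α.IsRightRestriction j L r → α.IsCovariant r →
        Symmetry.IsFusion r Φ →
      (∃! μ : G → U1GG G, α.IsFusionPhase Φ μ) ∧
        ∀ μ : G → U1GG G, α.IsFusionPhase Φ μ → groupCohomology.IsMulCocycle₁ μ) ∧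
    Finite (KGroup G) ∧
    ∃ Υ : SymTriv G → KGroup G,
      -- `Υ(α)` is the class `[μ]` for all choices; choices exist after stacking with `ρ_reg`
      (∀ (α : SymTriv G) (c : KGroup G),
        (α.sym.stack (Symmetry.regular G)).HasMuClass c ↔ c = Υ α) ∧
      (∀ (α : SymTriv G) (c : KGroup G), α.sym.HasMuClass c → c = Υ α) ∧
      -- decoupled symmetries
      (∀ (A : SpinChain) (α : Symmetry G A), α.IsDecoupled →
        ∃ h : α.HasObstruction 1, Υ ⟨A, α, h⟩ = 1) ∧
      -- local computability
      (∀ (A : SpinChain) (α β : Symmetry G A) (hα : α.HasObstruction 1)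
          (hβ : β.HasObstruction 1) (R : ℕ), α.RangeLE R → β.RangeLE R →
        (∃ a : ℤ, ∀ g, ∀ x ∈ A.sub (Set.Icc a (a + 12 * R)), α g x = β g x) →
        Υ ⟨A, α, hα⟩ = Υ ⟨A, β, hβ⟩) ∧
      -- multiplicativity under stacking
      (∀ α β : SymTriv G, ∃ h : (α.sym.stack β.sym).HasObstruction 1,
        Υ ⟨_, α.sym.stack β.sym, h⟩ = Υ α * Υ β) ∧
      -- invariance under stable equivalence
      (∀ α β : SymTriv G, α.sym.StablyEquivalent β.sym → Υ α = Υ β) ∧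
      -- the induced homomorphism of monoids
      ∃ _ : CommMonoid (Quot (SymTriv.Rel (G := G))),
        (∀ (α β : SymTriv G) (h : (α.sym.stack β.sym).HasObstruction 1),
          Quot.mk SymTriv.Rel α * Quot.mk SymTriv.Rel β =
            Quot.mk SymTriv.Rel ⟨_, α.sym.stack β.sym, h⟩) ∧
        (∀ h : (Symmetry.triv G SpinChain.unitChain).HasObstruction 1,
          (1 : Quot (SymTriv.Rel (G := G))) = Quot.mk SymTriv.Rel ⟨_, _, h⟩) ∧
        ∃ F : Quot (SymTriv.Rel (G := G)) →* KGroup G,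
          ∀ α : SymTriv G, F (Quot.mk SymTriv.Rel α) = Υ α := by 
  refine ⟨fun A α R j L r hα hr => ?_, fun A α j L r Φ hr hc hΦ => ⟨?_, fun μ hμ => ?_⟩,
    finite_KGroup, SymTriv.upsilon, SymTriv.hasMuClass_stack_regular_iff,
    fun α c hc => SymTriv.eq_upsilon hc.hasTwistedClass, fun A α hα => ?_,
    fun A α β hα hβ R hαR hβR h => ?_, fun α β => ⟨(α.stack β).obstruction, α.upsilon_stack β⟩,
    fun α β h => SymTriv.upsilon_eq_of_rel h, SymTriv.commMonoid, fun α β h => rfl, fun h => rfl,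
    SymTriv.upsilonHom, fun α => rfl⟩
  · obtain ⟨Φ, hΦ, hm⟩ := hr.exists_fusion hα
    exact ⟨Φ, hΦ, fun g h => SpinChain.sub_mono Set.Ico_subset_Icc_self (hm g h)⟩
  · obtain ⟨μ, hμ, -⟩ := hc.exists_fusionPhase hΦ
    refine ⟨μ, hμ, fun ν hν => funext fun k => funext fun g => funext fun h => ?_⟩
    exact phase_unique (hΦ g h).1.1 ((hν g h k).symm.trans (hμ g h k))
  · exact (Symmetry.isTwistedPhase_one_iff.2 hμ).isMulCocycle hc.isFlatCrossing hΦ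
  · have h := hα.hasMuClass_one.hasTwistedClass
    exact ⟨h.hasObstruction, (SymTriv.eq_upsilon (α := ⟨A, α, h.hasObstruction⟩) h).symm⟩
  · obtain ⟨a, ha⟩ := h
    exact (SymTriv.hasTwistedClass_upsilon ⟨A, α, hα⟩).eq_of_eq_on_Icc
      (SymTriv.hasTwistedClass_upsilon ⟨A, β, hβ⟩) hαR hβR a ha
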